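/- Let $k$ be an algebraically closed field of characteristic $0$ and let $m\ge 1$ be an integer. *Setup.* Let $f=(f_1,\dots,f_{N-1})$ be an isolated complete intersection curve singularity germ, $f_i\in k[[x_1,\dots,x_N]]$, and let $\delta_1,\dots,\delta_d\in k[[x_1,\dots,x_N]]^{N-1}$ represent a $k$-basis of the space of first-order deformations $\mathrm{Def}^1(f)=k[[x]]^{N-1}/\big((f)\,k[[x]]^{N-1}+\langle \partial f/\partial x_1,\dots,\partial f/\partial x_N\rangle\big)$. A one-parameter deformation $X/B$ of $f$ is given by $a\in k^d$: $\mathcal O_B=k[[t]]$ and $\mathcal O_X=k[[x_1,\dots,x_N]][[t]]/(f+t\sum_l a_l\delta_l)$. Let $\mathcal P^m=(\mathcal O_X\,\widehat\otimes_{\mathcal O_B}\,\mathcal O_X)/I_\Delta^m$ be the complete module of principal parts, where $I_\Delta$ is the ideal of the diagonal, viewed as an $\mathcal O_X$-module through the left factor. When $(\mathcal P^m)^\vee=\mathrm{Hom}_{\mathcal O_X}(\mathcal P^m,\mathcal O_X)$ is free with basis $e_1,\dots,e_m$ (as holds for general $a$) and $\bar\tau=(\tau_1,\dots,\tau_n)$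 is a list of elements of $\mathcal P^m$, let $I_{\bar\tau}\subset\mathcal O_X$ be the ideal generated by the maximal minors of the $m\times n$ matrix $(e_i(\tau_l))$; it does not depend on the basis. The automatic degeneracies of order $m$ of $f$ are $$\mathrm{AD}^m_{(1)}(f)=\min \dim_k\mathcal O_X/(t,I_{\bar\tau})\ \ (n=m),$$ $$\mathrm{AD}^m_{(2)}(f)=\min \dim_k\mathcal O_X/I_{\bar\tau}\ \ (n=m-1),\qquad \mathrm{AD}^m_{(1,1)}(f)=\min \dim_k\mathcal O_X/I_{\bar\tau}\ \ (n=m+1),$$ where the minima are taken over all one-parameter deformations $X/B$ of $f$ for which $(\mathcal P^m)^\vee$ is free of rank $m$ and over all lists $\bar\tau$ of $n$ elements of $\mathcal P^m$. For a general one-parameter deformation and any list $\bar\tau$ of $m$ elements attaining $\mathrm{AD}^m_{(1)}(f)$, the number of weight-$1$ inflection points of order $m$ limiting to the singularity is the multiplicity $\dim_K\big((\mathcal O_X/I_{\bar\tau})\otimes_{k[[t]]}K\big)$ of the degeneracy locus on the geometric generic fibre, where $K$ is an algebraic closure of $k((t))$. **Theorem.** For the node, i.e. the germ $f=xy\in k[[x,y]]$,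 and every choice of representatives of a basis of $\mathrm{Def}^1(xy)$: (a) $\mathrm{AD}^m_{(1)}(xy)=m(m-1)$. Moreover, for a general one-parameter deformation of the node there are lists $\bar\tau$ attaining this minimum, and for each of them the number of weight-$1$ inflection points of order $m$ limiting to the node is $m(m-1)$. (b) $\mathrm{AD}^m_{(2)}(xy)=\binom{m+1}{4}$ and $\mathrm{AD}^m_{(1,1)}(xy)=\binom{m+2}{4}$. -/

import Mathlib

open scoped TensorProduct

noncomputable section

namespace AutomaticDegeneracy

/-! ### First-order deformations of a germ -/

section Deformations

variable {k : Type*} [Field k] {N c : ℕ}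

/-- For a germ `f = (f₁, …, f_c)` in `k⟦x₁, …, x_N⟧`, the submodule of `k⟦x⟧ ^ c` generated by all
vectors with entries in the ideal `(f)` and by the partial derivatives `∂f/∂x_j`. -/
def trivialDeformations (f : Fin c → MvPowerSeries (Fin N) k) :
    Submodule (MvPowerSeries (Fin N) k) (Fin c → MvPowerSeries (Fin N) k) :=
  Ideal.span (Set.range f) • ⊤ ⊔
    Submodule.span (MvPowerSeries (Fin N) k)
      (Set.range fun (j : Fin N) (i : Fin c) => MvPowerSeries.pderiv k j (f i))

/-- The space `Def¹(f)` of first-order deformations of the complete intersection germ `f`, i.e. the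
cokernel of `Der(k⟦x⟧) → Hom((f)/(f)², k⟦x⟧/(f))`, which is `Ext¹(Ω¹, k⟦x⟧/(f))`. -/
abbrev Def1 (f : Fin c → MvPowerSeries (Fin N) k) : Type _ :=
  (Fin c → MvPowerSeries (Fin N) k) ⧸ trivialDeformations f

/-- A list `δ₁, …, δ_d` of elements of `k⟦x⟧ ^ c` whose classes form a `k`-basis of `Def¹(f)`.
It presents the versal deformation `f + ∑ α_l δ_l = 0` over `k⟦α₁, …, α_d⟧`. -/
structure Def1Basis (f : Fin c → MvPowerSeries (Fin N) k) where
  /-- the dimension of `Def¹(f)` -/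
  d : ℕ
  /-- representatives of the basis vectors -/
  δ : Fin d → Fin c → MvPowerSeries (Fin N) k
  linearIndependent : LinearIndependent k fun l => (Submodule.Quotient.mk (δ l) : Def1 f)
  span_eq_top : Submodule.span k (Set.range fun l => (Submodule.Quotient.mk (δ l) : Def1 f)) = ⊤

/-- The equations `f_i + t ∑_l a_l δ_{l,i}` in `k⟦x⟧⟦t⟧` of the one-parameter deformation obtained
from the versal deformation by `α_l ↦ a_l t`. -/
def deformationEquation {f : Fin c → MvPowerSeries (Fin N) k} (V : Def1Basis f)
    (a : Fin V.d → k) (i : Fin c) : PowerSeries (MvPowerSeries (Fin N) k) :=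
  PowerSeries.C (f i) + PowerSeries.X * PowerSeries.C (∑ l, a l • V.δ l i)

/-- The coordinate ring `𝒪_X = k⟦x⟧⟦t⟧ / (f + t ∑_l a_l δ_l)` of the total space of the
one-parameter deformation with direction `a`. It is an algebra over `𝒪_B = k⟦t⟧`. -/
abbrev TotalRing {f : Fin c → MvPowerSeries (Fin N) k} (V : Def1Basis f) (a : Fin V.d → k) :
    Type _ :=
  PowerSeries (MvPowerSeries (Fin N) k) ⧸ Ideal.span (Set.range (deformationEquation V a))

end Deformations

/-! ### Principal parts and degeneracy ideals -/

/-- For an `A`-algebra `S` the ring `(S ⊗_A S) / I_Δ ^ m`, where `I_Δ` is the kernel of the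
multiplication map. It is an `S`-module through the left factor. -/
abbrev AlgebraicPrincipalParts (A S : Type*) [CommRing A] [CommRing S] [Algebra A S] (m : ℕ) :
    Type _ :=
  (S ⊗[A] S) ⧸ (KaehlerDifferential.ideal A S) ^ m

/-- The complete module of principal parts `𝒫^m_{S/A} = (S ⊗̂_A S) / I_Δ ^ m`: the completion of
`(S ⊗_A S) / I_Δ ^ m` along the Jacobson radical of `S`, which is the maximal ideal of `S` when `S`
is local. -/
abbrev PrincipalParts (A S : Type*) [CommRing A] [CommRing S] [Algebra A S] (m : ℕ) : Type _ :=
  AdicCompletion (Ideal.jacobson (⊥ : Ideal S)) (AlgebraicPrincipalParts A S m)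

/-- The ideal generated by the maximal minors of a matrix. -/
def maximalMinorsIdeal {S : Type*} [CommRing S] {m n : ℕ} (M : Matrix (Fin m) (Fin n) S) :
    Ideal S :=
  Ideal.span {x | ∃ (p : Fin (min m n) ↪o Fin m) (q : Fin (min m n) ↪o Fin n),
    x = (M.submatrix p q).det}

/-- The ideal of the degeneracy locus of the map `S ^ n → 𝒫 → 𝒫ᵛᵛ` given by a list `τ` of `n`
elements of `𝒫 = 𝒫^m_{S/A}`, computed with a basis `e` of `𝒫ᵛ`: it is generated by the maximal
minors of the matrix `(e_i(τ_l))`. It does not depend on `e`. -/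
def degeneracyIdeal {A S : Type*} [CommRing A] [CommRing S] [Algebra A S] {m n : ℕ}
    (e : Module.Basis (Fin m) S (Module.Dual S (PrincipalParts A S m)))
    (τ : Fin n → PrincipalParts A S m) : Ideal S :=
  maximalMinorsIdeal (Matrix.of fun i l => e i (τ l))

/-! ### Automatic degeneracies -/

section Degeneracies

variable {k : Type*} [Field k] {N c : ℕ} {f : Fin c → MvPowerSeries (Fin N) k}

/-- The `k`-dimension of `𝒪_X / I`, with value `⊤` if it is infinite. -/
def colength (V : Def1Basis f) (a : Fin V.d → k) (I : Ideal (TotalRing V a)) : ℕ∞ :=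
  Cardinal.toENat (Module.rank k (TotalRing V a ⧸ I))

/-- The ideal of the special fibre `X₀` in `𝒪_X`. -/
def specialFibreIdeal (V : Def1Basis f) (a : Fin V.d → k) : Ideal (TotalRing V a) :=
  Ideal.span {algebraMap (PowerSeries k) (TotalRing V a) PowerSeries.X}

/-- The weight-one automatic degeneracy of order `m`: the minimum of `dim_k 𝒪_X / (I_{X₀} + I_τ)`
over all one-parameter deformations (for which `𝒫ᵛ` is free of rank `m`, as it is for a general
one, so that the degeneracy ideal is defined) and all lists `τ` of `m` elements of `𝒫`. -/
def AD1 (V : Def1Basis f) (m : ℕ) : ℕ∞ :=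
  sInf {r : ℕ∞ | ∃ (a : Fin V.d → k)
    (e : Module.Basis (Fin m) (TotalRing V a)
      (Module.Dual (TotalRing V a) (PrincipalParts (PowerSeries k) (TotalRing V a) m)))
    (τ : Fin m → PrincipalParts (PowerSeries k) (TotalRing V a) m),
    r = colength V a (specialFibreIdeal V a ⊔ degeneracyIdeal e τ)}

/-- The minimum of `dim_k 𝒪_X / I_τ` over all one-parameter deformations (for which `𝒫ᵛ` is free of
rank `m`) and all lists `τ` of `n` elements of `𝒫`. -/
def minColength (V : Def1Basis f) (m n : ℕ) : ℕ∞ :=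
  sInf {r : ℕ∞ | ∃ (a : Fin V.d → k)
    (e : Module.Basis (Fin m) (TotalRing V a)
      (Module.Dual (TotalRing V a) (PrincipalParts (PowerSeries k) (TotalRing V a) m)))
    (τ : Fin n → PrincipalParts (PowerSeries k) (TotalRing V a) m),
    r = colength V a (degeneracyIdeal e τ)}

/-- The weight-two type-(a) automatic degeneracy of order `m ≥ 1` (lists of `m - 1` elements). -/
def AD2 (V : Def1Basis f) (m : ℕ) : ℕ∞ := minColength V m (m - 1)

/-- The weight-two type-(b) automatic degeneracy of order `m` (lists of `m + 1` elements). -/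
def AD11 (V : Def1Basis f) (m : ℕ) : ℕ∞ := minColength V m (m + 1)

/-- The multiplicity of the intersection of the subscheme `I` of `X` with the geometric generic
fibre of `X / B`: the dimension of `(𝒪_X / I) ⊗ K` over an algebraic closure `K` of `k((t))`. -/
def genericFibreMultiplicity (V : Def1Basis f) (a : Fin V.d → k) (I : Ideal (TotalRing V a)) :
    ℕ∞ :=
  Cardinal.toENat (Module.rank (AlgebraicClosure (LaurentSeries k))
    (AlgebraicClosure (LaurentSeries k) ⊗[PowerSeries k] (TotalRing V a ⧸ I)))

/-- In a general one-parameter deformation of `f`, the number of weight-one inflection points of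
order `m` limiting to the singularity is `r`: for all directions `a` outside the zero set of some
nonzero polynomial there are lists `τ` of `m` elements of `𝒫` attaining the minimum that defines the
weight-one automatic degeneracy, and for every such list the degeneracy locus meets the geometric
generic fibre with multiplicity `r`. -/
def LimitingWeightOneCount (V : Def1Basis f) (m : ℕ) (r : ℕ∞) : Prop :=
  ∃ p : MvPolynomial (Fin V.d) k, p ≠ 0 ∧ ∀ a : Fin V.d → k, MvPolynomial.eval a p ≠ 0 →
    (∃ (e : Module.Basis (Fin m) (TotalRing V a)
        (Module.Dual (TotalRing V a) (PrincipalParts (PowerSeries k) (TotalRing V a) m)))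
      (τ : Fin m → PrincipalParts (PowerSeries k) (TotalRing V a) m),
      colength V a (specialFibreIdeal V a ⊔ degeneracyIdeal e τ) = AD1 V m) ∧
    ∀ (e : Module.Basis (Fin m) (TotalRing V a)
        (Module.Dual (TotalRing V a) (PrincipalParts (PowerSeries k) (TotalRing V a) m)))
      (τ : Fin m → PrincipalParts (PowerSeries k) (TotalRing V a) m),
      colength V a (specialFibreIdeal V a ⊔ degeneracyIdeal e τ) = AD1 V m →
        genericFibreMultiplicity V a (degeneracyIdeal e τ) = r

end Degeneracies

/-! ### The node -/

/-- The germ `xy` of a node in `k⟦x, y⟧`. -/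
def node (k : Type*) [Field k] : Fin 1 → MvPowerSeries (Fin 2) k :=
  fun _ => MvPowerSeries.X 0 * MvPowerSeries.X 1

theorem exists_eq_X_mul_add_X_mul {k : Type*} [Field k] (h : MvPowerSeries (Fin 2) k)
    (h0 : MvPowerSeries.constantCoeff h = 0) :
    ∃ q r : MvPowerSeries (Fin 2) k, h = MvPowerSeries.X 0 * q + MvPowerSeries.X 1 * r := by
  classical
  let g : MvPowerSeries (Fin 2) k := fun n => if n 0 = 0 then MvPowerSeries.coeff n h else 0
  have hg : ∀ n, MvPowerSeries.coeff n g = if n 0 = 0 then MvPowerSeries.coeff n h else 0 :=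
    fun n => rfl
  have h1 : (MvPowerSeries.X 0 : MvPowerSeries (Fin 2) k) ∣ h - g := by
    rw [MvPowerSeries.X_dvd_iff]
    intro n hn
    rw [map_sub, hg, if_pos hn, sub_self]
  have h2 : (MvPowerSeries.X 1 : MvPowerSeries (Fin 2) k) ∣ g := by
    rw [MvPowerSeries.X_dvd_iff]
    intro n hn
    rw [hg]
    split_ifs with hn0
    · have : n = 0 := by
        ext i
        fin_cases i
        · exact hn0
        · exact hn
      rw [this, MvPowerSeries.coeff_zero_eq_constantCoeff_apply, h0]
    · rfl
  obtain ⟨q, hq⟩ := h1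
  obtain ⟨r, hr⟩ := h2
  exact ⟨q, r, by rw [← hq, ← hr, sub_add_cancel]⟩

theorem mem_trivialDeformations_node {k : Type*} [Field k] (v : Fin 1 → MvPowerSeries (Fin 2) k) :
    v ∈ trivialDeformations (node k) ↔ MvPowerSeries.constantCoeff (v 0) = 0 := by
  have hd0 : ∀ i, MvPowerSeries.pderiv k 0 (node k i) = MvPowerSeries.X 1 := by
    intro i
    simp [node, Derivation.leibniz]
  have hd1 : ∀ i, MvPowerSeries.pderiv k 1 (node k i) = MvPowerSeries.X 0 := by
    intro i
    simp [node, Derivation.leibniz]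
  constructor
  · intro hv
    let K : Submodule (MvPowerSeries (Fin 2) k) (Fin 1 → MvPowerSeries (Fin 2) k) :=
      Submodule.comap (LinearMap.proj 0)
        (RingHom.ker (MvPowerSeries.constantCoeff (σ := Fin 2) (R := k)))
    have hle : trivialDeformations (node k) ≤ K := by
      refine sup_le ?_ ?_
      · rw [Submodule.smul_le]
        intro r hr w _
        have hr' : r ∈ RingHom.ker (MvPowerSeries.constantCoeff (σ := Fin 2) (R := k)) := by
          refine (Ideal.span_le.2 ?_) hr
          rintro _ ⟨i, rfl⟩
          simp [node, RingHom.mem_ker]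
        change MvPowerSeries.constantCoeff (r * w 0) = 0
        rw [map_mul, RingHom.mem_ker.1 hr', zero_mul]
      · rw [Submodule.span_le]
        rintro _ ⟨j, rfl⟩
        change MvPowerSeries.constantCoeff (MvPowerSeries.pderiv k j (node k 0)) = 0
        fin_cases j
        · exact (congrArg _ (hd0 0)).trans (MvPowerSeries.constantCoeff_X 1)
        · exact (congrArg _ (hd1 0)).trans (MvPowerSeries.constantCoeff_X 0)
    exact hle hv
  · intro hv
    obtain ⟨q, r, hqr⟩ := exists_eq_X_mul_add_X_mul (v 0) hv
    have hv' : v = q • (fun i => MvPowerSeries.pderiv k 1 (node k i)) +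
        r • (fun i => MvPowerSeries.pderiv k 0 (node k i)) := by
      funext i
      rw [Subsingleton.elim i 0]
      simp only [Pi.add_apply, Pi.smul_apply, hd0, hd1, smul_eq_mul]
      rw [hqr]
      ring
    rw [hv']
    refine Submodule.mem_sup_right (add_mem ?_ ?_) <;>
      exact Submodule.smul_mem _ _ (Submodule.subset_span ⟨_, rfl⟩)

/-- The class of `1` is a basis of `Def¹(xy)`. -/
def nodeDef1Basis (k : Type*) [Field k] : Def1Basis (node k) where
  d := 1
  δ := fun _ _ => 1
  linearIndependent := by
    rw [linearIndependent_unique_iff, Ne, Submodule.Quotient.mk_eq_zero,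
      mem_trivialDeformations_node]
    simp
  span_eq_top := by
    rw [eq_top_iff]
    rintro w -
    obtain ⟨v, rfl⟩ := Submodule.Quotient.mk_surjective _ w
    have : (Submodule.Quotient.mk v : Def1 (node k)) =
        MvPowerSeries.constantCoeff (v 0) •
          (Submodule.Quotient.mk (fun _ => 1) : Def1 (node k)) := by
      rw [← Submodule.Quotient.mk_smul, Submodule.Quotient.eq, mem_trivialDeformations_node]
      simp
    rw [this]
    exact Submodule.smul_mem _ _ (Submodule.subset_span ⟨0, rfl⟩)

end AutomaticDegeneracy

end

/-! Modulo trivial deformations only the constant term of a perturbation of `xy` survives. A nonzero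
direction therefore gives `xy + tu = 0` with `u` a unit, and its total ring is `k⟦x, y⟧` with, after
rescaling one coordinate, `t = xy` (`nonempty_smoothingChart`). The zero direction gives a dual that
is not free once `m > 1` (`isEmpty_basis_dual_of_mul_eq_zero`), so only smoothings matter; for `m =
1` all asserted lower bounds are zero.

On a smoothing, the field `θ = x ∂/∂x - y ∂/∂y` kills `t`, and `1, θ, …, θ^(m-1)` induce a basis of
the dual of the principal parts (`exists_dual_basis`). Every function is a limit of
`k⟦t⟧`-combinations of the weight vectors `z n`, equal to `x ^ n` for `n ≥ 0` and `y ^ (-n)` for `n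
< 0`, and every functional sends the jet of `z n` to a multiple of `z n` (`z_dvd_dual_jet`).

Lower bounds: expanding a minor of size `s` over weights, only families of `s` distinct weights
survive alternation. Such a product of `z n` is divisible by some `x ^ (a(a+1)/2) y ^ (b(b+1)/2)`
with `a + b + 1 = s`. Hence all minors lie in `cornerIdeal` (`det_mem_cornerIdeal`), whose colength,
counted under its staircase, is `(s + 2).choose 4`. Taking `s = m - 1` and `s = m` gives (b). For `n
= m` and `N = m.choose 2`, an element `g` of the corner ideal is, modulo `(xy, x ^ (N+1), y ^
(N+1))`, killed by `x` and `y`. It thus lowers the dimension `2N + 1` of that quotient by at most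
one, leaving `2N = m(m-1)`.

Sharpness: take the list `1, x ^ i + y ^ (n - i)` for `0 < i < n`. Its minors expand into monomials
times Vandermonde determinants of distinct integers, which are units in characteristic zero.
Nakayama's lemma recovers the whole corner ideal when `n = m ± 1`. When `n = m` the determinant is a
unit times `x ^ N` plus a unit times `y ^ N` modulo `xy`.

Limiting count: finite length on the special fibre makes the equation `g` of the degeneracy locus
coprime to `t`. Then `𝒪_X / (g)` is finite free over `k⟦t⟧`, and its generic rank equals the special
length (`nonempty_basis_quotient`). -/

open scoped TensorProduct

namespace AutomaticDegeneracy

/-! ### Functionals on principal parts -/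

section PrincipalParts

variable {A S : Type*} [CommRing A] [CommRing S] [Algebra A S] {m : ℕ}

variable (A m) in
/-- The jet of a function `f`: the image of `1 ⊗ f` in the complete module of principal parts. -/
noncomputable def jet (f : S) : PrincipalParts A S m :=
  AdicCompletion.of _ _ (Ideal.Quotient.mk _ ((1 : S) ⊗ₜ[A] f))

theorem of_mk_tmul (s f : S) :
    (AdicCompletion.of _ _ (Ideal.Quotient.mk _ (s ⊗ₜ[A] f)) : PrincipalParts A S m) =
      s • jet A m f := by
  rw [jet, ← map_smul]
  congr 1
  change _ = Ideal.Quotient.mk _ (s • ((1 : S) ⊗ₜ[A] f))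
  rw [TensorProduct.smul_tmul', smul_eq_mul, mul_one]

theorem jet_add (f g : S) : jet A m (f + g) = jet A m f + jet A m g := by
  simp [jet, TensorProduct.tmul_add]

theorem jet_algebraMap_mul (a : A) (f : S) :
    jet A m (algebraMap A S a * f) = algebraMap A S a • jet A m f := by
  rw [← of_mk_tmul, jet, ← Algebra.smul_def, ← TensorProduct.smul_tmul, Algebra.smul_def, mul_one]

theorem exists_mem_span_jet (hJ : (Ideal.jacobson (⊥ : Ideal S)).FG) (τ : PrincipalParts A S m)
    (n : ℕ) :
    ∃ p ∈ Submodule.span S (Set.range (jet A m : S → PrincipalParts A S m)),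
      τ - p ∈ ((Ideal.jacobson (⊥ : Ideal S)) ^ n • ⊤ : Submodule S (PrincipalParts A S m)) := by
  obtain ⟨q, hq⟩ := Submodule.Quotient.mk_surjective _ (AdicCompletion.eval _ _ n τ)
  refine ⟨AdicCompletion.of _ _ q, ?_, ?_⟩
  · obtain ⟨q, rfl⟩ := Ideal.Quotient.mk_surjective q
    clear hq
    induction q with
    | zero => simp
    | add a b ha hb => rw [map_add, map_add]; exact add_mem ha hb
    | tmul a b =>
      rw [of_mk_tmul]
      exact Submodule.smul_mem _ _ (Submodule.subset_span ⟨b, rfl⟩)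
  · rw [AdicCompletion.pow_smul_top_eq_ker_eval hJ, LinearMap.mem_ker, map_sub, ← hq,
      AdicCompletion.eval_of, Submodule.mkQ_apply, sub_self]

theorem map_mem_of_mem_smul_top {P : Type*} [AddCommGroup P] [Module S P] (I : Ideal S)
    (D : P →ₗ[S] S) {τ : P} (h : τ ∈ (I • ⊤ : Submodule S P)) : D τ ∈ I := by
  induction h using Submodule.smul_induction_on' with
  | smul r hr n _ =>
    rw [map_smul]
    exact I.mul_mem_right _ hr
  | add x _ y _ hx hy =>
    rw [map_add]
    exact add_mem hx hy

/-- Completing `D` gives a map into the completion of `S`, which is `S` itself. -/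
theorem exists_extension [IsAdicComplete (Ideal.jacobson (⊥ : Ideal S)) S]
    (D : AlgebraicPrincipalParts A S m →ₗ[S] S) :
    ∃ D' : Module.Dual S (PrincipalParts A S m), ∀ q, D' (AdicCompletion.of _ _ q) = D q := by
  refine ⟨(AdicCompletion.ofLinearEquiv (Ideal.jacobson (⊥ : Ideal S)) S).symm.toLinearMap ∘ₗ
    (AdicCompletion.map (Ideal.jacobson (⊥ : Ideal S)) D).restrictScalars S, fun q => ?_⟩
  simp [AdicCompletion.map_of]

/-- Combinations of jets are dense, a linear functional is adically continuous, and `S` is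
separated. -/
theorem dual_ext_jet [IsHausdorff (Ideal.jacobson (⊥ : Ideal S)) S]
    (hJ : (Ideal.jacobson (⊥ : Ideal S)).FG)
    {D D' : Module.Dual S (PrincipalParts A S m)} (h : ∀ f, D (jet A m f) = D' (jet A m f)) :
    D = D' := by
  refine LinearMap.ext fun τ => ?_
  rw [← sub_eq_zero]
  refine IsHausdorff.haus (I := Ideal.jacobson (⊥ : Ideal S)) inferInstance _ fun n => ?_
  obtain ⟨p, hp, hτ⟩ := exists_mem_span_jet hJ τ n
  have hDp : D p = D' p := by
    clear hτ
    induction hp using Submodule.span_induction with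
    | mem x hx => obtain ⟨f, rfl⟩ := hx; exact h f
    | zero => simp
    | add x y _ _ hx hy => simp [hx, hy]
    | smul a x _ hx => simp [hx]
  rw [SModEq.zero]
  have := map_mem_of_mem_smul_top _ (D - D') hτ
  simpa [hDp] using this

/-- This is `D` applied to `(1 ⊗ s - s ⊗ 1) ^ m * (1 ⊗ f)`, which lies in `I_Δ ^ m`. The resulting
recurrence drives all divisibility and vanishing statements for functionals. -/
theorem sum_pow_mul_jet (D : Module.Dual S (PrincipalParts A S m)) (s f : S) :
    ∑ i ∈ Finset.range (m + 1), (-1) ^ (m - i) * (m.choose i : S) * s ^ (m - i) *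
      D (jet A m (s ^ i * f)) = 0 := by
  have hmem : ((1 : S) ⊗ₜ[A] s + (-s) ⊗ₜ[A] (1 : S)) ^ m * ((1 : S) ⊗ₜ[A] f) ∈
      KaehlerDifferential.ideal A S ^ m := by
    refine Ideal.mul_mem_right _ _ (Ideal.pow_mem_pow ?_ m)
    have := KaehlerDifferential.one_smul_sub_smul_one_mem_ideal A s
    rwa [sub_eq_add_neg, ← TensorProduct.neg_tmul] at this
  have h0 := congrArg (fun q => D (AdicCompletion.of _ _ q)) (Ideal.Quotient.eq_zero_iff_mem.2 hmem)
  simp only [map_zero] at h0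
  rw [← h0, add_pow, Finset.sum_mul, map_sum, map_sum, map_sum]
  refine Finset.sum_congr rfl fun i _ => ?_
  have : ((1 : S) ⊗ₜ[A] s) ^ i * ((-s) ⊗ₜ[A] (1 : S)) ^ (m - i) * (m.choose i : S ⊗[A] S) *
      ((1 : S) ⊗ₜ[A] f) =
      ((-1) ^ (m - i) * (m.choose i : S) * s ^ (m - i)) ⊗ₜ[A] (s ^ i * f) := by
    rw [show (m.choose i : S ⊗[A] S) = (m.choose i : S) ⊗ₜ[A] (1 : S) from
      (Algebra.TensorProduct.natCast_def _)]
    simp only [Algebra.TensorProduct.tmul_pow, Algebra.TensorProduct.tmul_mul_tmul, one_pow,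
      one_mul, mul_one]
    congr 1
    rw [neg_pow]; ring
  rw [this, of_mk_tmul, map_smul, smul_eq_mul]

/-- A functional behaves like a differential operator of order below `m`, so it loses at most `m`
powers of `s`. This makes `f ↦ D (jet f)` continuous and allows truncation of power series. -/
theorem pow_dvd_jet_pow_mul (D : Module.Dual S (PrincipalParts A S m)) (s f : S) (n : ℕ) :
    s ^ n ∣ D (jet A m (s ^ (n + m) * f)) := by
  induction n using Nat.strong_induction_on generalizing f with
  | _ n ih =>
  have h := sum_pow_mul_jet D s (s ^ n * f)
  rw [Finset.sum_range_succ, Nat.sub_self, Nat.choose_self, pow_zero, pow_zero, Nat.cast_one,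
    one_mul, one_mul, one_mul, ← mul_assoc, ← pow_add, add_comm m n, add_comm,
    ← eq_neg_iff_add_eq_zero] at h
  rw [h, dvd_neg]
  refine Finset.dvd_sum fun i hi => ?_
  have hi : i < m := Finset.mem_range.1 hi
  rcases lt_or_ge (m - i) n with hlt | hge
  · have h1 : s ^ i * (s ^ n * f) = s ^ (n - (m - i) + m) * f := by
      rw [← mul_assoc, ← pow_add]; congr 2; omega
    obtain ⟨c, hc⟩ := ih (n - (m - i)) (by omega) f
    rw [h1, hc]
    refine ⟨(-1) ^ (m - i) * (m.choose i : S) * c, ?_⟩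
    have : s ^ n = s ^ (m - i) * s ^ (n - (m - i)) := by rw [← pow_add]; congr 1; omega
    rw [this]; ring
  · exact Dvd.dvd.mul_right (Dvd.dvd.mul_left (pow_dvd_pow s hge) _) _

theorem baseChange_derivation_mul (θ : Derivation A S S) (p q : S ⊗[A] S) :
    θ.toLinearMap.baseChange S (p * q) =
      p * θ.toLinearMap.baseChange S q + q * θ.toLinearMap.baseChange S p := by
  induction p with
  | zero => simp
  | add a b ha hb => rw [add_mul, map_add, ha, hb, map_add]; ring
  | tmul a b =>
    induction q with
    | zero => simp
    | add c d hc hd => rw [mul_add, map_add, hc, hd, map_add]; ring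
    | tmul c d =>
      simp only [Algebra.TensorProduct.tmul_mul_tmul, LinearMap.baseChange_tmul]
      rw [mul_comm c a, ← TensorProduct.tmul_add]
      simp

/-- By the Leibniz rule, `1 ⊗ θ` costs one power of `I`. -/
theorem baseChange_derivation_mem_pow (θ : Derivation A S S) (I : Ideal (S ⊗[A] S)) (n : ℕ)
    {z : S ⊗[A] S} (hz : z ∈ I ^ (n + 1)) : θ.toLinearMap.baseChange S z ∈ I ^ n := by
  induction n generalizing z with
  | zero => simp
  | succ n ih =>
    rw [pow_succ] at hz
    induction hz using Submodule.mul_induction_on' with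
    | mem_mul_mem p hp q hq =>
      rw [baseChange_derivation_mul]
      refine add_mem (Ideal.mul_mem_right _ _ hp) ?_
      rw [pow_succ']
      exact Ideal.mul_mem_mul hq (ih hp)
    | add a _ b _ ha hb => rw [map_add]; exact add_mem ha hb

/-- The functional is multiplication after `(1 ⊗ θ) ^ j`. Since `j < m`, applying `(1 ⊗ θ) ^ j` to
`I_Δ ^ m` still lands in a positive power of `I_Δ`, which multiplication kills. -/
theorem exists_dual_iterate_derivation [IsAdicComplete (Ideal.jacobson (⊥ : Ideal S)) S]
    (θ : Derivation A S S) {j : ℕ} (hj : j < m) :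
    ∃ D : Module.Dual S (PrincipalParts A S m), ∀ f, D (jet A m f) = θ^[j] f := by
  let Θ : Module.End S (S ⊗[A] S) := θ.toLinearMap.baseChange S
  let Φ : S ⊗[A] S →ₗ[S] S := (Algebra.TensorProduct.lmul'' A (S := S)).toLinearMap ∘ₗ Θ ^ j
  have hpow : ∀ i n, ∀ z ∈ KaehlerDifferential.ideal A S ^ (n + i),
      (Θ ^ i) z ∈ KaehlerDifferential.ideal A S ^ n := by
    intro i
    induction i with
    | zero => intro n z hz; simpa using hz
    | succ i ih =>
      intro n z hz
      rw [pow_succ', Module.End.mul_apply]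
      exact baseChange_derivation_mem_pow θ _ _ (ih (n + 1) z (by rwa [add_right_comm]))
  have hker : (KaehlerDifferential.ideal A S ^ m).restrictScalars S ≤ LinearMap.ker Φ := by
    intro z hz
    have h1 := hpow j (m - j) z (by rwa [Nat.sub_add_cancel hj.le])
    have h2 := Ideal.pow_le_self (by omega : m - j ≠ 0) h1
    exact h2
  obtain ⟨D, hD⟩ := exists_extension (A := A) (m := m)
    ((Submodule.liftQ _ Φ hker) ∘ₗ
      (Submodule.Quotient.restrictScalarsEquiv S (KaehlerDifferential.ideal A S ^ m)).symm)
  refine ⟨D, fun f => ?_⟩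
  have hit : ∀ i, (Θ ^ i) ((1 : S) ⊗ₜ[A] f) = 1 ⊗ₜ (θ^[i] f) := by
    intro i
    induction i with
    | zero => simp
    | succ i ih =>
      rw [pow_succ', Module.End.mul_apply, ih, Function.iterate_succ_apply']
      simp [Θ]
  have h3 : D (jet A m f) = Φ (1 ⊗ₜ f) := by
    rw [jet, hD]
    rfl
  rw [h3]
  simp only [Φ, LinearMap.comp_apply, hit]
  exact (Algebra.TensorProduct.lmul'_apply_tmul _ _).trans (one_mul _)

end PrincipalParts

/-! ### Power series in two variables -/

section TwoVariables

variable {k : Type*} [Field k]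

theorem prime_X_zero : Prime (MvPowerSeries.X 0 : MvPowerSeries (Fin 2) k) := by
  have := NoZeroDivisors.to_isDomain (MvPowerSeries (Fin 1) k)
  rw [← MulEquiv.prime_iff (MvPowerSeries.finSuccEquiv k 1), MvPowerSeries.finSuccEquiv_X_zero]
  exact PowerSeries.X_prime

theorem prime_X_one : Prime (MvPowerSeries.X 1 : MvPowerSeries (Fin 2) k) := by
  rw [← MulEquiv.prime_iff (MvPowerSeries.renameEquiv k (Equiv.swap (0 : Fin 2) 1))]
  simpa using prime_X_zero

theorem X_dvd_X_iff {i j : Fin 2} :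
    (MvPowerSeries.X i : MvPowerSeries (Fin 2) k) ∣ MvPowerSeries.X j ↔ i = j := by
  classical
  refine ⟨fun h => ?_, fun h => h ▸ dvd_rfl⟩
  by_contra hij
  have := MvPowerSeries.X_dvd_iff.1 h (Finsupp.single j 1) (by simp [Ne.symm hij])
  simp [MvPowerSeries.coeff_X] at this

theorem maximalIdeal_mvPowerSeries :
    IsLocalRing.maximalIdeal (MvPowerSeries (Fin 2) k) =
      Ideal.span {MvPowerSeries.X 0, MvPowerSeries.X 1} := by
  ext f
  rw [IsLocalRing.mem_maximalIdeal, mem_nonunits_iff, MvPowerSeries.isUnit_iff_constantCoeff,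
    isUnit_iff_ne_zero, not_not, Ideal.mem_span_pair]
  constructor
  · intro h
    obtain ⟨q, r, h⟩ := exists_eq_X_mul_add_X_mul f h
    exact ⟨q, r, by rw [h]; ring⟩
  · rintro ⟨q, r, rfl⟩
    simp

instance isAdicComplete_maximalIdeal_mvPowerSeries :
    IsAdicComplete (IsLocalRing.maximalIdeal (MvPowerSeries (Fin 2) k))
      (MvPowerSeries (Fin 2) k) := by
  have h : IsAdicComplete (.span (.range MvPowerSeries.X) : Ideal (MvPowerSeries (Fin 2) k))
    (MvPowerSeries (Fin 2) k) := inferInstance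
  rw [maximalIdeal_mvPowerSeries]
  have : Set.range (MvPowerSeries.X : Fin 2 → MvPowerSeries (Fin 2) k) =
      {MvPowerSeries.X 0, MvPowerSeries.X 1} := by
    ext; simp [Fin.exists_fin_two, eq_comm]
  rwa [this] at h

end TwoVariables

/-! ### Charts of smoothings of the node -/

/-- A presentation of a `k⟦t⟧`-algebra `S` as `k⟦X₀, X₁⟧`, with `t = X₀ X₁ w` for a unit `w`. -/
structure SmoothingChart (k S : Type*) [Field k] [CommRing S] [Algebra k S]
    [Algebra (PowerSeries k) S] where
  /-- the identification with a ring of power series -/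
  φ : MvPowerSeries (Fin 2) k ≃ₐ[k] S
  /-- the unit in the equation of the parameter -/
  w : (MvPowerSeries (Fin 2) k)ˣ
  algebraMap_X : algebraMap (PowerSeries k) S PowerSeries.X =
    φ (MvPowerSeries.X 0 * (w : MvPowerSeries (Fin 2) k) * MvPowerSeries.X 1)

namespace SmoothingChart

variable {k S : Type*} [Field k] [CommRing S] [Algebra k S] [Algebra (PowerSeries k) S]
  (c : SmoothingChart k S)

/-- The first coordinate, normalized so that the parameter is `x y`. -/
noncomputable def x : S := c.φ (MvPowerSeries.X 0 * (c.w : MvPowerSeries (Fin 2) k))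

/-- The second coordinate. -/
noncomputable def y : S := c.φ (MvPowerSeries.X 1)

theorem algebraMap_X_eq : algebraMap (PowerSeries k) S PowerSeries.X = c.x * c.y := by
  rw [c.algebraMap_X, x, y, map_mul]

theorem isDomain (c : SmoothingChart k S) : IsDomain S :=
  have := NoZeroDivisors.to_isDomain (MvPowerSeries (Fin 2) k)
  c.φ.symm.toMulEquiv.isDomain (MvPowerSeries (Fin 2) k)

theorem isLocalRing (c : SmoothingChart k S) : IsLocalRing S := c.φ.toRingEquiv.isLocalRing

theorem isNoetherianRing (c : SmoothingChart k S) : IsNoetherianRing S :=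
  isNoetherianRing_of_ringEquiv _ c.φ.toRingEquiv

theorem associated_x : Associated (c.φ (MvPowerSeries.X 0)) c.x :=
  ⟨c.w.map (c.φ : _ →* S), by simp [x]⟩

theorem prime_x : Prime c.x := by
  rw [← c.associated_x.prime_iff, MulEquiv.prime_iff]
  exact prime_X_zero

theorem prime_y : Prime c.y := by
  rw [y, MulEquiv.prime_iff]
  exact prime_X_one

theorem not_x_dvd_y : ¬ c.x ∣ c.y := by
  rw [← c.associated_x.dvd_iff_dvd_left, y, map_dvd_iff, X_dvd_X_iff]
  simp

theorem not_y_dvd_x : ¬ c.y ∣ c.x := by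
  rw [← c.associated_x.dvd_iff_dvd_right, y, map_dvd_iff, X_dvd_X_iff]
  simp

theorem x_pow_dvd_of_dvd_y_pow_mul {i j : ℕ} {s : S} (h : c.x ^ i ∣ c.y ^ j * s) : c.x ^ i ∣ s := by
  have := c.isDomain
  exact c.prime_x.pow_dvd_of_dvd_mul_left i
    (fun h' => c.not_x_dvd_y (c.prime_x.dvd_of_dvd_pow h')) h

theorem y_pow_dvd_of_dvd_x_pow_mul {i j : ℕ} {s : S} (h : c.y ^ i ∣ c.x ^ j * s) : c.y ^ i ∣ s := by
  have := c.isDomain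
  exact c.prime_y.pow_dvd_of_dvd_mul_left i
    (fun h' => c.not_y_dvd_x (c.prime_y.dvd_of_dvd_pow h')) h

theorem jacobson_eq_map : Ideal.jacobson (⊥ : Ideal S) =
    (IsLocalRing.maximalIdeal (MvPowerSeries (Fin 2) k)).map c.φ.toRingEquiv := by
  have := c.isLocalRing
  rw [IsLocalRing.jacobson_eq_maximalIdeal _ bot_ne_top]
  ext s
  rw [← Ideal.comap_symm, Ideal.mem_comap, IsLocalRing.mem_maximalIdeal,
    IsLocalRing.mem_maximalIdeal, mem_nonunits_iff, mem_nonunits_iff]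
  exact not_congr (MulEquiv.isUnit_map c.φ.symm).symm

theorem jacobson_eq : Ideal.jacobson (⊥ : Ideal S) = Ideal.span {c.x, c.y} := by
  rw [c.jacobson_eq_map, maximalIdeal_mvPowerSeries, Ideal.map_span, Set.image_pair,
    Ideal.span_insert, Ideal.span_insert (c.x)]
  have := c.isDomain
  congr 1
  exact Ideal.span_singleton_eq_span_singleton.2 c.associated_x

theorem jacobson_fg (c : SmoothingChart k S) : (Ideal.jacobson (⊥ : Ideal S)).FG := by
  rw [c.jacobson_eq]
  exact Submodule.fg_span (Set.toFinite _)

theorem isAdicComplete (c : SmoothingChart k S) :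
    IsAdicComplete (Ideal.jacobson (⊥ : Ideal S)) S := by
  rw [c.jacobson_eq_map, IsAdicComplete.congr_ringEquiv]
  infer_instance

theorem x_mem : c.x ∈ Ideal.jacobson (⊥ : Ideal S) := by
  rw [c.jacobson_eq]; exact Ideal.subset_span (by simp)

theorem y_mem : c.y ∈ Ideal.jacobson (⊥ : Ideal S) := by
  rw [c.jacobson_eq]; exact Ideal.subset_span (by simp)

theorem exists_eq_add (s : S) : ∃ (a : k) (q r : S), s = algebraMap k S a + c.x * q + c.y * r := by
  have h : s - algebraMap k S (MvPowerSeries.constantCoeff (c.φ.symm s)) ∈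
      Ideal.jacobson (⊥ : Ideal S) := by
    rw [c.jacobson_eq_map, ← Ideal.comap_symm, Ideal.mem_comap, IsLocalRing.mem_maximalIdeal,
      mem_nonunits_iff, MvPowerSeries.isUnit_iff_constantCoeff]
    have : c.φ.symm (s - algebraMap k S (MvPowerSeries.constantCoeff (c.φ.symm s))) =
        c.φ.symm s - MvPowerSeries.C (MvPowerSeries.constantCoeff (c.φ.symm s)) := by
      rw [map_sub, AlgEquiv.commutes]; rfl
    change ¬ IsUnit (MvPowerSeries.constantCoeff (c.φ.symm _))
    rw [this]
    simp
  rw [c.jacobson_eq, Ideal.mem_span_pair] at h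
  obtain ⟨q, r, h⟩ := h
  exact ⟨_, q, r, by rw [add_assoc, ← sub_eq_iff_eq_add', ← h]; ring⟩

theorem mem_span_monomials_add (s : S) (n : ℕ) :
    ∃ p ∈ Submodule.span k (Set.range fun d : ℕ × ℕ => c.x ^ d.1 * c.y ^ d.2),
      s - p ∈ Ideal.jacobson (⊥ : Ideal S) ^ n := by
  induction n generalizing s with
  | zero => exact ⟨0, zero_mem _, by simp⟩
  | succ n ih =>
    obtain ⟨a, q, r, rfl⟩ := c.exists_eq_add s
    obtain ⟨p, hp, hqp⟩ := ih q
    obtain ⟨p', hp', hrp⟩ := ih r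
    have hmul : ∀ z ∈ Submodule.span k (Set.range fun d : ℕ × ℕ => c.x ^ d.1 * c.y ^ d.2),
        c.x * z ∈ Submodule.span k (Set.range fun d : ℕ × ℕ => c.x ^ d.1 * c.y ^ d.2) ∧
        c.y * z ∈ Submodule.span k (Set.range fun d : ℕ × ℕ => c.x ^ d.1 * c.y ^ d.2) := by
      intro z hz
      induction hz using Submodule.span_induction with
      | mem z hz =>
        obtain ⟨d, rfl⟩ := hz
        exact ⟨Submodule.subset_span ⟨(d.1 + 1, d.2), by dsimp; ring⟩,
          Submodule.subset_span ⟨(d.1, d.2 + 1), by dsimp; ring⟩⟩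
      | zero => simp
      | add u v _ _ hu hv =>
        rw [mul_add, mul_add]; exact ⟨add_mem hu.1 hv.1, add_mem hu.2 hv.2⟩
      | smul b u _ hu =>
        rw [mul_smul_comm, mul_smul_comm]
        exact ⟨Submodule.smul_mem _ _ hu.1, Submodule.smul_mem _ _ hu.2⟩
    refine ⟨a • 1 + c.x * p + c.y * p',
      add_mem (add_mem (Submodule.smul_mem _ _ (Submodule.subset_span ⟨(0, 0), by simp⟩))
        (hmul p hp).1) (hmul p' hp').2, ?_⟩
    rw [← Algebra.algebraMap_eq_smul_one, show algebraMap k S a + c.x * q + c.y * r -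
      (algebraMap k S a + c.x * p + c.y * p') = c.x * (q - p) + c.y * (r - p') by ring, pow_succ']
    exact add_mem (Ideal.mul_mem_mul c.x_mem hqp) (Ideal.mul_mem_mul c.y_mem hrp)

theorem jacobson_pow_le (n : ℕ) :
    Ideal.jacobson (⊥ : Ideal S) ^ (n + n) ≤ Ideal.span {c.x ^ n} ⊔ Ideal.span {c.y ^ n} := by
  rw [c.jacobson_eq, Ideal.span_insert]
  refine Ideal.sup_pow_add_le_pow_sup_pow.trans ?_
  rw [Ideal.span_singleton_pow, Ideal.span_singleton_pow]

/-- The vector field dual to the logarithmic form `dx / x` on the fibres. -/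
theorem exists_derivation [IsScalarTower k (PowerSeries k) S] :
    ∃ θ : Derivation (PowerSeries k) S S, θ c.x = c.x ∧ θ c.y = - c.y := by
  have := c.isDomain
  have hcomplete := c.isAdicComplete
  set R := MvPowerSeries (Fin 2) k
  let w : R := c.w
  have hu : IsUnit (w + MvPowerSeries.X 0 * MvPowerSeries.pderiv k 0 w) := by
    have hw : IsUnit w := c.w.isUnit
    rw [MvPowerSeries.isUnit_iff_constantCoeff] at hw ⊢
    simpa using hw
  let v : R := ↑(hu.unit⁻¹)
  have hv : v * (w + MvPowerSeries.X 0 * MvPowerSeries.pderiv k 0 w) = 1 := hu.val_inv_mul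
  -- With `t = X₀ w X₁`, this is the Hamiltonian field `∂₁t · ∂₀ - ∂₀t · ∂₁`, so it kills `t`. The
  -- factor `v` normalizes it to send `X₁` to `-X₁`.
  let D₀ : Derivation k R R := v •
    ((MvPowerSeries.X 0 * (w + MvPowerSeries.X 1 * MvPowerSeries.pderiv k 1 w)) •
        MvPowerSeries.pderiv k 0 -
      (MvPowerSeries.X 1 * (w + MvPowerSeries.X 0 * MvPowerSeries.pderiv k 0 w)) •
        MvPowerSeries.pderiv k 1)
  have h00 : MvPowerSeries.pderiv k 0 (MvPowerSeries.X 0 : R) = 1 := MvPowerSeries.pderiv_X_self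
  have h11 : MvPowerSeries.pderiv k 1 (MvPowerSeries.X 1 : R) = 1 := MvPowerSeries.pderiv_X_self
  have h01 : MvPowerSeries.pderiv k 0 (MvPowerSeries.X 1 : R) = 0 :=
    MvPowerSeries.pderiv_X_of_ne (by decide)
  have h10 : MvPowerSeries.pderiv k 1 (MvPowerSeries.X 0 : R) = 0 :=
    MvPowerSeries.pderiv_X_of_ne (by decide)
  have hD₀y : D₀ (MvPowerSeries.X 1) = - MvPowerSeries.X 1 := by
    simp only [D₀, Derivation.smul_apply, Derivation.sub_apply, h01, h11, smul_eq_mul]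
    linear_combination (- MvPowerSeries.X 1) * hv
  have hD₀t : D₀ (MvPowerSeries.X 0 * w * MvPowerSeries.X 1) = 0 := by
    simp only [D₀, Derivation.smul_apply, Derivation.sub_apply, Derivation.leibniz, h00, h01,
      h10, h11, smul_eq_mul]
    ring
  let θ₀ : S →ₗ[k] S := c.φ.toLinearMap ∘ₗ D₀.toLinearMap ∘ₗ c.φ.symm.toLinearMap
  have hθ₀ : ∀ s, θ₀ s = c.φ (D₀ (c.φ.symm s)) := fun _ => rfl
  have hmul : ∀ s s', θ₀ (s * s') = s * θ₀ s' + s' * θ₀ s := by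
    intro s s'
    simp [hθ₀, Derivation.leibniz]
  have hy : θ₀ c.y = - c.y := by
    rw [hθ₀, y, AlgEquiv.symm_apply_apply, hD₀y, map_neg]
  have ht : θ₀ (c.x * c.y) = 0 := by
    rw [hθ₀, ← c.algebraMap_X_eq, c.algebraMap_X, AlgEquiv.symm_apply_apply, hD₀t, map_zero]
  have hx : θ₀ c.x = c.x := by
    rw [hmul, hy] at ht
    refine mul_left_cancel₀ c.prime_y.ne_zero ?_
    linear_combination ht
  have hconst : ∀ a : k, θ₀ (algebraMap k S a) = 0 := by
    intro a
    rw [hθ₀, AlgEquiv.commutes, Derivation.map_algebraMap, map_zero]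
  -- Killing `k` and `t` gives linearity over `k⟦t⟧` only after a limit: splitting off the constant
  -- term repeatedly puts the value in every power of the Jacobson radical.
  have hpow : ∀ (n : ℕ) (a : PowerSeries k),
      θ₀ (algebraMap _ S a) ∈ Ideal.jacobson (⊥ : Ideal S) ^ n := by
    intro n
    induction n with
    | zero => simp
    | succ n ih =>
      intro a
      rw [PowerSeries.eq_X_mul_shift_add_const a, map_add, map_add, map_mul, hmul,
        c.algebraMap_X_eq, ht, mul_zero, add_zero, PowerSeries.C_eq_algebraMap,
        ← IsScalarTower.algebraMap_apply, hconst, add_zero, pow_succ']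
      exact Ideal.mul_mem_mul (Ideal.mul_mem_right _ _ c.x_mem) (ih _)
  have hA : ∀ a : PowerSeries k, θ₀ (algebraMap _ S a) = 0 := by
    intro a
    refine IsHausdorff.haus hcomplete.toIsHausdorff _ fun n => ?_
    rw [SModEq.zero]
    simpa using hpow n a
  refine ⟨Derivation.mk' { toFun := θ₀, map_add' := map_add θ₀, map_smul' := fun a s => ?_ }
    fun s s' => ?_, hx, hy⟩
  · rw [Algebra.smul_def, hmul, hA, mul_zero, add_zero, RingHom.id_apply, Algebra.smul_def]
  · simpa using hmul s s'

end SmoothingChart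

/-! ### Functionals on powers of two factors of the parameter -/

section PowersOfFactors

variable {A S : Type*} [CommRing A] [CommRing S] [Algebra A S] {m : ℕ}

theorem jet_zero : jet A m (0 : S) = 0 := by
  simp [jet]

theorem dual_jet_mul_pow (D : Module.Dual S (PrincipalParts A S m)) {x y : S} {t : A}
    (ht : x * y = algebraMap A S t) (i : ℕ) (f : S) :
    D (jet A m ((x * y) ^ i * f)) = (x * y) ^ i * D (jet A m f) := by
  rw [ht, ← map_pow, jet_algebraMap_mul, map_smul, smul_eq_mul]

/-- Apply the recurrence to powers of `y` times `x ^ n`. Each product `y ^ i * x ^ n` with `i > 0`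
is a power of `t` times a smaller power of `x` or a power of `y`, so `t`-linearity and induction
show that `x ^ n` divides `y ^ m * D (jet x ^ n)`. The power of `y` is then cancelled by `hxy`. -/
theorem pow_dvd_dual_jet_pow (D : Module.Dual S (PrincipalParts A S m)) {x y : S} {t : A}
    (ht : x * y = algebraMap A S t) (hxy : ∀ (i j : ℕ) (s : S), x ^ i ∣ y ^ j * s → x ^ i ∣ s)
    (n : ℕ) : x ^ n ∣ D (jet A m (x ^ n)) := by
  induction n using Nat.strong_induction_on with
  | _ n ih =>
  have h := sum_pow_mul_jet D y (x ^ n)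
  rw [Finset.sum_range_succ', add_comm, ← eq_neg_iff_add_eq_zero] at h
  simp only [Nat.sub_zero, Nat.choose_zero_right, Nat.cast_one, mul_one, pow_zero, one_mul] at h
  have hdvd : x ^ n ∣ (-1) ^ m * y ^ m * D (jet A m (x ^ n)) := by
    rw [h, dvd_neg]
    refine Finset.dvd_sum fun i _ => Dvd.dvd.mul_left ?_ _
    rcases le_or_gt (i + 1) n with hi | hi
    · have : y ^ (i + 1) * x ^ n = (x * y) ^ (i + 1) * x ^ (n - (i + 1)) := by
        rw [mul_pow, mul_right_comm, ← pow_add, Nat.add_sub_cancel' hi, mul_comm]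
      rw [this, dual_jet_mul_pow D ht, mul_pow]
      obtain ⟨d, hd⟩ := ih (n - (i + 1)) (by omega)
      refine ⟨y ^ (i + 1) * d, ?_⟩
      rw [hd]
      rw [show x ^ n = x ^ (i + 1) * x ^ (n - (i + 1)) by rw [← pow_add, Nat.add_sub_cancel' hi]]
      ring
    · have : y ^ (i + 1) * x ^ n = (x * y) ^ n * y ^ (i + 1 - n) := by
        rw [mul_pow, mul_assoc, ← pow_add, Nat.add_sub_cancel' hi.le, mul_comm]
      rw [this, dual_jet_mul_pow D ht, mul_pow, mul_assoc]
      exact dvd_mul_right _ _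
  rw [mul_assoc] at hdvd
  exact hxy _ _ _ ((IsUnit.dvd_mul_left (isUnit_one.neg.pow m)).1 hdvd)

/-- The top coefficient of the recurrence is `1`, so `m` consecutive zeros propagate upwards. -/
theorem dual_jet_pow_eq_zero_of_lt (D : Module.Dual S (PrincipalParts A S m)) {x : S}
    (h : ∀ n < m, D (jet A m (x ^ n)) = 0) (n : ℕ) : D (jet A m (x ^ n)) = 0 := by
  induction n using Nat.strong_induction_on with
  | _ n ih =>
  rcases lt_or_ge n m with hn | hn
  · exact h n hn
  have hs := sum_pow_mul_jet D x (x ^ (n - m))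
  rw [Finset.sum_range_succ, Finset.sum_eq_zero, zero_add] at hs
  · simpa [← pow_add, Nat.add_sub_cancel' hn] using hs
  · intro i hi
    have hi := Finset.mem_range.1 hi
    rw [← pow_add, ih _ (by omega), mul_zero]

/-- In the recurrence for powers of `x` times `y ^ n`, all terms except `x ^ m * D (jet y ^ n)`
reduce to known zeros through `xy = t`. -/
theorem dual_jet_pow_eq_zero_of_mul_eq [IsDomain S] (D : Module.Dual S (PrincipalParts A S m))
    {x y : S} {t : A} (ht : x * y = algebraMap A S t) (hx : x ≠ 0)
    (h : ∀ n, D (jet A m (x ^ n)) = 0) (n : ℕ) : D (jet A m (y ^ n)) = 0 := by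
  induction n using Nat.strong_induction_on with
  | _ n ih =>
  have hs := sum_pow_mul_jet D x (y ^ n)
  rw [Finset.sum_range_succ', Finset.sum_eq_zero, zero_add] at hs
  · simpa [hx] using hs
  · intro i _
    rcases le_or_gt (i + 1) n with hi | hi
    · have : x ^ (i + 1) * y ^ n = (x * y) ^ (i + 1) * y ^ (n - (i + 1)) := by
        rw [mul_pow, mul_assoc, ← pow_add, Nat.add_sub_cancel' hi]
      rw [this, dual_jet_mul_pow D ht, ih _ (by omega), mul_zero, mul_zero]
    · have : x ^ (i + 1) * y ^ n = (x * y) ^ n * x ^ (i + 1 - n) := by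
        rw [mul_pow, mul_right_comm, ← pow_add, Nat.add_sub_cancel' hi.le]
      rw [this, dual_jet_mul_pow D ht, h, mul_zero, mul_zero]

end PowersOfFactors

theorem isUnit_det_vandermonde {k S : Type*} [Field k] [CharZero k] [CommRing S] [Algebra k S]
    (m : ℕ) :
    IsUnit (Matrix.vandermonde fun i : Fin m => ((i : ℕ) : S)).det := by
  have : Matrix.vandermonde (fun i : Fin m => ((i : ℕ) : S)) =
      (algebraMap k S).mapMatrix (Matrix.vandermonde fun i : Fin m => ((i : ℕ) : k)) := by
    ext i j; simp [Matrix.vandermonde_apply]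
  rw [this, ← RingHom.map_det]
  refine IsUnit.map _ (isUnit_iff_ne_zero.2 ?_)
  rw [Matrix.det_vandermonde_ne_zero_iff]
  intro i j h
  exact Fin.ext (Nat.cast_injective h)

/-! ### The dual of the principal parts of a smoothing -/

namespace SmoothingChart

variable {k S : Type*} [Field k] [CommRing S] [Algebra k S] [Algebra (PowerSeries k) S]
  (c : SmoothingChart k S) {m : ℕ}

/-- The generator `x ^ n` or `y ^ (-n)` of the functions of weight `n`. -/
noncomputable def z (n : ℤ) : S := c.x ^ n.toNat * c.y ^ (-n).toNat

@[simp]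
theorem z_natCast (n : ℕ) : c.z n = c.x ^ n := by simp [z]

@[simp]
theorem z_neg_natCast (n : ℕ) : c.z (-n) = c.y ^ n := by simp [z]

theorem x_pow_mul_y_pow (i j : ℕ) :
    c.x ^ i * c.y ^ j = (c.x * c.y) ^ (min i j) * c.z (i - j) := by
  rw [z, mul_pow, mul_mul_mul_comm, ← pow_add, ← pow_add]
  congr 2 <;> omega

theorem z_dvd_dual_jet (D : Module.Dual S (PrincipalParts (PowerSeries k) S m)) (n : ℤ) :
    c.z n ∣ D (jet (PowerSeries k) m (c.z n)) := by
  obtain ⟨n, rfl | rfl⟩ := n.eq_nat_or_neg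
  · rw [z_natCast]
    exact pow_dvd_dual_jet_pow D c.algebraMap_X_eq.symm
      (fun _ _ _ => c.x_pow_dvd_of_dvd_y_pow_mul) n
  · rw [z_neg_natCast]
    exact pow_dvd_dual_jet_pow D ((mul_comm _ _).trans c.algebraMap_X_eq.symm)
      (fun _ _ _ => c.y_pow_dvd_of_dvd_x_pow_mul) n

/-- One polynomial truncation serves all functionals: the error lies in `(x ^ (n+m), y ^ (n+m))`,
and a functional loses at most `m` powers. -/
theorem exists_monomials_approx (f : S) (n : ℕ) :
    ∃ p ∈ Submodule.span k (Set.range fun d : ℕ × ℕ => c.x ^ d.1 * c.y ^ d.2),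
      ∀ D : Module.Dual S (PrincipalParts (PowerSeries k) S m),
        D (jet (PowerSeries k) m f) - D (jet (PowerSeries k) m p) ∈
          Ideal.jacobson (⊥ : Ideal S) ^ n := by
  obtain ⟨p, hp, hfp⟩ := c.mem_span_monomials_add f ((n + m) + (n + m))
  refine ⟨p, hp, fun D => ?_⟩
  obtain ⟨u, hu, v, hv, huv⟩ := Submodule.mem_sup.1 (c.jacobson_pow_le _ hfp)
  obtain ⟨u, rfl⟩ := Ideal.mem_span_singleton.1 hu
  obtain ⟨v, rfl⟩ := Ideal.mem_span_singleton.1 hv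
  rw [← sub_add_cancel f p, ← huv, jet_add, jet_add, map_add, map_add, add_sub_cancel_right]
  exact add_mem
    (Ideal.mem_of_dvd _ (pow_dvd_jet_pow_mul D c.x u n) (Ideal.pow_mem_pow c.x_mem n))
    (Ideal.mem_of_dvd _ (pow_dvd_jet_pow_mul D c.y v n) (Ideal.pow_mem_pow c.y_mem n))

variable [IsScalarTower k (PowerSeries k) S]

theorem jet_smul (a : k) (f : S) :
    jet (PowerSeries k) m (a • f) = algebraMap k S a • jet (PowerSeries k) m f := by
  rw [IsScalarTower.algebraMap_apply k (PowerSeries k) S, ← jet_algebraMap_mul,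
    ← IsScalarTower.algebraMap_apply, Algebra.smul_def]

/-- Zeros at `1, x, …, x ^ (m-1)` spread to all powers of `x`, then to powers of `y`, then by
`t`-linearity to all monomials, and by continuity to all jets. -/
theorem dual_eq_zero (D : Module.Dual S (PrincipalParts (PowerSeries k) S m))
    (h : ∀ n < m, D (jet (PowerSeries k) m (c.x ^ n)) = 0) : D = 0 := by
  have := c.isDomain
  have := c.isAdicComplete
  have hx := dual_jet_pow_eq_zero_of_lt D h
  have hy := dual_jet_pow_eq_zero_of_mul_eq D c.algebraMap_X_eq.symm c.prime_x.ne_zero hx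
  have hz : ∀ n, D (jet _ m (c.z n)) = 0 := by
    intro n
    obtain ⟨n, rfl | rfl⟩ := n.eq_nat_or_neg
    · rw [z_natCast, hx]
    · rw [z_neg_natCast, hy]
  refine dual_ext_jet c.jacobson_fg fun f => ?_
  rw [LinearMap.zero_apply]
  refine IsHausdorff.haus (I := Ideal.jacobson (⊥ : Ideal S)) inferInstance _ fun n => ?_
  obtain ⟨p, hp, hD⟩ := c.exists_monomials_approx (m := m) f n
  have hDp : D (jet _ m p) = 0 := by
    clear hD
    induction hp using Submodule.span_induction with
    | mem p hp =>
      obtain ⟨d, rfl⟩ := hp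
      dsimp only
      rw [x_pow_mul_y_pow, dual_jet_mul_pow D c.algebraMap_X_eq.symm, hz, mul_zero]
    | zero => rw [jet_zero, map_zero]
    | add p q _ _ hp hq => rw [jet_add, map_add, hp, hq, add_zero]
    | smul a p _ hp => rw [jet_smul, map_smul, hp, smul_zero]
  rw [SModEq.zero]
  simpa [hDp] using hD D

/-- Any family of functionals takes an element of `𝒫` to a vector in the span of multiples of
the `z n`, up to high order. -/
theorem exists_approx_mem_span {ι : Type*}
    (e : ι → Module.Dual S (PrincipalParts (PowerSeries k) S m)) :
    ∃ w : ℤ → ι → S, ∀ (τ : PrincipalParts (PowerSeries k) S m) (n : ℕ),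
      ∃ v ∈ Submodule.span S (Set.range fun l => c.z l • w l),
        ∀ i, e i τ - v i ∈ Ideal.jacobson (⊥ : Ideal S) ^ n := by
  choose w hw using fun (l : ℤ) (i : ι) => c.z_dvd_dual_jet (e i) l
  refine ⟨w, fun τ n => ?_⟩
  set L := Submodule.span S (Set.range fun l => c.z l • w l)
  have hmono : ∀ p ∈ Submodule.span k (Set.range fun d : ℕ × ℕ => c.x ^ d.1 * c.y ^ d.2),
      (fun i => e i (jet _ m p)) ∈ L := by
    intro p hp
    induction hp using Submodule.span_induction with
    | mem p hp =>
      obtain ⟨d, rfl⟩ := hp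
      have : (fun i => e i (jet (PowerSeries k) m (c.x ^ d.1 * c.y ^ d.2))) =
          (c.x * c.y) ^ (min d.1 d.2) • (c.z (d.1 - d.2) • w (d.1 - d.2)) := by
        funext i
        rw [x_pow_mul_y_pow, dual_jet_mul_pow _ c.algebraMap_X_eq.symm, hw]
        rfl
      dsimp only
      rw [this]
      exact Submodule.smul_mem _ _ (Submodule.subset_span ⟨_, rfl⟩)
    | zero =>
      convert zero_mem L with i
      rw [jet_zero, map_zero, Pi.zero_apply]
    | add p q _ _ hp hq =>
      convert add_mem hp hq with i
      rw [jet_add, map_add, Pi.add_apply]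
    | smul a p _ hp =>
      convert Submodule.smul_mem L (algebraMap k S a) hp with i
      rw [jet_smul, map_smul, Pi.smul_apply]
  obtain ⟨q, hq, hτq⟩ := exists_mem_span_jet c.jacobson_fg τ n
  have hjet : ∃ v ∈ L, ∀ i, e i q - v i ∈ Ideal.jacobson (⊥ : Ideal S) ^ n := by
    clear hτq
    induction hq using Submodule.span_induction with
    | mem q hq =>
      obtain ⟨f, rfl⟩ := hq
      obtain ⟨p, hp, hD⟩ := c.exists_monomials_approx (m := m) f n
      exact ⟨_, hmono p hp, fun i => hD (e i)⟩
    | zero => exact ⟨0, zero_mem _, by simp⟩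
    | add p q _ _ hp hq =>
      obtain ⟨v, hv, hv'⟩ := hp
      obtain ⟨u, hu, hu'⟩ := hq
      refine ⟨v + u, add_mem hv hu, fun i => ?_⟩
      rw [map_add, Pi.add_apply, add_sub_add_comm]
      exact add_mem (hv' i) (hu' i)
    | smul a p _ hp =>
      obtain ⟨v, hv, hv'⟩ := hp
      refine ⟨a • v, Submodule.smul_mem _ _ hv, fun i => ?_⟩
      rw [map_smul, Pi.smul_apply, ← smul_sub]
      exact Ideal.mul_mem_left _ _ (hv' i)
  obtain ⟨v, hv, hv'⟩ := hjet
  refine ⟨v, hv, fun i => ?_⟩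
  have := add_mem (map_mem_of_mem_smul_top _ (e i) hτq) (hv' i)
  rwa [map_sub, sub_add_sub_cancel] at this

theorem exists_dual_basis [CharZero k] :
    ∃ e : Module.Basis (Fin m) S (Module.Dual S (PrincipalParts (PowerSeries k) S m)),
      ∀ j n, e j (jet _ m (c.z n)) = (n : S) ^ (j : ℕ) * c.z n := by
  have := c.isDomain
  have := c.isAdicComplete
  obtain ⟨θ, hθx, hθy⟩ := c.exists_derivation
  choose Θ hΘ using fun j : Fin m => exists_dual_iterate_derivation θ j.2
  have hz : ∀ j n, Θ j (jet _ m (c.z n)) = (n : S) ^ (j : ℕ) * c.z n := by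
    have hθz : ∀ n, θ (c.z n) = n * c.z n := by
      intro n
      obtain ⟨n, rfl | rfl⟩ := n.eq_nat_or_neg
      · rw [z_natCast, Derivation.leibniz_pow, hθx]
        cases n with
        | zero => simp
        | succ n => rw [nsmul_eq_mul, Nat.add_sub_cancel, pow_succ, smul_eq_mul, Int.cast_natCast]
      · rw [z_neg_natCast, Derivation.leibniz_pow, hθy]
        cases n with
        | zero => simp
        | succ n =>
          rw [nsmul_eq_mul, Nat.add_sub_cancel, pow_succ, smul_eq_mul, Int.cast_neg,
            Int.cast_natCast]
          ring
    intro j n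
    rw [hΘ]
    induction (j : ℕ) with
    | zero => simp
    | succ i ih =>
      rw [Function.iterate_succ_apply', ih, Derivation.leibniz, hθz,
        Derivation.leibniz_pow, Derivation.map_intCast]
      simp only [smul_eq_mul, mul_zero, smul_zero, add_zero]
      ring
  have hV := isUnit_det_vandermonde (k := k) (S := S) m
  have hx : ∀ (j : Fin m) (n : ℕ), Θ j (jet _ m (c.x ^ n)) = (n : S) ^ (j : ℕ) * c.x ^ n := by
    intro j n
    simpa using hz j n
  have hli : LinearIndependent S Θ := by
    rw [Fintype.linearIndependent_iff]
    intro g hg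
    have : (Matrix.vandermonde fun i : Fin m => ((i : ℕ) : S)).mulVec g = 0 := by
      funext n
      have h1 := congrArg (fun D => D (jet (PowerSeries k) m (c.x ^ (n : ℕ)))) hg
      simp only [LinearMap.sum_apply, LinearMap.smul_apply, hx, LinearMap.zero_apply,
        smul_eq_mul] at h1
      refine mul_right_cancel₀ (pow_ne_zero n c.prime_x.ne_zero) ?_
      rw [Pi.zero_apply, zero_mul, ← h1, Matrix.mulVec, dotProduct, Finset.sum_mul]
      exact Finset.sum_congr rfl fun j _ => by rw [Matrix.vandermonde_apply]; ring
    exact congrFun (Matrix.eq_zero_of_mulVec_eq_zero hV.ne_zero this)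
  have hsp : ⊤ ≤ Submodule.span S (Set.range Θ) := by
    rintro D -
    -- Matching `D` on `x ^ n` asks for `∑ j, g j * n ^ j * x ^ n = D (jet x ^ n)`. Divisibility of
    -- the right side by `x ^ n` reduces this to an invertible Vandermonde system.
    choose d hd using fun n : Fin m =>
      pow_dvd_dual_jet_pow D c.algebraMap_X_eq.symm
        (fun _ _ _ => c.x_pow_dvd_of_dvd_y_pow_mul) n
    set V := Matrix.vandermonde fun i : Fin m => ((i : ℕ) : S) with hVdef
    let g := V⁻¹.mulVec d
    have hVg : V.mulVec g = d := by
      rw [Matrix.mulVec_mulVec, Matrix.mul_nonsing_inv _ hV, Matrix.one_mulVec]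
    have hD : D - ∑ j, g j • Θ j = 0 := by
      refine c.dual_eq_zero _ fun n hn => ?_
      have h1 := congrFun hVg ⟨n, hn⟩
      have h2 := hd ⟨n, hn⟩
      dsimp only at h2
      rw [LinearMap.sub_apply, h2, ← h1]
      simp only [LinearMap.sum_apply, LinearMap.smul_apply, hx, smul_eq_mul, Matrix.mulVec,
        dotProduct, Finset.mul_sum, V, Matrix.vandermonde_apply]
      rw [sub_eq_zero]
      exact Finset.sum_congr rfl fun j _ => by ring
    rw [sub_eq_zero.1 hD]
    exact Submodule.sum_mem _ fun j _ => Submodule.smul_mem _ _ (Submodule.subset_span ⟨j, rfl⟩)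
  exact ⟨Module.Basis.mk hli hsp, fun j n => by rw [Module.Basis.mk_apply, hz]⟩

end SmoothingChart

/-! ### The trivial deformation of the node -/

/-- The functional `ε` of `θ` is killed by `y`, so in a free dual its coordinates are multiples of
`x` and `ε = x • η`. Evaluating at the jet of `x` gives `η (jet x) ≡ 1` modulo `y`, whereas the
recurrence with `xy = 0` gives `y ^ m * η (jet x) = 0` and hence `x ∣ η (jet x)`. Together these put
`1` in `(x, y)`. The condition `1 < m` is what makes `θ` define a functional. -/
theorem isEmpty_basis_dual_of_mul_eq_zero {A S : Type*} [CommRing A] [CommRing S] [Algebra A S]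
    [IsAdicComplete (Ideal.jacobson (⊥ : Ideal S)) S] (hJ : (Ideal.jacobson (⊥ : Ideal S)).FG)
    {m : ℕ} (hm : 1 < m) {x y : S} (hxy : x * y = 0) (hy : ∀ (n : ℕ) (s : S), y ^ n * s = 0 → x ∣ s)
    (hx : ∀ s : S, x * s = 0 → y ∣ s) (h1 : (1 : S) ∉ Ideal.span {x, y})
    (θ : Derivation A S S) (hθx : θ x = x) (hθ : ∀ f, x ∣ θ f) :
    IsEmpty (Module.Basis (Fin m) S (Module.Dual S (PrincipalParts A S m))) := by
  refine ⟨fun e => h1 ?_⟩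
  obtain ⟨ε, hε⟩ := exists_dual_iterate_derivation θ hm
  have hyε : y • ε = 0 := by
    refine dual_ext_jet hJ fun f => ?_
    obtain ⟨d, hd⟩ := hθ f
    rw [LinearMap.smul_apply, hε, Function.iterate_one, hd, LinearMap.zero_apply, smul_eq_mul,
      ← mul_assoc, mul_comm y, hxy, zero_mul]
  have hrepr : ∀ i, x ∣ e.repr ε i := by
    intro i
    refine hy 1 _ ?_
    rw [pow_one, ← smul_eq_mul, ← Finsupp.smul_apply, ← map_smul, hyε, map_zero,
      Finsupp.zero_apply]
  choose r hr using hrepr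
  let η : Module.Dual S (PrincipalParts A S m) := ∑ i, r i • e i
  have hη : ε = x • η := by
    rw [← e.sum_repr ε, Finset.smul_sum]
    exact Finset.sum_congr rfl fun i _ => by rw [hr, mul_smul]
  have hηx : y ∣ η (jet A m x) - 1 := by
    refine hx _ ?_
    have h2 : ε (jet A m x) = x := by rw [hε, Function.iterate_one, hθx]
    rw [hη, LinearMap.smul_apply, smul_eq_mul] at h2
    rw [mul_sub, h2, mul_one, sub_self]
  have hηx' : x ∣ η (jet A m x) := by
    refine hy m _ ?_
    have hs := sum_pow_mul_jet η y x
    rw [Finset.sum_range_succ', Finset.sum_eq_zero, zero_add] at hs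
    · have hu : IsUnit ((-1 : S) ^ m) := isUnit_one.neg.pow m
      simpa [mul_assoc, hu.mul_right_eq_zero] using hs
    · intro i _
      rw [pow_succ, mul_assoc (y ^ i), mul_comm y x, hxy, mul_zero, jet_zero, map_zero, mul_zero]
  obtain ⟨p, hp⟩ := hηx
  obtain ⟨q, hq⟩ := hηx'
  exact Ideal.mem_span_pair.2 ⟨q, -p, by linear_combination hp - hq⟩

theorem isAdicComplete_quotient {R : Type*} [CommRing R] [IsNoetherianRing R] [IsLocalRing R]
    [IsAdicComplete (IsLocalRing.maximalIdeal R) R] {I : Ideal R} (hI : I ≠ ⊤) :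
    IsAdicComplete (Ideal.jacobson (⊥ : Ideal (R ⧸ I))) (R ⧸ I) := by
  have := Ideal.Quotient.nontrivial_iff.2 hI
  have hloc : IsLocalRing (R ⧸ I) :=
    IsLocalRing.of_surjective' (Ideal.Quotient.mk I) Ideal.Quotient.mk_surjective
  have hmax : Ideal.jacobson (⊥ : Ideal (R ⧸ I)) =
      (IsLocalRing.maximalIdeal R).map (algebraMap R (R ⧸ I)) := by
    rw [IsLocalRing.jacobson_eq_maximalIdeal _ bot_ne_top]
    have hlh : IsLocalHom (Ideal.Quotient.mk I) :=
      .of_surjective _ Ideal.Quotient.mk_surjective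
    ext s
    obtain ⟨r, rfl⟩ := Ideal.Quotient.mk_surjective s
    rw [Ideal.Quotient.algebraMap_eq]
    constructor
    · intro h
      refine Ideal.mem_map_of_mem _ ?_
      rw [IsLocalRing.mem_maximalIdeal, mem_nonunits_iff] at h ⊢
      exact fun h' => h (h'.map _)
    · intro h
      have hle := ((IsLocalRing.local_hom_TFAE (Ideal.Quotient.mk I)).out 0 2).1 hlh
      exact hle h
  rw [hmax, IsAdicComplete.map_algebraMap_iff]
  have : IsPrecomplete (IsLocalRing.maximalIdeal R) (R ⧸ I) := by
    rw [← AdicCompletion.of_surjective_iff]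
    intro z
    obtain ⟨z, rfl⟩ := AdicCompletion.map_surjective (IsLocalRing.maximalIdeal R)
      (f := I.mkQ) I.mkQ_surjective z
    obtain ⟨z, rfl⟩ := AdicCompletion.of_surjective (IsLocalRing.maximalIdeal R) R z
    exact ⟨_, (AdicCompletion.map_of _ _ _).symm⟩
  exact { }

/-! ### The ring `k⟦x, y⟧⟦t⟧` and the field `x ∂/∂x` -/

section PowerSeriesOverTwoVariables

variable {k : Type*} [Field k]

theorem C_dvd_iff {R : Type*} [CommRing R] {r : R} {F : PowerSeries R} :
    PowerSeries.C r ∣ F ↔ ∀ n, r ∣ PowerSeries.coeff n F := by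
  constructor
  · rintro ⟨G, rfl⟩ n
    rw [PowerSeries.coeff_C_mul]
    exact dvd_mul_right _ _
  · intro h
    choose G hG using h
    refine ⟨PowerSeries.mk G, ?_⟩
    ext n
    rw [PowerSeries.coeff_C_mul, PowerSeries.coeff_mk, hG]

/-- Treating `t` as a third variable reduces this to power series in three variables. -/
instance isAdicComplete_maximalIdeal_powerSeries :
    IsAdicComplete (IsLocalRing.maximalIdeal (PowerSeries (MvPowerSeries (Fin 2) k)))
      (PowerSeries (MvPowerSeries (Fin 2) k)) := by
  have h : IsAdicComplete (.span (.range MvPowerSeries.X) :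
      Ideal (MvPowerSeries (Option (Fin 2)) k)) (MvPowerSeries (Option (Fin 2)) k) := inferInstance
  rw [← IsAdicComplete.congr_ringEquiv _
    (MvPowerSeries.optionEquivLeft (Fin 2) k).toRingEquiv] at h
  have hmax : IsLocalRing.maximalIdeal (PowerSeries (MvPowerSeries (Fin 2) k)) =
      (Ideal.span (Set.range MvPowerSeries.X)).map
        (MvPowerSeries.optionEquivLeft (Fin 2) k).toRingEquiv := by
    have hX : PowerSeries.X ∈ (Ideal.span (Set.range MvPowerSeries.X)).map
        (MvPowerSeries.optionEquivLeft (Fin 2) k).toRingEquiv := by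
      rw [← MvPowerSeries.optionEquivLeft_X_none]
      exact Ideal.mem_map_of_mem _ (Ideal.subset_span ⟨none, rfl⟩)
    have hC : ∀ i, PowerSeries.C (MvPowerSeries.X i) ∈ (Ideal.span (Set.range MvPowerSeries.X)).map
        (MvPowerSeries.optionEquivLeft (Fin 2) k).toRingEquiv := by
      intro i
      rw [← MvPowerSeries.optionEquivLeft_X_some]
      exact Ideal.mem_map_of_mem _ (Ideal.subset_span ⟨some i, rfl⟩)
    refine le_antisymm (fun F hF => ?_) ?_
    · rw [IsLocalRing.mem_maximalIdeal, mem_nonunits_iff, PowerSeries.isUnit_iff_constantCoeff,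
        ← mem_nonunits_iff, ← IsLocalRing.mem_maximalIdeal, maximalIdeal_mvPowerSeries,
        Ideal.mem_span_pair] at hF
      obtain ⟨q, r, hF⟩ := hF
      rw [PowerSeries.eq_X_mul_shift_add_const F, ← hF, map_add, map_mul, map_mul]
      exact add_mem (Ideal.mul_mem_right _ _ hX)
        (add_mem (Ideal.mul_mem_left _ _ (hC 0)) (Ideal.mul_mem_left _ _ (hC 1)))
    · rw [Ideal.map_le_iff_le_comap, Ideal.span_le]
      rintro _ ⟨i, rfl⟩
      change MvPowerSeries.optionEquivLeft (Fin 2) k (MvPowerSeries.X i) ∈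
        IsLocalRing.maximalIdeal (PowerSeries (MvPowerSeries (Fin 2) k))
      rw [IsLocalRing.mem_maximalIdeal, mem_nonunits_iff, PowerSeries.isUnit_iff_constantCoeff]
      cases i with
      | none => simp [MvPowerSeries.optionEquivLeft_X_none]
      | some i =>
        rw [MvPowerSeries.optionEquivLeft_X_some, PowerSeries.constantCoeff_C,
          MvPowerSeries.isUnit_iff_constantCoeff]
        simp
  rw [hmax]
  exact h

/-- The derivation `x ∂/∂x` of `k⟦x, y⟧⟦t⟧`, as a `k⟦t⟧`-linear map. -/
noncomputable def eulerMap (k : Type*) [Field k] :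
    PowerSeries (MvPowerSeries (Fin 2) k) →ₗ[PowerSeries k] PowerSeries (MvPowerSeries (Fin 2) k)
    where
  toFun F := PowerSeries.mk fun n =>
    MvPowerSeries.X 0 * MvPowerSeries.pderiv k 0 (PowerSeries.coeff n F)
  map_add' F G := by ext1 n; simp [mul_add]
  map_smul' a F := by
    ext1 n
    simp only [Algebra.smul_def, PowerSeries.coeff_mul, PowerSeries.coeff_mk, map_sum,
      PowerSeries.algebraMap_apply'', PowerSeries.coeff_map, Derivation.leibniz,
      Finset.mul_sum, RingHom.id_apply]
    refine Finset.sum_congr rfl fun p _ => ?_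
    rw [MvPowerSeries.algebraMap_apply, MvPowerSeries.pderiv_C]
    simp only [mul_zero, add_zero, Algebra.algebraMap_self, RingHom.id_apply]
    ring

theorem coeff_eulerMap (F : PowerSeries (MvPowerSeries (Fin 2) k)) (n : ℕ) :
    PowerSeries.coeff n (eulerMap k F) =
      MvPowerSeries.X 0 * MvPowerSeries.pderiv k 0 (PowerSeries.coeff n F) :=
  PowerSeries.coeff_mk _ fun n =>
    MvPowerSeries.X 0 * MvPowerSeries.pderiv k 0 (PowerSeries.coeff n F)

theorem eulerMap_mul (F G : PowerSeries (MvPowerSeries (Fin 2) k)) :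
    eulerMap k (F * G) = F * eulerMap k G + G * eulerMap k F := by
  ext1 n
  rw [mul_comm G, map_add, coeff_eulerMap]
  simp only [PowerSeries.coeff_mul, coeff_eulerMap, map_sum, Derivation.leibniz, Finset.mul_sum,
    ← Finset.sum_add_distrib, smul_eq_mul]
  exact Finset.sum_congr rfl fun p _ => by ring

theorem eulerMap_C (f : MvPowerSeries (Fin 2) k) :
    eulerMap k (PowerSeries.C f) =
      PowerSeries.C (MvPowerSeries.X 0 * MvPowerSeries.pderiv k 0 f) := by
  ext1 n
  rw [coeff_eulerMap, PowerSeries.coeff_C, PowerSeries.coeff_C]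
  split_ifs <;> simp

end PowerSeriesOverTwoVariables

theorem isEmpty_basis_dual_trivial_deformation {k : Type*} [Field k] {m : ℕ} (hm : 1 < m)
    {I : Ideal (PowerSeries (MvPowerSeries (Fin 2) k))}
    (hI : I = Ideal.span {PowerSeries.C (MvPowerSeries.X 0 * MvPowerSeries.X 1)}) :
    IsEmpty (Module.Basis (Fin m) (PowerSeries (MvPowerSeries (Fin 2) k) ⧸ I)
      (Module.Dual (PowerSeries (MvPowerSeries (Fin 2) k) ⧸ I)
        (PrincipalParts (PowerSeries k) (PowerSeries (MvPowerSeries (Fin 2) k) ⧸ I) m))) := by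
  have hmem : ∀ F, F ∈ I ↔ ∀ n, MvPowerSeries.X 0 * MvPowerSeries.X 1 ∣ PowerSeries.coeff n F := by
    intro F
    rw [hI, Ideal.mem_span_singleton, C_dvd_iff]
  have hconst : ∀ q r s : PowerSeries (MvPowerSeries (Fin 2) k), s ∈ I →
      q * PowerSeries.C (MvPowerSeries.X 0) + r * PowerSeries.C (MvPowerSeries.X 1) ≠ 1 + s := by
    intro q r s hs h
    obtain ⟨d, hd⟩ := (hmem s).1 hs 0
    have h0 := congrArg (fun F => MvPowerSeries.constantCoeff (PowerSeries.constantCoeff F)) h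
    rw [PowerSeries.coeff_zero_eq_constantCoeff_apply] at hd
    simp [hd] at h0
  have hItop : I ≠ ⊤ := by
    intro h
    exact hconst 0 0 (-1) (h ▸ Submodule.mem_top) (by simp)
  have hcomplete := isAdicComplete_quotient hItop
  have hE : ∀ F ∈ I, eulerMap k F ∈ I := by
    intro F hF
    rw [hI, Ideal.mem_span_singleton] at hF ⊢
    obtain ⟨G, rfl⟩ := hF
    rw [eulerMap_mul]
    refine dvd_add (dvd_mul_right _ _) (Dvd.dvd.mul_left ?_ _)
    rw [eulerMap_C, Derivation.leibniz, MvPowerSeries.pderiv_X_self,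
      MvPowerSeries.pderiv_X_of_ne (by decide), smul_zero, zero_add, smul_eq_mul, mul_one]
  let θ₀ : (PowerSeries (MvPowerSeries (Fin 2) k) ⧸ I) →ₗ[PowerSeries k]
      (PowerSeries (MvPowerSeries (Fin 2) k) ⧸ I) :=
    (Submodule.Quotient.restrictScalarsEquiv (PowerSeries k) I).toLinearMap ∘ₗ
      Submodule.mapQ (I.restrictScalars (PowerSeries k)) (I.restrictScalars (PowerSeries k))
        (eulerMap k) hE ∘ₗ
      (Submodule.Quotient.restrictScalarsEquiv (PowerSeries k) I).symm.toLinearMap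
  have hθ₀ : ∀ F, θ₀ (Ideal.Quotient.mk I F) = Ideal.Quotient.mk I (eulerMap k F) := fun _ => rfl
  let θ : Derivation (PowerSeries k) (PowerSeries (MvPowerSeries (Fin 2) k) ⧸ I)
      (PowerSeries (MvPowerSeries (Fin 2) k) ⧸ I) := Derivation.mk' θ₀ fun s s' => by
    obtain ⟨F, rfl⟩ := Ideal.Quotient.mk_surjective s
    obtain ⟨G, rfl⟩ := Ideal.Quotient.mk_surjective s'
    rw [← map_mul, hθ₀, hθ₀, hθ₀, eulerMap_mul, map_add, map_mul, map_mul, smul_eq_mul,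
      smul_eq_mul]
  have hθ : ∀ F, θ (Ideal.Quotient.mk I F) = Ideal.Quotient.mk I (eulerMap k F) := hθ₀
  refine isEmpty_basis_dual_of_mul_eq_zero (IsNoetherian.noetherian _) hm
    (x := Ideal.Quotient.mk I (PowerSeries.C (MvPowerSeries.X 0)))
    (y := Ideal.Quotient.mk I (PowerSeries.C (MvPowerSeries.X 1))) ?_ ?_ ?_ ?_ θ ?_ ?_
  · rw [← map_mul, ← map_mul, Ideal.Quotient.eq_zero_iff_mem, hI]
    exact Ideal.mem_span_singleton_self _
  · intro n s hs
    obtain ⟨F, rfl⟩ := Ideal.Quotient.mk_surjective s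
    rw [← map_pow, ← map_mul, Ideal.Quotient.eq_zero_iff_mem, hmem] at hs
    refine map_dvd _ (C_dvd_iff.2 fun j => ?_)
    have h1 := dvd_of_mul_right_dvd (hs j)
    rw [← map_pow, PowerSeries.coeff_C_mul] at h1
    refine (prime_X_zero.dvd_or_dvd h1).resolve_left fun h2 => ?_
    have := X_dvd_X_iff.1 (prime_X_zero.dvd_of_dvd_pow h2)
    simp at this
  · intro s hs
    obtain ⟨F, rfl⟩ := Ideal.Quotient.mk_surjective s
    rw [← map_mul, Ideal.Quotient.eq_zero_iff_mem, hmem] at hs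
    refine map_dvd _ (C_dvd_iff.2 fun j => ?_)
    have h1 := dvd_of_mul_left_dvd (hs j)
    rw [PowerSeries.coeff_C_mul] at h1
    refine (prime_X_one.dvd_or_dvd h1).resolve_left fun h2 => ?_
    have := X_dvd_X_iff.1 h2
    simp at this
  · intro h
    obtain ⟨q, r, h⟩ := Ideal.mem_span_pair.1 h
    obtain ⟨q, rfl⟩ := Ideal.Quotient.mk_surjective q
    obtain ⟨r, rfl⟩ := Ideal.Quotient.mk_surjective r
    rw [← map_mul, ← map_mul, ← map_add, ← map_one (Ideal.Quotient.mk I), Ideal.Quotient.eq] at h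
    exact hconst q r _ h (by ring)
  · rw [hθ, eulerMap_C, MvPowerSeries.pderiv_X_self, mul_one]
  · intro s
    obtain ⟨F, rfl⟩ := Ideal.Quotient.mk_surjective s
    rw [hθ]
    refine map_dvd _ (C_dvd_iff.2 fun n => ?_)
    rw [coeff_eulerMap]
    exact dvd_mul_right _ _

/-! ### Total rings of deformations of the node -/

section NodeDeformations

variable {k : Type*} [Field k]

instance isScalarTower_powerSeries :
    IsScalarTower k (PowerSeries k) (PowerSeries (MvPowerSeries (Fin 2) k)) :=
  IsScalarTower.of_algebraMap_eq fun a => by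
    rw [PowerSeries.algebraMap_apply'', PowerSeries.algebraMap_apply, PowerSeries.algebraMap_apply,
      PowerSeries.map_C, Algebra.algebraMap_self, RingHom.id_apply]

variable (V : Def1Basis (node k)) (a : Fin V.d → k)

theorem range_deformationEquation_node :
    Set.range (deformationEquation V a) =
      {PowerSeries.C (MvPowerSeries.X 0 * MvPowerSeries.X 1) +
        PowerSeries.X * PowerSeries.C (∑ l, a l • V.δ l 0)} := by
  rw [Set.range_unique]
  rfl

/-- A vanishing constant term means a vanishing class in `Def¹`, where the `δ l` are independent.
Thus the trivial direction is the only one without a smoothing chart. -/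
theorem eq_zero_of_constantCoeff_eq_zero
    (h : MvPowerSeries.constantCoeff (∑ l, a l • V.δ l 0) = 0) : a = 0 := by
  have h0 : ∑ l, a l • (Submodule.Quotient.mk (V.δ l) : Def1 (node k)) = 0 := by
    have h1 : (Submodule.Quotient.mk (∑ l, a l • V.δ l) : Def1 (node k)) = 0 := by
      rw [Submodule.Quotient.mk_eq_zero, mem_trivialDeformations_node, Finset.sum_apply]
      exact h
    rw [← h1]
    exact (map_sum ((trivialDeformations (node k)).mkQ.restrictScalars k) _ _).symm
  funext l
  exact Fintype.linearIndependent_iff.1 V.linearIndependent a h0 l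

theorem exists_constantCoeff_ne_zero : ∃ l, MvPowerSeries.constantCoeff (V.δ l 0) ≠ 0 := by
  by_contra! h
  have h0 : ∀ l, (Submodule.Quotient.mk (V.δ l) : Def1 (node k)) = 0 := by
    intro l
    rw [Submodule.Quotient.mk_eq_zero, mem_trivialDeformations_node, h]
  have h1 : (Submodule.Quotient.mk (fun _ => 1) : Def1 (node k)) ∈
      Submodule.span k (Set.range fun l => (Submodule.Quotient.mk (V.δ l) : Def1 (node k))) := by
    rw [V.span_eq_top]; trivial
  simp only [h0] at h1
  have h2 : (Submodule.Quotient.mk (fun _ => 1) : Def1 (node k)) = 0 := by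
    refine (Submodule.mem_bot k).1 ((Submodule.span_le.2 ?_) h1)
    rintro _ ⟨l, rfl⟩
    simp
  rw [Submodule.Quotient.mk_eq_zero, mem_trivialDeformations_node] at h2
  simp at h2

theorem isEmpty_basis_dual_of_constantCoeff_eq_zero {m : ℕ} (hm : 1 < m)
    (h : MvPowerSeries.constantCoeff (∑ l, a l • V.δ l 0) = 0) :
    IsEmpty (Module.Basis (Fin m) (TotalRing V a)
      (Module.Dual (TotalRing V a) (PrincipalParts (PowerSeries k) (TotalRing V a) m))) := by
  obtain rfl := eq_zero_of_constantCoeff_eq_zero V a h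
  refine isEmpty_basis_dual_trivial_deformation hm ?_
  rw [range_deformationEquation_node]
  simp

/-- Modulo the maximal ideal of `k⟦x, y⟧` the equation is `t` times a unit, so Weierstrass division
leaves a unique remainder of degree zero in `t`. Hence `k⟦x, y⟧` maps isomorphically to the total
ring, and `t = -xy / u`. -/
theorem nonempty_smoothingChart (h : MvPowerSeries.constantCoeff (∑ l, a l • V.δ l 0) ≠ 0) :
    Nonempty (SmoothingChart k (TotalRing V a)) := by
  set u := ∑ l, a l • V.δ l 0 with hu
  have hunit : IsUnit u := by
    rw [MvPowerSeries.isUnit_iff_constantCoeff]; exact isUnit_iff_ne_zero.2 h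
  set g := PowerSeries.C (MvPowerSeries.X 0 * MvPowerSeries.X 1 : MvPowerSeries (Fin 2) k) +
    PowerSeries.X * PowerSeries.C u with hg
  have hspan : Ideal.span (Set.range (deformationEquation V a)) = Ideal.span {g} := by
    rw [range_deformationEquation_node]
  have hmap : g.map (IsLocalRing.residue (MvPowerSeries (Fin 2) k)) =
      PowerSeries.X * PowerSeries.C (IsLocalRing.residue (MvPowerSeries (Fin 2) k) u) := by
    have h0 : IsLocalRing.residue (MvPowerSeries (Fin 2) k) (MvPowerSeries.X 0) = 0 := by
      rw [IsLocalRing.residue_eq_zero_iff, IsLocalRing.mem_maximalIdeal, mem_nonunits_iff,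
        MvPowerSeries.isUnit_iff_constantCoeff]
      simp
    rw [hg, map_add, map_mul (PowerSeries.map _), PowerSeries.map_C, map_mul, h0, zero_mul,
      map_zero, zero_add, PowerSeries.map_X, PowerSeries.map_C]
  have hres : IsLocalRing.residue (MvPowerSeries (Fin 2) k) u ≠ 0 := (hunit.map _).ne_zero
  have hne : g.map (IsLocalRing.residue (MvPowerSeries (Fin 2) k)) ≠ 0 := by
    rw [hmap]
    exact mul_ne_zero PowerSeries.X_ne_zero (by simpa using hres)
  have hord : (g.map (Ideal.Quotient.mk (IsLocalRing.maximalIdeal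
      (MvPowerSeries (Fin 2) k)))).order.toNat = 1 := by
    change (g.map (IsLocalRing.residue (MvPowerSeries (Fin 2) k))).order.toNat = 1
    have : (PowerSeries.X * PowerSeries.C
        (IsLocalRing.residue (MvPowerSeries (Fin 2) k) u)).order = ((1 : ℕ) : ℕ∞) := by
      rw [PowerSeries.order_eq_nat]
      refine ⟨by simpa using hres, fun i hi => ?_⟩
      obtain rfl : i = 0 := by omega
      simp
    rw [hmap, this]
    rfl
  have hdiv := PowerSeries.IsWeierstrassDivisor.of_map_ne_zero hne
  let φ₀ : MvPowerSeries (Fin 2) k →ₐ[k] TotalRing V a :=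
    IsScalarTower.toAlgHom k (MvPowerSeries (Fin 2) k) (TotalRing V a)
  have hφ₀ : ∀ f, φ₀ f = Ideal.Quotient.mk _ (PowerSeries.C f) := fun _ => rfl
  have hbij : Function.Bijective φ₀ := by
    constructor
    · rw [injective_iff_map_eq_zero]
      intro f hf
      rw [hφ₀, Ideal.Quotient.eq_zero_iff_mem, hspan, Ideal.mem_span_singleton] at hf
      obtain ⟨q, hq⟩ := hf
      have := hdiv.eq_zero_of_mul_eq (q := q) (r := Polynomial.C f)
        (by rw [hord]; exact Polynomial.degree_C_le.trans_lt (by norm_num))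
        (by rw [← hq, Polynomial.coe_C])
      simpa using this.2
    · intro s
      obtain ⟨F, rfl⟩ := Ideal.Quotient.mk_surjective s
      obtain ⟨q, r, hqr⟩ := PowerSeries.exists_isWeierstrassDivision F hne
      have hr := hqr.degree_lt
      rw [hord] at hr
      obtain ⟨f, rfl⟩ : ∃ f, r = Polynomial.C f := ⟨_, Polynomial.eq_C_of_degree_le_zero
        (Nat.WithBot.lt_one_iff_le_zero.1 (by simpa using hr))⟩
      refine ⟨f, ?_⟩
      rw [hφ₀, Ideal.Quotient.eq, hspan, Ideal.mem_span_singleton]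
      refine ⟨-q, ?_⟩
      rw [hqr.eq_mul_add, Polynomial.coe_C]
      ring
  refine ⟨⟨AlgEquiv.ofBijective φ₀ hbij, -hunit.unit⁻¹, ?_⟩⟩
  rw [AlgEquiv.ofBijective_apply, hφ₀, IsScalarTower.algebraMap_apply (PowerSeries k)
    (PowerSeries (MvPowerSeries (Fin 2) k)), Ideal.Quotient.algebraMap_eq, Ideal.Quotient.eq, hspan,
    Ideal.mem_span_singleton, PowerSeries.algebraMap_apply'', PowerSeries.map_X]
  refine ⟨PowerSeries.C ↑(hunit.unit⁻¹), ?_⟩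
  have h1 : PowerSeries.C u * PowerSeries.C (↑(hunit.unit⁻¹) : MvPowerSeries (Fin 2) k) = 1 := by
    rw [← map_mul, hunit.mul_val_inv, map_one]
  rw [hg, Units.val_neg]
  simp only [map_mul, map_neg]
  linear_combination (- PowerSeries.X) * h1

end NodeDeformations

/-! ### Sums of distinct natural numbers -/

theorem choose_two_card_le_sum (A : Finset ℕ) : A.card.choose 2 ≤ ∑ i ∈ A, i := by
  induction A using Finset.induction_on_max with
  | empty => simp
  | insert a s hs ih =>
    have ha : a ∉ s := fun h => lt_irrefl _ (hs a h)
    have hcard : s.card ≤ a := by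
      simpa using Finset.card_le_card fun i hi => Finset.mem_range.2 (hs i hi)
    rw [Finset.card_insert_of_notMem ha, Finset.sum_insert ha, Nat.choose_succ_succ' s.card 1,
      Nat.choose_one_right]
    exact add_le_add hcard ih

/-- This equality case later singles out the terms of a minor that are exact corners. -/
theorem eq_range_of_sum_le (A : Finset ℕ) (h : ∑ i ∈ A, i ≤ A.card.choose 2) :
    A = Finset.range A.card := by
  induction A using Finset.induction_on_max with
  | empty => simp
  | insert a s hs ih =>
    have ha : a ∉ s := fun h => lt_irrefl _ (hs a h)
    have hcard : s.card ≤ a := by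
      simpa using Finset.card_le_card fun i hi => Finset.mem_range.2 (hs i hi)
    rw [Finset.card_insert_of_notMem ha, Finset.sum_insert ha, Nat.choose_succ_succ' s.card 1,
      Nat.choose_one_right, one_add_one_eq_two] at h
    have hle := choose_two_card_le_sum s
    obtain rfl : a = s.card := by omega
    rw [Finset.card_insert_of_notMem ha, Finset.range_add_one, ← ih (by omega)]

theorem choose_two_card_succ_le_sum (A : Finset ℕ) (hA : 0 ∉ A) :
    (A.card + 1).choose 2 ≤ ∑ i ∈ A, i := by
  simpa [hA] using choose_two_card_le_sum (insert 0 A)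

theorem insert_zero_eq_range_of_sum_le (A : Finset ℕ) (hA : 0 ∉ A)
    (h : ∑ i ∈ A, i ≤ (A.card + 1).choose 2) : insert 0 A = Finset.range (A.card + 1) := by
  have := eq_range_of_sum_le (insert 0 A) (by simpa [hA] using h)
  rwa [Finset.card_insert_of_notMem hA] at this

/-! ### The ideal of corners -/

section CornerIdeal

variable {S : Type*} [CommRing S] (x y : S)

/-- The ideal generated by `x ^ (a(a+1)/2) y ^ (b(b+1)/2)` with `a + b + 1 = s`. -/
def cornerIdeal (s : ℕ) : Ideal S :=
  Ideal.span {z | ∃ a b, a + b + 1 = s ∧ z = x ^ (a + 1).choose 2 * y ^ (b + 1).choose 2}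

variable {x y}

theorem corner_mem {a b s : ℕ} (h : a + b + 1 = s) :
    x ^ (a + 1).choose 2 * y ^ (b + 1).choose 2 ∈ cornerIdeal x y s :=
  Ideal.subset_span ⟨a, b, h, rfl⟩

theorem mul_mem_cornerIdeal {a b s P Q : ℕ} (h : a + b + 1 = s) (hP : (a + 1).choose 2 ≤ P)
    (hQ : (b + 1).choose 2 ≤ Q) : x ^ P * y ^ Q ∈ cornerIdeal x y s :=
  Ideal.mem_of_dvd _ (mul_dvd_mul (pow_dvd_pow x hP) (pow_dvd_pow y hQ)) (corner_mem h)

/-- If `p` weights are positive and `q` negative, the exponents of `x` and `y` are at least `1 + ⋯ +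
p` and `1 + ⋯ + q`; at most one weight is zero, so `p + q + 1 ≥ s`. -/
theorem prod_mem_cornerIdeal {s : ℕ} (hs : 1 ≤ s) {ν : Fin s → ℤ} (hν : Function.Injective ν) :
    ∏ l, (x ^ (ν l).toNat * y ^ (-ν l).toNat) ∈ cornerIdeal x y s := by
  have key : ∀ μ : Fin s → ℤ, Function.Injective μ →
      ((Finset.univ.filter fun l => 0 < μ l).card + 1).choose 2 ≤ ∑ l, (μ l).toNat := by
    intro μ hμ
    have hinj : Set.InjOn (fun l => (μ l).toNat)
        (Finset.univ.filter fun l => 0 < μ l : Finset (Fin s)) := by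
      intro i hi j hj hij
      simp only [Finset.coe_filter, Finset.mem_univ, true_and, Set.mem_ofPred_eq] at hi hj hij
      exact hμ (by omega)
    have h1 := choose_two_card_succ_le_sum
      ((Finset.univ.filter fun l => 0 < μ l).image fun l => (μ l).toNat) (by simp)
    rw [Finset.card_image_of_injOn hinj, Finset.sum_image hinj] at h1
    exact h1.trans (Finset.sum_le_sum_of_subset (Finset.filter_subset _ _))
  have hP := key ν hν
  have hQ := key (fun l => - ν l) (neg_injective.comp hν)
  set p := (Finset.univ.filter fun l => 0 < ν l).card
  set q := (Finset.univ.filter fun l => 0 < - ν l).card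
  have hpq : s ≤ p + q + 1 := by
    have hzero : (Finset.univ.filter fun l => ν l = 0).card ≤ 1 := by
      rw [Finset.card_le_one]
      intro i hi j hj
      simp only [Finset.mem_filter, Finset.mem_univ, true_and] at hi hj
      exact hν (hi.trans hj.symm)
    have hcover : (Finset.univ : Finset (Fin s)) ⊆
        ((Finset.univ.filter fun l => 0 < ν l) ∪ (Finset.univ.filter fun l => 0 < - ν l)) ∪
          (Finset.univ.filter fun l => ν l = 0) := by
      intro l _
      simp only [Finset.mem_union, Finset.mem_filter, Finset.mem_univ, true_and]
      omega
    have h1 := Finset.card_le_card hcover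
    have h2 := Finset.card_union_le ((Finset.univ.filter fun l => 0 < ν l) ∪
      (Finset.univ.filter fun l => 0 < - ν l)) (Finset.univ.filter fun l => ν l = 0)
    have h3 := Finset.card_union_le (Finset.univ.filter fun l => 0 < ν l)
      (Finset.univ.filter fun l => 0 < - ν l)
    rw [Finset.card_univ, Fintype.card_fin] at h1
    omega
  rw [Finset.prod_mul_distrib, Finset.prod_pow_eq_pow_sum, Finset.prod_pow_eq_pow_sum]
  -- Without a zero weight `p + q = s`, one more than a corner needs, and `p` can equal `s`; hence
  -- the truncation.
  refine mul_mem_cornerIdeal (a := min p (s - 1)) (b := s - 1 - min p (s - 1)) (by omega)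
    (le_trans (Nat.choose_le_choose 2 (by omega)) hP)
    (le_trans (Nat.choose_le_choose 2 (by omega)) hQ)

end CornerIdeal

/-- After multilinear expansion, a repeated weight repeats an argument and the alternating map
vanishes. -/
theorem multilinear_mem_of_mem_span {S : Type*} [CommRing S] {s : ℕ} (I : Ideal S) (z : ℤ → S)
    {M : Type*} [AddCommGroup M] [Module S M] (w : ℤ → M) (f : M [⋀^Fin s]→ₗ[S] S)
    (hz : ∀ ν : Fin s → ℤ, Function.Injective ν → ∏ l, z (ν l) ∈ I) (v : Fin s → M)
    (hv : ∀ l, v l ∈ Submodule.span S (Set.range fun n => z n • w n)) : f v ∈ I := by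
  classical
  choose d hd using fun l => Finsupp.mem_span_range_iff_exists_finsupp.1 (hv l)
  have hvd : v = fun l => ∑ n ∈ (d l).support, (d l n * z n) • w n := by
    funext l
    rw [← hd l, Finsupp.sum]
    exact Finset.sum_congr rfl fun n _ => (mul_smul _ _ _).symm
  rw [hvd]
  have hsum := f.toMultilinearMap.map_sum_finset (fun l n => (d l n * z n) • w n)
    (fun l => (d l).support)
  rw [AlternatingMap.coe_multilinearMap] at hsum
  rw [hsum]
  refine Ideal.sum_mem _ fun ν _ => ?_
  rw [← AlternatingMap.coe_multilinearMap, MultilinearMap.map_smul_univ, smul_eq_mul]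
  by_cases hν : Function.Injective ν
  · rw [Finset.prod_mul_distrib]
    exact Ideal.mul_mem_right _ _ (Ideal.mul_mem_left _ _ (hz ν hν))
  · rw [AlternatingMap.coe_multilinearMap,
      AlternatingMap.map_eq_zero_of_not_injective f (fun l => w (ν l)), mul_zero]
    · exact Ideal.zero_mem _
    · exact fun h => hν (Function.Injective.of_comp (f := w) h)

theorem det_sub_det_mem {S : Type*} [CommRing S] {s : ℕ} (I : Ideal S)
    {M M' : Matrix (Fin s) (Fin s) S} (h : ∀ i j, M i j - M' i j ∈ I) : M.det - M'.det ∈ I := by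
  rw [← Ideal.Quotient.eq, RingHom.map_det, RingHom.map_det]
  congr 1
  ext i j
  exact Ideal.Quotient.eq.2 (h i j)

/-! ### Minors of degeneracy matrices lie in the corner ideal -/

namespace SmoothingChart

variable {k S : Type*} [Field k] [CommRing S] [Algebra k S] [Algebra (PowerSeries k) S]
  [IsScalarTower k (PowerSeries k) S] (c : SmoothingChart k S) {m : ℕ}

theorem det_mem_cornerIdeal {s : ℕ} (hs : 1 ≤ s)
    (e : Fin s → Module.Dual S (PrincipalParts (PowerSeries k) S m))
    (τ : Fin s → PrincipalParts (PowerSeries k) S m) :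
    (Matrix.of fun i l => e i (τ l)).det ∈ cornerIdeal c.x c.y s := by
  obtain ⟨w, hw⟩ := c.exists_approx_mem_span e
  -- At this order the error lies in `(x ^ s.choose 2, y ^ s.choose 2)`, which is generated by the
  -- two extreme corners.
  choose v hv hev using fun l => hw (τ l) (s.choose 2 + s.choose 2)
  have h1 : (Matrix.of v).det ∈ cornerIdeal c.x c.y s :=
    multilinear_mem_of_mem_span _ c.z w Matrix.detRowAlternating
      (fun ν hν => prod_mem_cornerIdeal hs hν) v hv
  have h2 : Ideal.jacobson (⊥ : Ideal S) ^ (s.choose 2 + s.choose 2) ≤ cornerIdeal c.x c.y s := by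
    obtain ⟨s, rfl⟩ := Nat.exists_eq_add_of_le' hs
    refine (c.jacobson_pow_le _).trans (sup_le ?_ ?_) <;> rw [Ideal.span_singleton_le_iff_mem]
    · simpa using corner_mem (x := c.x) (y := c.y) (a := s) (b := 0) rfl
    · simpa using corner_mem (x := c.x) (y := c.y) (a := 0) (b := s) (by omega)
  have h3 := h2 (det_sub_det_mem _ (M := (Matrix.of fun i l => e i (τ l)))
    (M' := (Matrix.of v).transpose) fun i l => hev l i)
  rw [Matrix.det_transpose] at h3
  simpa using add_mem h3 h1

theorem degeneracyIdeal_le_cornerIdeal {n : ℕ} (hs : 1 ≤ min m n)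
    (e : Module.Basis (Fin m) S (Module.Dual S (PrincipalParts (PowerSeries k) S m)))
    (τ : Fin n → PrincipalParts (PowerSeries k) S m) :
    degeneracyIdeal e τ ≤ cornerIdeal c.x c.y (min m n) := by
  rw [degeneracyIdeal, maximalMinorsIdeal, Ideal.span_le]
  rintro _ ⟨p, q, rfl⟩
  exact c.det_mem_cornerIdeal hs (fun i => e (p i)) (fun l => τ (q l))

end SmoothingChart

/-! ### Monomial ideals in two variables -/

/-- The ideal generated by the monomials in `x` and `y` with exponents in `D`. -/
def monomialIdeal {S : Type*} [CommRing S] (x y : S) (D : Set (ℕ × ℕ)) : Ideal S :=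
  Ideal.span ((fun d : ℕ × ℕ => x ^ d.1 * y ^ d.2) '' D)

theorem monomial_mem_monomialIdeal {S : Type*} [CommRing S] {x y : S} {D : Set (ℕ × ℕ)}
    {d : ℕ × ℕ} (h : d ∈ D) : x ^ d.1 * y ^ d.2 ∈ monomialIdeal x y D :=
  Ideal.subset_span ⟨d, h, rfl⟩

theorem monomialIdeal_le {S : Type*} [CommRing S] {x y : S} {D : Set (ℕ × ℕ)} {I : Ideal S}
    (h : ∀ d ∈ D, x ^ d.1 * y ^ d.2 ∈ I) : monomialIdeal x y D ≤ I := by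
  rw [monomialIdeal, Ideal.span_le]
  rintro _ ⟨d, hd, rfl⟩
  exact h d hd

/-- The exponents of the generators of `cornerIdeal`. -/
def corners (s : ℕ) : Set (ℕ × ℕ) :=
  {d | ∃ a b, a + b + 1 = s ∧ d = ((a + 1).choose 2, (b + 1).choose 2)}

theorem cornerIdeal_eq_monomialIdeal {S : Type*} [CommRing S] (x y : S) (s : ℕ) :
    cornerIdeal x y s = monomialIdeal x y (corners s) := by
  rw [cornerIdeal, monomialIdeal]
  congr 1
  ext z
  constructor
  · rintro ⟨a, b, h, rfl⟩
    exact ⟨_, ⟨a, b, h, rfl⟩, rfl⟩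
  · rintro ⟨_, ⟨a, b, h, rfl⟩, rfl⟩
    exact ⟨a, b, h, rfl⟩

theorem finite_corners (s : ℕ) : (corners s).Finite := by
  refine ((Finset.range s).finite_toSet.image fun a =>
    ((a + 1).choose 2, (s - 1 - a + 1).choose 2)).subset ?_
  rintro _ ⟨a, b, h, rfl⟩
  refine ⟨a, by simp; omega, ?_⟩
  simp only [Prod.mk.injEq, true_and]
  congr 1
  omega

section TwoVariables

variable {k : Type*} [Field k]

/-- A pair of natural numbers as an exponent. -/
noncomputable def expo (d : ℕ × ℕ) : Fin 2 →₀ ℕ := Finsupp.single 0 d.1 + Finsupp.single 1 d.2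

@[simp]
theorem expo_zero (d : ℕ × ℕ) : expo d 0 = d.1 := by simp [expo]

@[simp]
theorem expo_one (d : ℕ × ℕ) : expo d 1 = d.2 := by simp [expo]

theorem expo_eta (n : Fin 2 →₀ ℕ) : expo (n 0, n 1) = n := by
  ext i; fin_cases i <;> simp

theorem expo_le_expo {d e : ℕ × ℕ} : expo d ≤ expo e ↔ d ≤ e := by
  rw [Finsupp.le_def, Fin.forall_fin_two]
  simp [Prod.le_def]

theorem expo_injective : Function.Injective expo := fun d e h => by
  ext
  · simpa using DFunLike.congr_fun h 0
  · simpa using DFunLike.congr_fun h 1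

theorem X_pow_mul_X_pow (d : ℕ × ℕ) :
    (MvPowerSeries.X 0 : MvPowerSeries (Fin 2) k) ^ d.1 * MvPowerSeries.X 1 ^ d.2 =
      MvPowerSeries.monomial (expo d) 1 := by
  rw [MvPowerSeries.X_pow_eq, MvPowerSeries.X_pow_eq, MvPowerSeries.monomial_mul_monomial, mul_one,
    expo]

theorem coeff_eq_zero_of_mem_monomialIdeal {D : Set (ℕ × ℕ)} {h : MvPowerSeries (Fin 2) k}
    (hh : h ∈ monomialIdeal (MvPowerSeries.X 0) (MvPowerSeries.X 1) D) {d : ℕ × ℕ}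
    (hd : ∀ e ∈ D, ¬ e ≤ d) : MvPowerSeries.coeff (expo d) h = 0 := by
  classical
  induction hh using Submodule.span_induction generalizing d with
  | mem h hh =>
    obtain ⟨e, he, rfl⟩ := hh
    dsimp only
    rw [X_pow_mul_X_pow, MvPowerSeries.coeff_monomial, if_neg]
    exact fun h => hd e he (expo_injective h).ge
  | zero => simp
  | add f g _ _ hf hg => rw [map_add, hf hd, hg hd, add_zero]
  | smul a f _ hf =>
    rw [smul_eq_mul, MvPowerSeries.coeff_mul]
    refine Finset.sum_eq_zero fun p hp => ?_
    rw [← expo_eta p.2, hf, mul_zero]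
    intro e he hle
    refine hd e he (hle.trans ?_)
    rw [← expo_le_expo, expo_eta, ← Finset.HasAntidiagonal.mem_antidiagonal.1 hp]
    exact le_add_self

/-- For each generator in turn, the part of the series supported on its multiples is split off. -/
theorem mem_monomialIdeal_of_coeff {D : Set (ℕ × ℕ)} (hD : D.Finite) {h : MvPowerSeries (Fin 2) k}
    (hh : ∀ d, (∀ e ∈ D, ¬ e ≤ d) → MvPowerSeries.coeff (expo d) h = 0) :
    h ∈ monomialIdeal (MvPowerSeries.X 0) (MvPowerSeries.X 1) D := by
  classical
  induction D, hD using Set.Finite.induction_on generalizing h with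
  | empty =>
    have : h = 0 := by
      ext n
      rw [← expo_eta n, hh _ (by simp), map_zero]
    rw [this]
    exact Ideal.zero_mem _
  | @insert e D _ _ ih =>
    let q : MvPowerSeries (Fin 2) k := fun n => MvPowerSeries.coeff (expo e + n) h
    have hq : ∀ n, MvPowerSeries.coeff n q = MvPowerSeries.coeff (expo e + n) h := fun _ => rfl
    have hmem : MvPowerSeries.monomial (expo e) 1 * q ∈
        monomialIdeal (MvPowerSeries.X 0) (MvPowerSeries.X 1) (insert e D) := by
      rw [← X_pow_mul_X_pow]
      exact Ideal.mul_mem_right _ _ (monomial_mem_monomialIdeal (Set.mem_insert _ _))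
    have hsub : h - MvPowerSeries.monomial (expo e) 1 * q ∈
        monomialIdeal (MvPowerSeries.X 0) (MvPowerSeries.X 1) D := by
      refine ih fun d hd => ?_
      rw [map_sub, MvPowerSeries.coeff_monomial_mul, one_mul]
      split_ifs with hle
      · rw [hq, add_tsub_cancel_of_le hle, sub_self]
      · rw [sub_zero]
        refine hh d fun e' he' => ?_
        rcases he' with rfl | he'
        · rwa [← expo_le_expo]
        · exact hd e' he'
    have := add_mem (Ideal.span_mono (Set.image_mono (Set.subset_insert e D)) hsub) hmem
    rwa [sub_add_cancel] at this

end TwoVariables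

/-! ### Colengths of ideals -/

namespace SmoothingChart

universe u

variable {k S : Type u} [Field k] [CommRing S] [Algebra k S] [Algebra (PowerSeries k) S]
  (c : SmoothingChart k S)

/-- Since `x` is `X₀` up to a unit, both pairs of coordinates generate the same monomial ideals, so
plain coefficients in `X₀, X₁` suffice to compute colengths. -/
theorem symm_mem_monomialIdeal_iff {D : Set (ℕ × ℕ)} {s : S} :
    c.φ.symm s ∈ monomialIdeal (MvPowerSeries.X 0) (MvPowerSeries.X 1) D ↔
      s ∈ monomialIdeal c.x c.y D := by
  constructor
  · intro h
    have hle : monomialIdeal (MvPowerSeries.X 0) (MvPowerSeries.X 1) D ≤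
        (monomialIdeal c.x c.y D).comap c.φ := by
      refine monomialIdeal_le fun d hd => ?_
      rw [Ideal.mem_comap, map_mul, map_pow, map_pow]
      exact Ideal.mem_of_dvd _ (mul_dvd_mul (pow_dvd_pow_of_dvd c.associated_x.symm.dvd _) dvd_rfl)
        (monomial_mem_monomialIdeal hd)
    simpa using hle h
  · intro h
    have hle : monomialIdeal c.x c.y D ≤
        (monomialIdeal (MvPowerSeries.X 0) (MvPowerSeries.X 1) D).comap c.φ.symm := by
      refine monomialIdeal_le fun d hd => ?_
      rw [Ideal.mem_comap, map_mul, map_pow, map_pow, x, y, AlgEquiv.symm_apply_apply,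
        AlgEquiv.symm_apply_apply]
      exact Ideal.mem_of_dvd _ (mul_dvd_mul (pow_dvd_pow_of_dvd (dvd_mul_right _ _) _) dvd_rfl)
        (monomial_mem_monomialIdeal hd)
    exact hle h

/-- The coefficients with exponents in a finite set. -/
noncomputable def coeffs (E : Finset (ℕ × ℕ)) : S →ₗ[k] (E → k) :=
  LinearMap.pi fun d => MvPowerSeries.coeff (expo d) ∘ₗ c.φ.symm.toLinearMap

theorem coeffs_apply (E : Finset (ℕ × ℕ)) (s : S) (d : E) :
    c.coeffs E s d = MvPowerSeries.coeff (expo d) (c.φ.symm s) := rfl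

theorem coeffs_surjective (E : Finset (ℕ × ℕ)) : Function.Surjective (c.coeffs E) := by
  classical
  intro v
  refine ⟨c.φ (∑ d : E, MvPowerSeries.monomial (expo d) (v d)), ?_⟩
  funext e
  rw [coeffs_apply, AlgEquiv.symm_apply_apply, map_sum, Finset.sum_eq_single e]
  · rw [MvPowerSeries.coeff_monomial_same]
  · intro d _ hd
    rw [MvPowerSeries.coeff_monomial, if_neg]
    exact fun h => hd (Subtype.ext (expo_injective h).symm)
  · simp

theorem coeffs_eq_zero_of_mem {D : Set (ℕ × ℕ)} {E : Finset (ℕ × ℕ)}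
    (hE : ∀ d ∈ E, ∀ e ∈ D, ¬ e ≤ d) {s : S} (hs : s ∈ monomialIdeal c.x c.y D) :
    c.coeffs E s = 0 := by
  funext d
  exact coeff_eq_zero_of_mem_monomialIdeal (c.symm_mem_monomialIdeal_iff.2 hs) (hE d d.2)

theorem mem_of_coeffs_eq_zero {D : Set (ℕ × ℕ)} (hD : D.Finite) {E : Finset (ℕ × ℕ)}
    (hE : ∀ d, (∀ e ∈ D, ¬ e ≤ d) → d ∈ E) {s : S} (hs : c.coeffs E s = 0) :
    s ∈ monomialIdeal c.x c.y D :=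
  c.symm_mem_monomialIdeal_iff.1
    (mem_monomialIdeal_of_coeff hD fun d hd => congrFun hs ⟨d, hE d hd⟩)

theorem toENat_rank_quotient (E : Finset (ℕ × ℕ)) (W : Submodule k (E → k)) :
    Cardinal.toENat (Module.rank k ((E → k) ⧸ W)) = ((E.card - Module.finrank k W : ℕ) : ℕ∞) := by
  rw [← Module.finrank_eq_rank, Cardinal.toENat_nat, Submodule.finrank_quotient,
    Module.finrank_fintype_fun_eq_card, Fintype.card_coe]

/-- The subspace `W` leaves room for ideals that are not monomial; it is zero for corner ideals and
a line for lists of length `m`. -/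
theorem le_toENat_rank_quotient (E : Finset (ℕ × ℕ)) (W : Submodule k (E → k)) {I : Ideal S}
    (h : ∀ s ∈ I, c.coeffs E s ∈ W) :
    ((E.card - Module.finrank k W : ℕ) : ℕ∞) ≤ Cardinal.toENat (Module.rank k (S ⧸ I)) := by
  rw [← toENat_rank_quotient]
  refine OrderHomClass.mono Cardinal.toENat ?_
  let f : (S ⧸ I) →ₗ[k] ((E → k) ⧸ W) :=
    Submodule.liftQ (I.restrictScalars k) (W.mkQ ∘ₗ c.coeffs E) (fun s hs => by
      simpa using h s hs) ∘ₗ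
      (Submodule.Quotient.restrictScalarsEquiv k I).symm.toLinearMap
  refine LinearMap.rank_le_of_surjective f fun v => ?_
  obtain ⟨v, rfl⟩ := W.mkQ_surjective v
  obtain ⟨s, rfl⟩ := c.coeffs_surjective E v
  exact ⟨Ideal.Quotient.mk I s, rfl⟩

theorem toENat_rank_quotient_le (E : Finset (ℕ × ℕ)) (W : Submodule k (E → k)) {I : Ideal S}
    (h : ∀ s, c.coeffs E s ∈ W → s ∈ I) :
    Cardinal.toENat (Module.rank k (S ⧸ I)) ≤ ((E.card - Module.finrank k W : ℕ) : ℕ∞) := by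
  rw [← toENat_rank_quotient]
  refine OrderHomClass.mono Cardinal.toENat ?_
  have hsurj : Function.Surjective (W.mkQ ∘ₗ c.coeffs E) :=
    W.mkQ_surjective.comp (c.coeffs_surjective E)
  let f : (S ⧸ LinearMap.ker (W.mkQ ∘ₗ c.coeffs E)) →ₗ[k] (S ⧸ I) :=
    (Submodule.Quotient.restrictScalarsEquiv k I).toLinearMap ∘ₗ
      Submodule.mapQ _ (I.restrictScalars k) LinearMap.id (fun s hs => h s (by simpa using hs))
  rw [← (LinearMap.quotKerEquivOfSurjective _ hsurj).rank_eq]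
  refine LinearMap.rank_le_of_surjective f fun v => ?_
  obtain ⟨s, rfl⟩ := Ideal.Quotient.mk_surjective v
  exact ⟨Submodule.Quotient.mk s, rfl⟩

end SmoothingChart

/-! ### Counting the monomials outside the ideal of corners -/

/-- The exponents of the monomials outside `cornerIdeal`. -/
def staircase (s : ℕ) : Finset (ℕ × ℕ) :=
  (Finset.range s).biUnion fun a =>
    Finset.Ico ((a + 1).choose 2) ((a + 2).choose 2) ×ˢ Finset.range ((s - 1 - a + 1).choose 2)

/-- For a first exponent in block `a`, the binding corner is the one with index `a`, the last
reached on the `x`-side. Block `s - 1` is empty, which accounts for the pure power of `x`. -/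
theorem mem_staircase {s : ℕ} (hs : 1 ≤ s) (d : ℕ × ℕ) :
    d ∈ staircase s ↔ ∀ e ∈ corners s, ¬ e ≤ d := by
  simp only [staircase, Finset.mem_biUnion, Finset.mem_range, Finset.mem_product, Finset.mem_Ico]
  constructor
  · rintro ⟨a₀, ha₀, ⟨h1, h2⟩, h3⟩ _ ⟨a, b, hab, rfl⟩ ⟨h4, h5⟩
    dsimp only at h4 h5
    have ha : a ≤ a₀ := by
      by_contra! h
      have := Nat.choose_le_choose 2 (show a₀ + 2 ≤ a + 1 by omega)
      omega
    have := Nat.choose_le_choose 2 (show s - 1 - a₀ + 1 ≤ b + 1 by omega)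
    omega
  · intro h
    have hex : ∃ a, d.1 < (a + 2).choose 2 := by
      refine ⟨d.1, ?_⟩
      rw [Nat.choose_succ_succ' (d.1 + 1) 1, Nat.choose_one_right]
      omega
    classical
    set a := Nat.find hex with ha
    have h1 : (a + 1).choose 2 ≤ d.1 := by
      rcases Nat.eq_zero_or_pos a with h0 | hpos
      · simp [h0]
      · have := Nat.find_min hex (m := a - 1) (by omega)
        rwa [show a - 1 + 2 = a + 1 by omega, not_lt] at this
    have has : a < s := by
      by_contra! hge
      refine h (s.choose 2, 0) ⟨s - 1, 0, by omega, ?_⟩ ⟨?_, Nat.zero_le _⟩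
      · rw [Nat.sub_add_cancel hs]; simp
      · exact (Nat.choose_le_choose 2 (by omega)).trans h1
    refine ⟨a, has, ⟨h1, Nat.find_spec hex⟩, ?_⟩
    by_contra! hge
    exact h _ ⟨a, s - 1 - a, by omega, rfl⟩ ⟨h1, hge⟩

theorem sum_succ (s : ℕ) : ∑ a ∈ Finset.range s, (a + 1) = (s + 1).choose 2 := by
  induction s with
  | zero => simp
  | succ s ih =>
    rw [Finset.sum_range_succ, ih, Nat.choose_succ_succ' (s + 1) 1, Nat.choose_one_right, add_comm]

theorem sum_succ_mul_sub (s : ℕ) :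
    ∑ a ∈ Finset.range s, (a + 1) * (s - a) = (s + 2).choose 3 := by
  induction s with
  | zero => simp
  | succ s ih =>
    have h : ∀ a ∈ Finset.range (s + 1), (a + 1) * (s + 1 - a) = (a + 1) * (s - a) + (a + 1) := by
      intro a ha
      rw [Nat.succ_sub (Nat.lt_succ_iff.1 (Finset.mem_range.1 ha)), Nat.mul_succ]
    rw [Finset.sum_congr rfl h, Finset.sum_add_distrib, sum_succ, Finset.sum_range_succ, ih,
      Nat.sub_self, mul_zero, add_zero, Nat.choose_succ_succ' (s + 2) 2, add_comm]

/-- Passing from `s` to `s + 1` splits each binomial by Pascal's rule, and the increment is the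
preceding sum. -/
theorem sum_succ_mul_choose (s : ℕ) :
    ∑ a ∈ Finset.range s, (a + 1) * (s - a).choose 2 = (s + 2).choose 4 := by
  induction s with
  | zero => simp [Nat.choose_eq_zero_of_lt]
  | succ s ih =>
    have h : ∀ a ∈ Finset.range (s + 1), (a + 1) * (s + 1 - a).choose 2 =
        (a + 1) * (s - a) + (a + 1) * (s - a).choose 2 := by
      intro a ha
      rw [Nat.succ_sub (Nat.lt_succ_iff.1 (Finset.mem_range.1 ha)), Nat.succ_eq_add_one,
        Nat.choose_succ_succ' (s - a) 1, Nat.choose_one_right, Nat.mul_add]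
    rw [Finset.sum_congr rfl h, Finset.sum_add_distrib, Finset.sum_range_succ,
      Finset.sum_range_succ, ih, sum_succ_mul_sub, Nat.sub_self, mul_zero, add_zero,
      Nat.choose_zero_succ, mul_zero, add_zero, Nat.choose_succ_succ' (s + 2) 3]

theorem card_staircase (s : ℕ) : (staircase s).card = (s + 2).choose 4 := by
  rw [staircase, Finset.card_biUnion, ← sum_succ_mul_choose]
  · refine Finset.sum_congr rfl fun a ha => ?_
    have ha := Finset.mem_range.1 ha
    rw [Finset.card_product, Nat.card_Ico, Finset.card_range, Nat.choose_succ_succ' (a + 1) 1,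
      Nat.choose_one_right, Nat.add_sub_cancel, show s - 1 - a + 1 = s - a by omega]
  · intro a _ b _ hab
    rw [Function.onFun, Finset.disjoint_left]
    rintro d hd hd'
    simp only [Finset.mem_product, Finset.mem_Ico] at hd hd'
    rcases lt_or_gt_of_ne hab with h | h
    · have := Nat.choose_le_choose 2 (show a + 2 ≤ b + 1 by omega)
      omega
    · have := Nat.choose_le_choose 2 (show b + 2 ≤ a + 1 by omega)
      omega

namespace SmoothingChart

universe u

variable {k S : Type u} [Field k] [CommRing S] [Algebra k S] [Algebra (PowerSeries k) S]
  (c : SmoothingChart k S)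

theorem le_rank_quotient_of_le_cornerIdeal {s : ℕ} (hs : 1 ≤ s) {I : Ideal S}
    (h : I ≤ cornerIdeal c.x c.y s) :
    (((s + 2).choose 4 : ℕ) : ℕ∞) ≤ Cardinal.toENat (Module.rank k (S ⧸ I)) := by
  have := c.le_toENat_rank_quotient (staircase s) ⊥ (I := I) fun t ht => by
    rw [Submodule.mem_bot]
    refine c.coeffs_eq_zero_of_mem (D := corners s) (fun d hd => (mem_staircase hs d).1 hd) ?_
    rw [← cornerIdeal_eq_monomialIdeal]
    exact h ht
  simpa [card_staircase] using this

theorem rank_quotient_le_of_cornerIdeal_le {s : ℕ} (hs : 1 ≤ s) {I : Ideal S}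
    (h : cornerIdeal c.x c.y s ≤ I) :
    Cardinal.toENat (Module.rank k (S ⧸ I)) ≤ (((s + 2).choose 4 : ℕ) : ℕ∞) := by
  have := c.toENat_rank_quotient_le (staircase s) ⊥ (I := I) fun t ht => by
    refine h ?_
    rw [cornerIdeal_eq_monomialIdeal]
    exact c.mem_of_coeffs_eq_zero (finite_corners s) (fun d hd => (mem_staircase hs d).2 hd)
      ((Submodule.mem_bot k).1 ht)
  simpa [card_staircase] using this

end SmoothingChart

/-! ### Lists with small degeneracy ideals -/

section Expansion

variable {S : Type*} [CommRing S]

variable (S) in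
/-- The vector of powers of an integer. -/
def powerVec (m : ℕ) (ν : ℤ) : Fin m → S := fun j => (ν : S) ^ (j : ℕ)

/-- The column of the degeneracy matrix defined by `x ^ i + y ^ (n - i)`, or by `1` for `i = 0`. -/
def nodeColumn (x y : S) (m n i : ℕ) : Fin m → S :=
  x ^ i • powerVec S m i + if i = 0 then 0 else y ^ (n - i) • powerVec S m (i - n)

/-- The choice, for each column, of one of the two summands. -/
def chosenVec {s : ℕ} (r : Fin s → ℕ) (m n : ℕ) (A : Finset (Fin s)) : Fin s → Fin m → S :=
  fun l => powerVec S m (if l ∈ A then r l else r l - n)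

/-- `A` records the columns contributing their power of `x`. Column `0` has no `y`-summand, so it
must belong to `A`. -/
theorem multilinear_nodeColumn {m n s : ℕ} (x y : S) (r : Fin s → ℕ)
    (f : MultilinearMap S (fun _ : Fin s => Fin m → S) S) :
    f (fun l => nodeColumn x y m n (r l)) = ∑ A : Finset (Fin s),
      if ∀ l ∉ A, r l ≠ 0 then
        x ^ (∑ l ∈ A, r l) * y ^ (∑ l ∈ Aᶜ, (n - r l)) * f (chosenVec r m n A) else 0 := by
  classical
  have h := f.map_add_univ (fun l => x ^ r l • powerVec S m (r l))
    (fun l => if r l = 0 then 0 else y ^ (n - r l) • powerVec S m (r l - n))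
  refine Eq.trans ?_ (h.trans (Finset.sum_congr rfl fun A _ => ?_))
  · rfl
  split_ifs with hA
  · have : A.piecewise (fun l => x ^ r l • powerVec S m (r l))
        (fun l => if r l = 0 then 0 else y ^ (n - r l) • powerVec S m (r l - n)) =
        fun l => A.piecewise (fun l => x ^ r l) (fun l => y ^ (n - r l)) l •
          chosenVec r m n A l := by
      funext l
      by_cases hl : l ∈ A
      · simp [hl, chosenVec]
      · simp [hl, chosenVec, hA l hl]
    rw [this, MultilinearMap.map_smul_univ, Finset.prod_piecewise, Finset.univ_inter,
      ← Finset.compl_eq_univ_sdiff, Finset.prod_pow_eq_pow_sum, Finset.prod_pow_eq_pow_sum,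
      smul_eq_mul]
  · push Not at hA
    obtain ⟨l, hl, hr⟩ := hA
    exact f.map_coord_zero l (by simp [hl, hr])

theorem mem_of_multilinear_nodeColumn_mem {m n s : ℕ} {x y : S} {r : Fin s → ℕ}
    {f : MultilinearMap S (fun _ : Fin s => Fin m → S) S} {K : Ideal S} (A : Finset (Fin s))
    (hA : ∀ l ∉ A, r l ≠ 0) (hf : f (fun l => nodeColumn x y m n (r l)) ∈ K)
    (hK : ∀ B : Finset (Fin s), B ≠ A → (∀ l ∉ B, r l ≠ 0) →
      x ^ (∑ l ∈ B, r l) * y ^ (∑ l ∈ Bᶜ, (n - r l)) * f (chosenVec r m n B) ∈ K)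
    (hu : IsUnit (f (chosenVec r m n A))) :
    x ^ (∑ l ∈ A, r l) * y ^ (∑ l ∈ Aᶜ, (n - r l)) ∈ K := by
  classical
  rw [multilinear_nodeColumn, ← Finset.add_sum_erase _ _ (Finset.mem_univ A), if_pos hA] at hf
  refine (Ideal.mul_unit_mem_iff_mem K hu).1 ((Submodule.add_mem_iff_left _ ?_).1 hf)
  refine Ideal.sum_mem _ fun B hB => ?_
  split_ifs with hB'
  · exact hK B (Finset.ne_of_mem_erase hB) hB'
  · exact Ideal.zero_mem _

/-- Both exponents are sums of distinct integers. If either exceeds its minimum, a factor of `x` or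
`y` can be split off a multiple of a corner; otherwise the equality case forces initial segments on
both sides. -/
theorem mem_mul_cornerIdeal_or {n s : ℕ} {x y : S} {𝔪 : Ideal S} (hx : x ∈ 𝔪) (hy : y ∈ 𝔪)
    {r : Fin s → ℕ} (hr : Function.Injective r) (hn : ∀ l, r l < n) {l₀ : Fin s} (h₀ : r l₀ = 0)
    {A : Finset (Fin s)} (hA : ∀ l ∉ A, r l ≠ 0) :
    x ^ (∑ l ∈ A, r l) * y ^ (∑ l ∈ Aᶜ, (n - r l)) ∈ 𝔪 * cornerIdeal x y s ∨
      (A.image r = Finset.range A.card ∧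
        insert 0 (Aᶜ.image fun l => n - r l) = Finset.range (Aᶜ.card + 1)) := by
  have hl₀ : l₀ ∈ A := by
    by_contra h
    exact hA l₀ h h₀
  have hcard := Finset.card_add_card_compl A
  rw [Fintype.card_fin] at hcard
  have hpos : 0 < A.card := Finset.card_pos.2 ⟨l₀, hl₀⟩
  have hinj : Function.Injective fun l => n - r l := fun i j hij => by
    have := hn i
    have := hn j
    exact hr (by dsimp only at hij; omega)
  have h0 : 0 ∉ Aᶜ.image fun l => n - r l := by
    simp only [Finset.mem_image, not_exists, not_and]
    intro l _
    have := hn l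
    omega
  have hP := choose_two_card_le_sum (A.image r)
  have hQ := choose_two_card_succ_le_sum _ h0
  have hP' := eq_range_of_sum_le (A.image r)
  have hQ' := insert_zero_eq_range_of_sum_le _ h0
  rw [Finset.card_image_of_injective _ hr, Finset.sum_image hr.injOn] at hP hP'
  rw [Finset.card_image_of_injective _ hinj, Finset.sum_image hinj.injOn] at hQ hQ'
  rcases hP.lt_or_eq with hlt | heq
  · left
    obtain ⟨P, hPe⟩ := Nat.exists_eq_add_of_le' (Nat.one_le_of_lt hlt)
    rw [hPe, pow_succ', mul_assoc]
    exact Ideal.mul_mem_mul hx (mul_mem_cornerIdeal (a := A.card - 1) (b := Aᶜ.card) (by omega)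
      (by rw [Nat.sub_add_cancel hpos]; omega) hQ)
  rcases hQ.lt_or_eq with hlt | heq'
  · left
    obtain ⟨Q, hQe⟩ := Nat.exists_eq_add_of_le' (Nat.one_le_of_lt hlt)
    rw [hQe, pow_succ', mul_left_comm]
    exact Ideal.mul_mem_mul hy (mul_mem_cornerIdeal (a := A.card - 1) (b := Aᶜ.card) (by omega)
      (by rw [Nat.sub_add_cancel hpos]; omega) (by omega))
  exact Or.inr ⟨hP' heq.ge, hQ' heq'.ge⟩

theorem isUnit_det_powerVec {k : Type*} [Field k] [CharZero k] [Algebra k S] {s : ℕ}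
    {ν : Fin s → ℤ} (hν : Function.Injective ν) :
    IsUnit (Matrix.of fun l => powerVec S s (ν l)).det := by
  have : (Matrix.of fun l => powerVec S s (ν l)) =
      (algebraMap k S).mapMatrix (Matrix.vandermonde fun l => (ν l : k)) := by
    ext i j; simp [Matrix.vandermonde_apply, powerVec]
  rw [this, ← RingHom.map_det]
  refine IsUnit.map _ (isUnit_iff_ne_zero.2 ?_)
  rw [Matrix.det_vandermonde_ne_zero_iff]
  exact Int.cast_injective.comp hν

theorem minor_mem_maximalMinorsIdeal {m n s : ℕ} (h : min m n = s)
    (M : Matrix (Fin m) (Fin n) S) (p : Fin s ↪o Fin m) (q : Fin s ↪o Fin n) :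
    (M.submatrix p q).det ∈ maximalMinorsIdeal M := by
  subst h
  exact Ideal.subset_span ⟨p, q, rfl⟩

/-- The degeneracy matrix of the list `1, x + y ^ (n - 1), …, x ^ (n - 1) + y`. -/
def nodeMatrix (x y : S) (m n : ℕ) : Matrix (Fin m) (Fin n) S :=
  Matrix.of fun j l => nodeColumn x y m n l j

/-- Nakayama's lemma: terms in `(x, y)` times the corner ideal may be ignored. -/
theorem cornerIdeal_le_of_corners_mem {x y : S} {s : ℕ} {I : Ideal S}
    (hx : x ∈ Ideal.jacobson (⊥ : Ideal S)) (hy : y ∈ Ideal.jacobson (⊥ : Ideal S))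
    (h : ∀ a b, a + b + 1 = s → x ^ (a + 1).choose 2 * y ^ (b + 1).choose 2 ∈
      I ⊔ Ideal.span {x, y} * cornerIdeal x y s) :
    cornerIdeal x y s ≤ I := by
  refine Submodule.le_of_le_smul_of_le_jacobson_bot (I := Ideal.span {x, y}) ?_ ?_ ?_
  · rw [cornerIdeal_eq_monomialIdeal, monomialIdeal]
    exact Submodule.fg_span ((finite_corners s).image _)
  · rw [Ideal.span_le, Set.insert_subset_iff, Set.singleton_subset_iff]
    exact ⟨hx, hy⟩
  · rw [cornerIdeal, Ideal.span_le]
    rintro _ ⟨a, b, hab, rfl⟩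
    exact h a b hab

end Expansion

/-! ### Minors of the node matrix -/

section NodeMatrix

variable {S : Type*} [CommRing S]

/-- The two weights available in a column agree modulo `n`, and different columns have different
residues. -/
theorem chosenVec_node_injective {s n : ℕ} {r : Fin s → ℕ} (hr : Function.Injective r)
    (hn : ∀ l, r l < n) (A : Finset (Fin s)) :
    Function.Injective fun l => if l ∈ A then (r l : ℤ) else r l - n := by
  intro i j hij
  have := hn i
  have := hn j
  dsimp only at hij
  refine hr ?_
  split_ifs at hij <;> omega

theorem sum_id_range (a : ℕ) : ∑ i ∈ Finset.range a, i = a.choose 2 := by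
  rw [Finset.sum_range_id, Nat.choose_two_right]

theorem sum_eq_choose_two {s a : ℕ} {r : Fin s → ℕ} (hr : Function.Injective r)
    {A : Finset (Fin s)} (h : A.image r = Finset.range a) :
    ∑ l ∈ A, r l = a.choose 2 := by
  rw [← sum_id_range, ← h, Finset.sum_image hr.injOn]

theorem sum_sub_eq_choose_two {s b n : ℕ} {r : Fin s → ℕ} (hr : Function.Injective r)
    (hn : ∀ l, r l < n) {A : Finset (Fin s)}
    (h : insert 0 (A.image fun l => n - r l) = Finset.range b) :
    ∑ l ∈ A, (n - r l) = b.choose 2 := by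
  have hinj : Function.Injective fun l => n - r l := fun i j hij => by
    have := hn i
    have := hn j
    exact hr (by dsimp only at hij; omega)
  have h0 : 0 ∉ A.image fun l => n - r l := by
    simp only [Finset.mem_image, not_exists, not_and]
    intro l _
    have := hn l
    omega
  rw [← sum_id_range, ← h, Finset.sum_insert h0, zero_add, Finset.sum_image hinj.injOn]

/-- The maximal minors of the node matrix with one more column than rows generate an ideal that
contains all the corners. -/
theorem cornerIdeal_le_maximalMinorsIdeal_succ {k : Type*} [Field k] [CharZero k] [Algebra k S]
    {x y : S} (hx : x ∈ Ideal.jacobson (⊥ : Ideal S)) (hy : y ∈ Ideal.jacobson (⊥ : Ideal S))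
    (m : ℕ) :
    cornerIdeal x y m ≤ maximalMinorsIdeal (nodeMatrix x y m (m + 1)) := by
  classical
  refine cornerIdeal_le_of_corners_mem hx hy fun a b hab => ?_
  set I := maximalMinorsIdeal (nodeMatrix x y m (m + 1))
  set K := I ⊔ Ideal.span {x, y} * cornerIdeal x y m
  -- Deleting column `a + 1` isolates the corner `(a, b)`: columns `0, …, a` take `x` and columns `a
  -- + 2, …, m` take `y`.
  let o : Fin (m + 1) := ⟨a + 1, by omega⟩
  let r : Fin m → ℕ := fun l => (o.succAbove l : ℕ)
  have hr : Function.Injective r := Fin.val_injective.comp Fin.succAbove_right_injective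
  have hn : ∀ l, r l < m + 1 := fun l => (o.succAbove l).2
  have hro : ∀ l, r l ≠ a + 1 := fun l h => Fin.succAbove_ne o l (Fin.ext h)
  have hex : ∀ i, i < m + 1 → i ≠ a + 1 → ∃ l, r l = i := fun i hi hio => by
    obtain ⟨l, hl⟩ := Fin.exists_succAbove_eq (x := ⟨i, hi⟩) (y := o)
      (fun h => hio (congrArg Fin.val h))
    exact ⟨l, congrArg Fin.val hl⟩
  obtain ⟨l₀, h₀⟩ := hex 0 (by omega) (by omega)
  let A := Finset.univ.filter fun l => r l < a + 1
  have hA1 : A.image r = Finset.range (a + 1) := by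
    ext i
    simp only [Finset.mem_image, Finset.mem_range, A, Finset.mem_filter, Finset.mem_univ, true_and]
    constructor
    · rintro ⟨l, hl, rfl⟩
      exact hl
    · intro hi
      obtain ⟨l, rfl⟩ := hex i (by omega) (by omega)
      exact ⟨l, hi, rfl⟩
  have hA2 : insert 0 (Aᶜ.image fun l => m + 1 - r l) = Finset.range (b + 1) := by
    ext i
    simp only [Finset.mem_insert, Finset.mem_image, Finset.mem_range, A, Finset.mem_compl,
      Finset.mem_filter, Finset.mem_univ, true_and, not_lt]
    constructor
    · rintro (rfl | ⟨l, hl, rfl⟩)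
      · omega
      · have := hro l
        omega
    · intro hi
      rcases Nat.eq_zero_or_pos i with h | h
      · exact Or.inl h
      · obtain ⟨l, hl⟩ := hex (m + 1 - i) (by omega) (by omega)
        exact Or.inr ⟨l, by omega, by omega⟩
  have hmem := mem_of_multilinear_nodeColumn_mem (x := x) (y := y) (n := m + 1) (r := r)
    (f := (Matrix.detRowAlternating (R := S) (n := Fin m)).toMultilinearMap) (K := K) A ?_ ?_ ?_ ?_
  · rwa [sum_eq_choose_two hr hA1, sum_sub_eq_choose_two hr hn hA2] at hmem
  · intro l hl h
    exact hl (by simp [A, h])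
  · refine Ideal.mem_sup_left ?_
    have := minor_mem_maximalMinorsIdeal (s := m) (by simp) (nodeMatrix x y m (m + 1))
      (RelEmbedding.refl _) o.succAboveOrderEmb
    rw [← Matrix.det_transpose] at this
    exact this
  · intro B hBA hB
    refine Ideal.mul_mem_right _ _ (Ideal.mem_sup_right ?_)
    refine (mem_mul_cornerIdeal_or (Ideal.subset_span (by simp)) (Ideal.subset_span (by simp))
      hr hn h₀ hB).resolve_right ?_
    -- The gap at `a + 1` bounds the `x`-segment by `a + 1` columns and the `y`-segment by `b`. They
    -- have `m = a + 1 + b` columns in total, so both bounds are attained and `B = A`.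
    rintro ⟨hB1, hB2⟩
    have hcard := Finset.card_add_card_compl B
    rw [Fintype.card_fin] at hcard
    have h1 : a + 1 ∉ B.image r := by
      simp only [Finset.mem_image, not_exists, not_and]
      exact fun l _ => hro l
    have h2 : m - a ∉ insert 0 (Bᶜ.image fun l => m + 1 - r l) := by
      simp only [Finset.mem_insert, Finset.mem_image, not_or, not_exists, not_and]
      refine ⟨by omega, fun l _ h => hro l ?_⟩
      have := hn l
      omega
    rw [hB1, Finset.mem_range] at h1
    rw [hB2, Finset.mem_range] at h2
    refine hBA ?_
    ext l
    have : l ∈ B ↔ r l ∈ B.image r := by simp [hr.eq_iff]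
    rw [this, hB1, Finset.mem_range, show B.card = a + 1 by omega]
    simp [A]
  · exact isUnit_det_powerVec (k := k) (chosenVec_node_injective hr hn A)

/-- The maximal minors of the node matrix with one more row than columns generate an ideal that
contains all the corners. -/
theorem cornerIdeal_le_maximalMinorsIdeal_pred {k : Type*} [Field k] [CharZero k] [Algebra k S]
    {x y : S} (hx : x ∈ Ideal.jacobson (⊥ : Ideal S)) (hy : y ∈ Ideal.jacobson (⊥ : Ideal S))
    (s : ℕ) :
    cornerIdeal x y s ≤ maximalMinorsIdeal (nodeMatrix x y (s + 1) s) := by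
  classical
  refine cornerIdeal_le_of_corners_mem hx hy fun a => ?_
  set I := maximalMinorsIdeal (nodeMatrix x y (s + 1) s)
  set K := I ⊔ Ideal.span {x, y} * cornerIdeal x y s
  -- With no column to delete, every cut into an `x`-segment and a `y`-segment gives an exact
  -- corner; the corners are extracted one after another in order of `a`.
  induction a using Nat.strong_induction_on with
  | _ a ih =>
  intro b hab
  let r : Fin s → ℕ := fun l => (l : ℕ)
  have hr : Function.Injective r := Fin.val_injective
  have hn : ∀ l, r l < s := fun l => l.2
  let A := Finset.univ.filter fun l => r l < a + 1
  have hA1 : A.image r = Finset.range (a + 1) := by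
    ext i
    simp only [Finset.mem_image, Finset.mem_range, A, Finset.mem_filter, Finset.mem_univ, true_and]
    constructor
    · rintro ⟨l, hl, rfl⟩
      exact hl
    · intro hi
      exact ⟨⟨i, by omega⟩, hi, rfl⟩
  have hA2 : insert 0 (Aᶜ.image fun l => s - r l) = Finset.range (b + 1) := by
    ext i
    simp only [Finset.mem_insert, Finset.mem_image, Finset.mem_range, A, Finset.mem_compl,
      Finset.mem_filter, Finset.mem_univ, true_and, not_lt]
    constructor
    · rintro (rfl | ⟨l, hl, rfl⟩)
      · omega
      · omega
    · intro hi
      rcases Nat.eq_zero_or_pos i with h | h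
      · exact Or.inl h
      · exact Or.inr ⟨⟨s - i, by omega⟩, by simp only [r]; omega, by simp only [r]; omega⟩
  -- Bordering by a vector turns the determinant into a combination of maximal minors. Weight `a +
  -- 1` is chosen to kill, by a repeated row, the cuts with a longer `x`-segment; shorter ones are
  -- covered by induction.
  let w : Fin (s + 1) → S := powerVec S (s + 1) (a + 1 : ℕ)
  let f : MultilinearMap S (fun _ : Fin s => Fin (s + 1) → S) S :=
    ((Matrix.detRowAlternating (R := S) (n := Fin (s + 1))).curryLeft w).toMultilinearMap
  have hf : ∀ v, f v = (Matrix.of (Fin.cons w v : Fin (s + 1) → Fin (s + 1) → S)).det :=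
    fun v => rfl
  have hmem := mem_of_multilinear_nodeColumn_mem (x := x) (y := y) (n := s) (r := r)
    (f := f) (K := K) A ?_ ?_ ?_ ?_
  · rwa [sum_eq_choose_two hr hA1, sum_sub_eq_choose_two hr hn hA2] at hmem
  · intro l hl h
    exact hl (by simp [A, h])
  · refine Ideal.mem_sup_left ?_
    rw [hf, Matrix.det_succ_row_zero]
    refine Ideal.sum_mem _ fun j _ => Ideal.mul_mem_left _ _ ?_
    have := minor_mem_maximalMinorsIdeal (s := s) (by simp) (nodeMatrix x y (s + 1) s)
      j.succAboveOrderEmb (RelEmbedding.refl _)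
    rw [← Matrix.det_transpose] at this
    exact this
  · intro B hBA hB
    rcases mem_mul_cornerIdeal_or (𝔪 := Ideal.span {x, y}) (x := x) (y := y)
      (Ideal.subset_span (by simp)) (Ideal.subset_span (by simp)) hr hn
      (l₀ := ⟨0, by omega⟩) rfl hB with h | ⟨hB1, hB2⟩
    · exact Ideal.mul_mem_right _ _ (Ideal.mem_sup_right h)
    have hcard := Finset.card_add_card_compl B
    rw [Fintype.card_fin] at hcard
    have hmemB : ∀ l, l ∈ B ↔ r l < B.card := fun l => by
      rw [← Finset.mem_range, ← hB1]
      simp [hr.eq_iff]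
    have hpos : 0 < B.card := by
      by_contra! h0
      refine hB ⟨0, by omega⟩ ?_ rfl
      rw [hmemB]
      omega
    rcases lt_trichotomy B.card (a + 1) with hlt | heq | hgt
    · refine Ideal.mul_mem_right _ _ ?_
      rw [sum_eq_choose_two hr hB1, sum_sub_eq_choose_two hr hn hB2]
      have := ih (B.card - 1) (by omega) Bᶜ.card (by omega)
      rwa [Nat.sub_add_cancel hpos] at this
    · refine absurd ?_ hBA
      ext l
      rw [hmemB, heq]
      simp [A]
    · have hlt : a + 1 < s := by omega
      have : f (chosenVec r (s + 1) s B) = 0 := by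
        rw [hf]
        refine Matrix.det_zero_of_row_eq (i := 0) (j := Fin.succ ⟨a + 1, hlt⟩)
          (Fin.succ_ne_zero _).symm ?_
        change w = chosenVec r (s + 1) s B ⟨a + 1, hlt⟩
        rw [chosenVec, if_pos ((hmemB _).2 hgt)]
      rw [this, mul_zero]
      exact Ideal.zero_mem _
  · rw [hf]
    have hinj : Function.Injective (Fin.cons ((a + 1 : ℕ) : ℤ)
        (fun l => if l ∈ A then (r l : ℤ) else r l - s) : Fin (s + 1) → ℤ) := by
      rw [Fin.cons_injective_iff]
      refine ⟨?_, chosenVec_node_injective hr hn A⟩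
      rintro ⟨l, hl⟩
      have := hn l
      dsimp only at hl
      split_ifs at hl with h
      · simp only [A, Finset.mem_filter, Finset.mem_univ, true_and] at h
        omega
      · omega
    have := isUnit_det_powerVec (S := S) (k := k) hinj
    convert this using 3
    funext l
    refine Fin.cases ?_ (fun l => ?_) l
    · rfl
    · rfl

/-- The determinant of the square node matrix modulo `xy`. -/
theorem det_nodeMatrix_eq {k : Type*} [Field k] [CharZero k] [Algebra k S] (x y : S) {m : ℕ}
    (hm : 2 ≤ m) :
    ∃ α β h : S, IsUnit α ∧ IsUnit β ∧
      (nodeMatrix x y m m).det = α * x ^ m.choose 2 + β * y ^ m.choose 2 + x * y * h := by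
  classical
  let r : Fin m → ℕ := fun l => (l : ℕ)
  have hr : Function.Injective r := Fin.val_injective
  have hn : ∀ l, r l < m := fun l => l.2
  let f := (Matrix.detRowAlternating (R := S) (n := Fin m)).toMultilinearMap
  let l₀ : Fin m := ⟨0, by omega⟩
  have hdet : (nodeMatrix x y m m).det = f (fun l => nodeColumn x y m m (r l)) := by
    rw [← Matrix.det_transpose]
    rfl
  have hu : ∀ A, IsUnit (f (chosenVec r m m A)) := fun A =>
    isUnit_det_powerVec (k := k) (chosenVec_node_injective hr hn A)
  have hne : ({l₀} : Finset (Fin m)) ≠ Finset.univ := by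
    intro h
    have : (⟨1, by omega⟩ : Fin m) ∈ ({l₀} : Finset (Fin m)) := h ▸ Finset.mem_univ _
    simp [l₀] at this
  -- A selection involves no `y` only when it is everything, and no `x` only when it is the forced
  -- column `0`; every other term is divisible by `xy`.
  have hrest : ∀ A ∈ (Finset.univ.erase Finset.univ).erase ({l₀} : Finset (Fin m)),
      x * y ∣ (if ∀ l ∉ A, r l ≠ 0 then
        x ^ (∑ l ∈ A, r l) * y ^ (∑ l ∈ Aᶜ, (m - r l)) * f (chosenVec r m m A) else 0) := by
    intro A hA
    simp only [Finset.mem_erase, Finset.mem_univ, and_true] at hA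
    split_ifs with h
    · have h0 : l₀ ∈ A := by
        by_contra h'
        exact h l₀ h' rfl
      refine Dvd.dvd.mul_right (mul_dvd_mul (dvd_pow_self x ?_) (dvd_pow_self y ?_)) _
      · intro hs
        rw [Finset.sum_eq_zero_iff] at hs
        refine hA.1 (Finset.eq_singleton_iff_unique_mem.2 ⟨h0, fun l hl => ?_⟩)
        exact Fin.ext (hs l hl)
      · intro hs
        rw [Finset.sum_eq_zero_iff] at hs
        refine hA.2 (Finset.eq_univ_iff_forall.2 fun l => ?_)
        by_contra hl
        have := hs l (Finset.mem_compl.2 hl)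
        have := hn l
        omega
    · exact dvd_zero _
  obtain ⟨h, hh⟩ := Finset.dvd_sum hrest
  refine ⟨f (chosenVec r m m Finset.univ), f (chosenVec r m m {l₀}), h, hu _, hu _, ?_⟩
  have hP : ∑ l : Fin m, r l = m.choose 2 := by
    rw [← sum_id_range, Finset.sum_range]
  have hQ : ∑ l ∈ ({l₀} : Finset (Fin m))ᶜ, (m - r l) = m.choose 2 := by
    refine sum_sub_eq_choose_two hr hn ?_
    ext i
    simp only [Finset.mem_insert, Finset.mem_image, Finset.mem_range, Finset.mem_compl,
      Finset.mem_singleton]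
    constructor
    · rintro (rfl | ⟨l, hl, rfl⟩)
      · omega
      · have : r l ≠ 0 := fun h => hl (Fin.ext h)
        omega
    · intro hi
      rcases Nat.eq_zero_or_pos i with h | h
      · exact Or.inl h
      · refine Or.inr ⟨⟨m - i, by omega⟩, fun h => ?_, by simp only [r]; omega⟩
        have := congrArg Fin.val h
        simp only [l₀] at this
        omega
  rw [hdet, multilinear_nodeColumn, ← Finset.add_sum_erase _ _ (Finset.mem_univ Finset.univ),
    ← Finset.add_sum_erase _ _ (Finset.mem_erase.2 ⟨hne, Finset.mem_univ _⟩), hh]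
  rw [if_pos (by simp), if_pos, hP, hQ]
  · simp only [Finset.compl_univ, Finset.sum_empty, Finset.sum_singleton, pow_zero, mul_one,
      show r l₀ = 0 from rfl, one_mul]
    ring
  · intro l hl h
    exact hl (Finset.mem_singleton.2 (Fin.ext h))

end NodeMatrix

namespace SmoothingChart

variable {k S : Type*} [Field k] [CharZero k] [CommRing S] [Algebra k S] [Algebra (PowerSeries k) S]
  [IsScalarTower k (PowerSeries k) S] (c : SmoothingChart k S)

/-- There is a basis of the dual of the principal parts and a list whose degeneracy ideal is
generated by the maximal minors of the node matrix. -/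
theorem exists_degeneracyIdeal_eq (m n : ℕ) :
    ∃ (e : Module.Basis (Fin m) S (Module.Dual S (PrincipalParts (PowerSeries k) S m)))
      (τ : Fin n → PrincipalParts (PowerSeries k) S m),
      degeneracyIdeal e τ = maximalMinorsIdeal (nodeMatrix c.x c.y m n) := by
  obtain ⟨e, he⟩ := c.exists_dual_basis (m := m)
  refine ⟨e, fun l => jet (PowerSeries k) m (c.z (l : ℕ)) +
    if (l : ℕ) = 0 then 0 else jet (PowerSeries k) m (c.z (-((n - l : ℕ) : ℤ))), ?_⟩
  rw [degeneracyIdeal]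
  congr 1
  ext j l
  simp only [Matrix.of_apply, nodeMatrix, nodeColumn, map_add, Pi.add_apply, Pi.smul_apply,
    smul_eq_mul, powerVec, he]
  rw [z_natCast]
  split_ifs with h
  · simp [mul_comm]
  · rw [he, z_neg_natCast, Nat.cast_sub l.2.le]
    simp [powerVec, mul_comm]

end SmoothingChart

/-! ### Lists of length `m` -/

theorem maximalMinorsIdeal_square {S : Type*} [CommRing S] {m : ℕ} (M : Matrix (Fin m) (Fin m) S) :
    maximalMinorsIdeal M = Ideal.span {M.det} := by
  have hrefl : ∀ p : Fin m ↪o Fin m, (p : Fin m → Fin m) = id := fun p =>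
    (p.strictMono.range_inj strictMono_id).1 (by
      rw [(Finite.surjective_of_injective p.injective).range_eq, Set.range_id])
  have key : ∀ s, s = m → ∀ (p : Fin s ↪o Fin m) (q : Fin s ↪o Fin m),
      (M.submatrix p q).det = M.det := by
    rintro s rfl p q
    rw [hrefl p, hrefl q, Matrix.submatrix_id_id]
  refine le_antisymm (Ideal.span_le.2 ?_) ?_
  · rintro _ ⟨p, q, rfl⟩
    rw [key _ (min_self m)]
    exact Ideal.subset_span rfl
  · rw [Ideal.span_singleton_le_iff_mem]
    exact minor_mem_maximalMinorsIdeal (min_self m) M (RelEmbedding.refl _) (RelEmbedding.refl _)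

/-- The exponents of the monomials `x ^ i` and `y ^ i` with `i ≤ N`. -/
def axes (N : ℕ) : Finset (ℕ × ℕ) :=
  (Finset.range (N + 1)).image (fun i => (i, 0)) ∪ (Finset.range N).image fun i => (0, i + 1)

theorem mem_axes {N : ℕ} (d : ℕ × ℕ) :
    d ∈ axes N ↔ ∀ e ∈ ({(1, 1), (N + 1, 0), (0, N + 1)} : Set (ℕ × ℕ)), ¬ e ≤ d := by
  obtain ⟨i, j⟩ := d
  simp only [axes, Finset.mem_union, Finset.mem_image, Finset.mem_range, Prod.mk.injEq,
    Set.mem_insert_iff, Set.mem_singleton_iff, forall_eq_or_imp, forall_eq, Prod.mk_le_mk]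
  constructor
  · rintro (⟨i', h, rfl, rfl⟩ | ⟨j', h, rfl, rfl⟩) <;> omega
  · rintro ⟨h1, h2, h3⟩
    rcases Nat.eq_zero_or_pos j with rfl | hj
    · exact Or.inl ⟨i, by omega, rfl, rfl⟩
    · exact Or.inr ⟨j - 1, by omega, by omega, by omega⟩

theorem card_axes (N : ℕ) : (axes N).card = 2 * N + 1 := by
  rw [axes, Finset.card_union_of_disjoint, Finset.card_image_of_injective,
    Finset.card_image_of_injective, Finset.card_range, Finset.card_range]
  · omega
  · intro i j h
    simpa using h
  · intro i j h
    simpa using h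
  · rw [Finset.disjoint_left]
    simp only [Finset.mem_image, not_exists, not_and]
    rintro _ ⟨i, _, rfl⟩ j _ h
    simp at h

/-- Inner corners are divisible by `xy`, and the two outer ones are the pure powers with exponent
`m.choose 2`. So `g` spans at most a line modulo this monomial ideal. -/
theorem mul_mem_of_mem_cornerIdeal {S : Type*} [CommRing S] {x y g : S} {m : ℕ}
    (hg : g ∈ cornerIdeal x y m) :
    x * g ∈ monomialIdeal x y {(1, 1), (m.choose 2 + 1, 0), (0, m.choose 2 + 1)} ∧
      y * g ∈ monomialIdeal x y {(1, 1), (m.choose 2 + 1, 0), (0, m.choose 2 + 1)} := by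
  set D : Set (ℕ × ℕ) := {(1, 1), (m.choose 2 + 1, 0), (0, m.choose 2 + 1)}
  have h : ∀ {i j : ℕ} {d : ℕ × ℕ}, d ∈ D → d ≤ (i, j) → x ^ i * y ^ j ∈ monomialIdeal x y D :=
    fun hd hle => Ideal.mem_of_dvd _
      (mul_dvd_mul (pow_dvd_pow x hle.1) (pow_dvd_pow y hle.2)) (monomial_mem_monomialIdeal hd)
  induction hg using Submodule.span_induction with
  | mem g hg =>
    obtain ⟨a, b, hab, rfl⟩ := hg
    have hpos : ∀ i, 0 < i → 1 ≤ (i + 1).choose 2 := fun i hi => Nat.choose_pos (by omega)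
    rw [← mul_assoc, ← pow_succ', mul_left_comm, ← pow_succ']
    constructor
    · rcases Nat.eq_zero_or_pos b with rfl | hb
      · refine h (d := (m.choose 2 + 1, 0)) (by simp [D]) ⟨?_, by simp⟩
        rw [← hab, add_zero]
      · exact h (d := (1, 1)) (by simp [D]) ⟨by simp, hpos b hb⟩
    · rcases Nat.eq_zero_or_pos a with rfl | ha
      · refine h (d := (0, m.choose 2 + 1)) (by simp [D]) ⟨by simp, ?_⟩
        rw [← hab, zero_add]
      · exact h (d := (1, 1)) (by simp [D]) ⟨hpos a ha, by simp⟩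
  | zero => simp
  | add f g _ _ hf hg =>
    rw [mul_add, mul_add]
    exact ⟨add_mem hf.1 hg.1, add_mem hf.2 hg.2⟩
  | smul a f _ hf =>
    rw [smul_eq_mul, mul_left_comm x, mul_left_comm y]
    exact ⟨Ideal.mul_mem_left _ _ hf.1, Ideal.mul_mem_left _ _ hf.2⟩

theorem two_mul_choose_two (m : ℕ) : 2 * m.choose 2 = m * (m - 1) := by
  rw [Nat.choose_two_right, Nat.mul_div_cancel' (Nat.even_mul_pred_self m).two_dvd]

/-! ### Length of the degeneracy locus on the special fibre -/

namespace SmoothingChart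

universe u

variable {k S : Type u} [Field k] [CommRing S] [Algebra k S] [Algebra (PowerSeries k) S]
  (c : SmoothingChart k S)

theorem le_rank_quotient_of_mem_cornerIdeal {m : ℕ} {g : S}
    (hg : g ∈ cornerIdeal c.x c.y m) :
    ((m * (m - 1) : ℕ) : ℕ∞) ≤
      Cardinal.toENat (Module.rank k (S ⧸ (Ideal.span {c.x * c.y} ⊔ Ideal.span {g}))) := by
  obtain ⟨hxg, hyg⟩ := mul_mem_of_mem_cornerIdeal hg
  set D : Set (ℕ × ℕ) := {(1, 1), (m.choose 2 + 1, 0), (0, m.choose 2 + 1)} with hD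
  have hzero : ∀ s ∈ monomialIdeal c.x c.y D, c.coeffs (axes (m.choose 2)) s = 0 := fun s hs =>
    c.coeffs_eq_zero_of_mem (fun d hd => (mem_axes d).1 hd) hs
  have hxy : c.x * c.y ∈ monomialIdeal c.x c.y D := by
    simpa using monomial_mem_monomialIdeal (x := c.x) (y := c.y) (D := D) (d := (1, 1))
      (by simp [D])
  refine le_trans ?_ (c.le_toENat_rank_quotient (axes (m.choose 2))
    (Submodule.span k {c.coeffs (axes (m.choose 2)) g}) fun s hs => ?_)
  · have := (finrank_span_le_card (R := k) {c.coeffs (axes (m.choose 2)) g}).trans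
      (by simp : _ ≤ 1)
    rw [card_axes, ← two_mul_choose_two]
    exact_mod_cast by omega
  · obtain ⟨s₁, hs₁, s₂, hs₂, rfl⟩ := Submodule.mem_sup.1 hs
    obtain ⟨p, rfl⟩ := Ideal.mem_span_singleton'.1 hs₁
    obtain ⟨q, rfl⟩ := Ideal.mem_span_singleton'.1 hs₂
    obtain ⟨a, q', r, rfl⟩ := c.exists_eq_add q
    have : p * (c.x * c.y) + (algebraMap k S a + c.x * q' + c.y * r) * g =
        (p * (c.x * c.y) + q' * (c.x * g) + r * (c.y * g)) + a • g := by
      rw [Algebra.smul_def]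
      ring
    rw [this, map_add, map_smul, hzero (_ + _), zero_add]
    · exact Submodule.smul_mem _ _ (Submodule.mem_span_singleton_self _)
    · exact add_mem (add_mem (Ideal.mul_mem_left _ _ hxy) (Ideal.mul_mem_left _ _ hxg))
        (Ideal.mul_mem_left _ _ hyg)

/-- Multiplying `g` by `x` or `y` produces `x ^ (N+1)` and `y ^ (N+1)` modulo `xy`. The quotient is
thus spanned by `2N + 1` monomials subject to the further relation `g`. -/
theorem rank_quotient_le_of_eq {N : ℕ} (hN : 1 ≤ N) {g α β h : S} (hα : IsUnit α) (hβ : IsUnit β)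
    (hg : g = α * c.x ^ N + β * c.y ^ N + c.x * c.y * h) :
    Cardinal.toENat (Module.rank k (S ⧸ (Ideal.span {c.x * c.y} ⊔ Ideal.span {g}))) ≤
      ((2 * N : ℕ) : ℕ∞) := by
  have := c.isDomain
  set D : Set (ℕ × ℕ) := {(1, 1), (N + 1, 0), (0, N + 1)} with hD
  set I := Ideal.span {c.x * c.y} ⊔ Ideal.span {g}
  have hxyI : c.x * c.y ∈ I := Ideal.mem_sup_left (Ideal.mem_span_singleton_self _)
  have hgI : g ∈ I := Ideal.mem_sup_right (Ideal.mem_span_singleton_self _)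
  obtain ⟨M, rfl⟩ := Nat.exists_eq_add_of_le' hN
  have hDI : monomialIdeal c.x c.y D ≤ I := by
    refine monomialIdeal_le ?_
    simp only [hD, Set.mem_insert_iff, Set.mem_singleton_iff, forall_eq_or_imp, forall_eq, pow_zero,
      mul_one, one_mul, pow_one]
    refine ⟨hxyI, (Ideal.unit_mul_mem_iff_mem I hα).1 ?_, (Ideal.unit_mul_mem_iff_mem I hβ).1 ?_⟩
    · have : α * c.x ^ (M + 1 + 1) = c.x * g - (β * c.y ^ M + c.x * h) * (c.x * c.y) := by
        rw [hg]; ring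
      rw [this]
      exact sub_mem (Ideal.mul_mem_left _ _ hgI) (Ideal.mul_mem_left _ _ hxyI)
    · have : β * c.y ^ (M + 1 + 1) = c.y * g - (α * c.x ^ M + c.y * h) * (c.x * c.y) := by
        rw [hg]; ring
      rw [this]
      exact sub_mem (Ideal.mul_mem_left _ _ hgI) (Ideal.mul_mem_left _ _ hxyI)
  have hmem : ∀ s, c.coeffs (axes (M + 1)) s = 0 → s ∈ monomialIdeal c.x c.y D := fun s hs =>
    c.mem_of_coeffs_eq_zero (Set.toFinite _) (fun d hd => (mem_axes d).2 hd) hs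
  -- The relation is nontrivial: otherwise reduction modulo `y` would put `x ^ (M+1)` in the ideal
  -- generated by `x ^ (M+2)`.
  have hne : c.coeffs (axes (M + 1)) g ≠ 0 := by
    intro h0
    have hle : monomialIdeal c.x c.y D ≤ Ideal.span {c.x ^ (M + 2), c.y} := by
      refine monomialIdeal_le ?_
      simp only [hD, Set.mem_insert_iff, Set.mem_singleton_iff, forall_eq_or_imp, forall_eq,
        pow_zero, mul_one, one_mul, pow_one]
      refine ⟨Ideal.mem_span_pair.2 ⟨0, c.x, by ring⟩, Ideal.mem_span_pair.2 ⟨1, 0, by ring⟩,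
        Ideal.mem_span_pair.2 ⟨0, c.y ^ (M + 1), by ring⟩⟩
    have h1 : α * c.x ^ (M + 1) ∈ Ideal.span {c.x ^ (M + 2), c.y} := by
      have : α * c.x ^ (M + 1) = g - (β * c.y ^ M + c.x * h) * c.y := by
        rw [hg]; ring
      rw [this]
      exact sub_mem (hle (hmem g h0)) (Ideal.mul_mem_left _ _ (Ideal.subset_span (by simp)))
    rw [Ideal.unit_mul_mem_iff_mem _ hα, Ideal.mem_span_pair] at h1
    obtain ⟨u, v, huv⟩ := h1
    have hdvd : c.y ∣ c.x ^ (M + 1) * (c.x * -u + 1) := ⟨v, by linear_combination -huv⟩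
    rcases c.prime_y.dvd_or_dvd hdvd with h | h
    · exact c.not_y_dvd_x (c.prime_y.dvd_of_dvd_pow h)
    · exact c.prime_y.not_isUnit (isUnit_of_dvd_unit h (Ideal.mem_jacobson_bot.1 c.x_mem (-u)))
  refine (c.toENat_rank_quotient_le (axes (M + 1))
    (Submodule.span k {c.coeffs (axes (M + 1)) g}) fun s hs => ?_).trans ?_
  · obtain ⟨a, ha⟩ := Submodule.mem_span_singleton.1 hs
    have h0 : c.coeffs (axes (M + 1)) (s - a • g) = 0 := by
      rw [map_sub, map_smul, ha, sub_self]
    have := add_mem (hDI (hmem _ h0)) (Submodule.smul_of_tower_mem I a hgI)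
    rwa [sub_add_cancel] at this
  · rw [finrank_span_singleton hne, card_axes, Nat.add_sub_cancel]

end SmoothingChart

/-! ### The generic fibre -/

/-- A module over `k⟦t⟧` that is separated and torsion-free has a basis lifting a given basis of its
reduction. -/
theorem nonempty_basis_of_reduction {k Q : Type*} [Field k] [AddCommGroup Q] [Module k Q]
    [Module (PowerSeries k) Q] [IsScalarTower k (PowerSeries k) Q] {r : ℕ} (b : Fin r → Q)
    (hsep : ∀ q : Q, (∀ n : ℕ, ∃ q' : Q, q = (PowerSeries.X : PowerSeries k) ^ n • q') → q = 0)
    (hreg : ∀ q : Q, (PowerSeries.X : PowerSeries k) • q = 0 → q = 0)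
    (hspan : ∀ q : Q, ∃ (a : Fin r → k) (q' : Q),
      q = ∑ i, a i • b i + (PowerSeries.X : PowerSeries k) • q')
    (hind : ∀ (a : Fin r → k) (q : Q), ∑ i, a i • b i = (PowerSeries.X : PowerSeries k) • q →
      a = 0) :
    Nonempty (Module.Basis (Fin r) (PowerSeries k) Q) := by
  have hC : ∀ (a : k) (q : Q), (PowerSeries.C a : PowerSeries k) • q = a • q := fun a q => by
    rw [PowerSeries.C_eq_algebraMap, algebraMap_smul]
  have hshift : ∀ a : Fin r → PowerSeries k, ∑ i, a i • b i =
      ∑ i, PowerSeries.constantCoeff (a i) • b i + (PowerSeries.X : PowerSeries k) •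
        ∑ i, (PowerSeries.mk fun n => PowerSeries.coeff (n + 1) (a i)) • b i := by
    intro a
    rw [Finset.smul_sum, ← Finset.sum_add_distrib]
    refine Finset.sum_congr rfl fun i _ => ?_
    conv_lhs => rw [PowerSeries.eq_X_mul_shift_add_const (a i), add_smul, hC, mul_smul, add_comm]
  have hli : LinearIndependent (PowerSeries k) b := by
    rw [Fintype.linearIndependent_iff]
    suffices H : ∀ (n : ℕ) (a : Fin r → PowerSeries k), ∑ i, a i • b i = 0 →
        ∀ i, PowerSeries.coeff n (a i) = 0 by
      intro a ha i
      ext n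
      rw [H n a ha i, map_zero]
    intro n
    induction n with
    | zero =>
      intro a ha i
      rw [hshift, add_eq_zero_iff_eq_neg, ← smul_neg] at ha
      have := congrFun (hind _ _ ha) i
      simpa using this
    | succ n ih =>
      intro a ha i
      have h0 := ha
      rw [hshift, add_eq_zero_iff_eq_neg, ← smul_neg] at h0
      have h0 := hind _ _ h0
      rw [hshift] at ha
      have hz : ∑ i, PowerSeries.constantCoeff (a i) • b i = 0 :=
        Finset.sum_eq_zero fun i _ => by
          have := congrFun h0 i
          simp only [Pi.zero_apply] at this
          rw [this, zero_smul]
      rw [hz, zero_add] at ha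
      simpa using ih _ (hreg _ ha) i
  refine ⟨Module.Basis.mk hli ?_⟩
  rintro q -
  -- Iterating the division by `t` produces the `t`-adic digits of the coordinates of `q`; they
  -- assemble into power series, and separatedness removes the remainder.
  choose a next hnext using hspan
  let seq : ℕ → Q := fun n => next^[n] q
  have hseq : ∀ n, seq n = ∑ i, a (seq n) i • b i + (PowerSeries.X : PowerSeries k) • seq (n + 1) :=
    fun n => by
      conv_lhs => rw [hnext (seq n)]
      rw [show seq (n + 1) = next (seq n) from Function.iterate_succ_apply' next n q]
  let coef : ℕ → Fin r → PowerSeries k := fun n i => PowerSeries.mk fun j => a (seq (n + j)) i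
  have hdiff : ∀ n, seq n - ∑ i, coef n i • b i =
      (PowerSeries.X : PowerSeries k) • (seq (n + 1) - ∑ i, coef (n + 1) i • b i) := by
    intro n
    have h1 : (fun i => PowerSeries.mk fun j => PowerSeries.coeff (j + 1) (coef n i)) =
        coef (n + 1) := by
      funext i
      ext j
      simp only [coef, PowerSeries.coeff_mk]
      rw [show n + (j + 1) = n + 1 + j by ring]
    have h2 : ∀ i, PowerSeries.constantCoeff (coef n i) = a (seq n) i := fun i => by
      simp [coef, ← PowerSeries.coeff_zero_eq_constantCoeff_apply]
    conv_lhs => rw [hseq n, hshift]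
    simp only [h2, funext_iff] at h1 ⊢
    simp only [h1, smul_sub]
    abel
  have hzero : seq 0 - ∑ i, coef 0 i • b i = 0 := by
    refine hsep _ fun n => ⟨seq n - ∑ i, coef n i • b i, ?_⟩
    induction n with
    | zero => simp
    | succ n ih =>
      rw [ih]
      conv_lhs => rw [hdiff n, smul_smul, ← pow_succ]
  rw [show q = seq 0 from rfl, sub_eq_zero.1 hzero]
  exact Submodule.sum_mem _ fun i _ => Submodule.smul_mem _ _ (Submodule.subset_span ⟨i, rfl⟩)

/-! ### Finite freeness over the base of a locus defined by one equation -/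

namespace SmoothingChart

universe u

variable {k S : Type u} [Field k] [CommRing S] [Algebra k S] [Algebra (PowerSeries k) S]
  (c : SmoothingChart k S)

theorem toENat_rank_quotient_eq_top_of_le {D : Set (ℕ × ℕ)} {I : Ideal S}
    (hI : I ≤ monomialIdeal c.x c.y D)
    (hD : ∀ n : ℕ, ∃ E : Finset (ℕ × ℕ), E.card = n ∧ ∀ d ∈ E, ∀ e ∈ D, ¬ e ≤ d) :
    Cardinal.toENat (Module.rank k (S ⧸ I)) = ⊤ := by
  rw [ENat.eq_top_iff_forall_ge]
  intro n
  obtain ⟨E, hE, h⟩ := hD n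
  have := c.le_toENat_rank_quotient E ⊥ (I := I) fun s hs =>
    (Submodule.mem_bot k).2 (c.coeffs_eq_zero_of_mem h (hI hs))
  simpa [hE] using this

/-- Otherwise the locus contains the branch `x = 0` of the special fibre, where all powers of `y`
are independent. -/
theorem not_x_dvd_of_rank_ne_top {g : S} (h : Cardinal.toENat
    (Module.rank k (S ⧸ (Ideal.span {c.x * c.y} ⊔ Ideal.span {g}))) ≠ ⊤) : ¬ c.x ∣ g := by
  intro hg
  refine h (c.toENat_rank_quotient_eq_top_of_le (D := {(1, 0)}) ?_ fun n =>
    ⟨(Finset.range n).image fun j => (0, j), ?_, ?_⟩)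
  · have hx : c.x ∈ monomialIdeal c.x c.y {(1, 0)} := by
      simpa using monomial_mem_monomialIdeal (x := c.x) (y := c.y)
        (Set.mem_singleton ((1, 0) : ℕ × ℕ))
    refine sup_le ?_ ?_ <;> rw [Ideal.span_singleton_le_iff_mem]
    · exact Ideal.mul_mem_right _ _ hx
    · exact Ideal.mem_of_dvd _ hg hx
  · rw [Finset.card_image_of_injective _ (fun i j hij => by simpa using hij), Finset.card_range]
  · simp [Prod.le_def]

theorem not_y_dvd_of_rank_ne_top {g : S} (h : Cardinal.toENat
    (Module.rank k (S ⧸ (Ideal.span {c.x * c.y} ⊔ Ideal.span {g}))) ≠ ⊤) : ¬ c.y ∣ g := by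
  intro hg
  refine h (c.toENat_rank_quotient_eq_top_of_le (D := {(0, 1)}) ?_ fun n =>
    ⟨(Finset.range n).image fun j => (j, 0), ?_, ?_⟩)
  · have hy : c.y ∈ monomialIdeal c.x c.y {(0, 1)} := by
      simpa using monomial_mem_monomialIdeal (x := c.x) (y := c.y)
        (Set.mem_singleton ((0, 1) : ℕ × ℕ))
    refine sup_le ?_ ?_ <;> rw [Ideal.span_singleton_le_iff_mem]
    · exact Ideal.mul_mem_left _ _ hy
    · exact Ideal.mem_of_dvd _ hg hy
  · rw [Finset.card_image_of_injective _ (fun i j hij => by simpa using hij), Finset.card_range]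
  · simp [Prod.le_def]

/-- The primes `x` and `y` must divide the cofactor, so they cancel. Consequently `t` is a
nonzerodivisor modulo `g`. -/
theorem dvd_of_dvd_algebraMap_X_mul {g s : S} (hx : ¬ c.x ∣ g) (hy : ¬ c.y ∣ g)
    (h : g ∣ c.x * c.y * s) : g ∣ s := by
  have := c.isDomain
  obtain ⟨u, hu⟩ := h
  obtain ⟨v, rfl⟩ := (c.prime_x.dvd_or_dvd
    (⟨c.y * s, by rw [← hu, mul_assoc]⟩ : c.x ∣ g * u)).resolve_left hx
  have huv : c.y * s = g * v := mul_left_cancel₀ c.prime_x.ne_zero (by linear_combination hu)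
  obtain ⟨w, rfl⟩ := (c.prime_y.dvd_or_dvd (⟨s, huv.symm⟩ : c.y ∣ g * v)).resolve_left hy
  exact ⟨w, mul_left_cancel₀ c.prime_y.ne_zero (by linear_combination huv)⟩

/-- A function whose zero locus meets the special fibre in a scheme of finite length `r` defines a
subscheme that is finite free of rank `r` over the base. -/
theorem nonempty_basis_quotient [IsScalarTower k (PowerSeries k) S] {g : S} {r : ℕ}
    (h : Cardinal.toENat
      (Module.rank k (S ⧸ (Ideal.span {c.x * c.y} ⊔ Ideal.span {g}))) = (r : ℕ∞)) :
    Nonempty (Module.Basis (Fin r) (PowerSeries k) (S ⧸ Ideal.span {g})) := by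
  have hne : Cardinal.toENat
      (Module.rank k (S ⧸ (Ideal.span {c.x * c.y} ⊔ Ideal.span {g}))) ≠ ⊤ := by
    rw [h]
    exact ENat.natCast_ne_top r
  have hX : ∀ s : S, (PowerSeries.X : PowerSeries k) • (Ideal.Quotient.mk (Ideal.span {g}) s) =
      Ideal.Quotient.mk _ (c.x * c.y * s) := fun s => by
    rw [← c.algebraMap_X_eq, ← Algebra.smul_def]
    rfl
  set J := Ideal.span {c.x * c.y} ⊔ Ideal.span {g} with hJ
  have hrank : Module.rank k (S ⧸ J) = r := by
    simpa using h
  have hfin : Module.Finite k (S ⧸ J) := Module.rank_lt_aleph0_iff.1 (by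
    rw [hrank]; exact Cardinal.natCast_lt_aleph0)
  let B : Module.Basis (Fin r) k (S ⧸ J) := Module.finBasisOfFinrankEq k (S ⧸ J)
    (Module.finrank_eq_of_rank_eq hrank)
  choose s hs using fun i => Ideal.Quotient.mk_surjective (B i)
  have hmk : ∀ (a : Fin r → k) (u : S), Ideal.Quotient.mk J (u - ∑ i, a i • s i) =
      Ideal.Quotient.mk J u - ∑ i, a i • B i := fun a u => by
    rw [map_sub, map_sum]
    congr 1
    refine Finset.sum_congr rfl fun i _ => ?_
    rw [← hs]
    rfl
  have hmk' : ∀ a : Fin r → k, Ideal.Quotient.mk (Ideal.span {g}) (∑ i, a i • s i) =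
      ∑ i, a i • Ideal.Quotient.mk (Ideal.span {g}) (s i) := fun a => by
    rw [map_sum]
    rfl
  refine nonempty_basis_of_reduction (fun i => Ideal.Quotient.mk _ (s i)) ?_ ?_ ?_ ?_
  · intro q hq
    have := c.isNoetherianRing
    -- Krull's intersection theorem; since `t` lies in the Jacobson radical, this yields `t`-adic
    -- separatedness.
    have hH : IsHausdorff (Ideal.jacobson (⊥ : Ideal S)) (S ⧸ Ideal.span {g}) :=
      IsHausdorff.of_le_jacobson _ _ le_rfl
    refine hH.haus q fun n => ?_
    rw [SModEq.zero]
    obtain ⟨q', rfl⟩ := hq n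
    rw [← algebraMap_smul S ((PowerSeries.X : PowerSeries k) ^ n), map_pow, c.algebraMap_X_eq]
    exact Submodule.smul_mem_smul (Ideal.pow_mem_pow (Ideal.mul_mem_right _ _ c.x_mem) n)
      Submodule.mem_top
  · intro q hq
    obtain ⟨u, rfl⟩ := Ideal.Quotient.mk_surjective q
    rw [hX, Ideal.Quotient.eq_zero_iff_mem, Ideal.mem_span_singleton] at hq
    rw [Ideal.Quotient.eq_zero_iff_mem, Ideal.mem_span_singleton]
    exact c.dvd_of_dvd_algebraMap_X_mul (c.not_x_dvd_of_rank_ne_top hne)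
      (c.not_y_dvd_of_rank_ne_top hne) hq
  · intro q
    obtain ⟨u, rfl⟩ := Ideal.Quotient.mk_surjective q
    let a : Fin r → k := fun i => B.repr (Ideal.Quotient.mk J u) i
    have hu : u - ∑ i, a i • s i ∈ J := by
      rw [← Ideal.Quotient.eq_zero_iff_mem, hmk, B.sum_repr, sub_self]
    obtain ⟨s₁, hs₁, s₂, hs₂, hsum⟩ := Submodule.mem_sup.1 hu
    obtain ⟨v, rfl⟩ := Ideal.mem_span_singleton.1 hs₁
    refine ⟨a, Ideal.Quotient.mk _ v, ?_⟩
    rw [hX, ← hmk', ← map_add, Ideal.Quotient.eq]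
    rwa [← sub_sub, ← hsum, add_sub_cancel_left]
  · intro a q hq
    obtain ⟨u, rfl⟩ := Ideal.Quotient.mk_surjective q
    rw [hX, ← hmk', Ideal.Quotient.eq] at hq
    have hmem : ∑ i, a i • s i ∈ J := by
      rw [← sub_add_cancel (∑ i, a i • s i) (c.x * c.y * u)]
      exact add_mem (Ideal.mem_sup_right hq)
        (Ideal.mem_sup_left (Ideal.mul_mem_right _ _ (Ideal.mem_span_singleton_self _)))
    have h0 : ∑ i, a i • B i = 0 := by
      have := hmk a 0
      rw [zero_sub, map_zero, zero_sub, Ideal.Quotient.eq_zero_iff_mem.2 (neg_mem hmem)] at this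
      exact neg_eq_zero.1 this.symm
    funext i
    exact Fintype.linearIndependent_iff.1 B.linearIndependent a h0 i

end SmoothingChart

/-! ### Automatic degeneracies of the node -/

namespace SmoothingChart

universe u

variable {k S : Type u} [Field k] [CommRing S] [Algebra k S] [Algebra (PowerSeries k) S]
  [IsScalarTower k (PowerSeries k) S]

theorem le_rank_quotient_special (c : SmoothingChart k S) {m : ℕ} (hm : 1 ≤ m)
    (e : Module.Basis (Fin m) S (Module.Dual S (PrincipalParts (PowerSeries k) S m)))
    (τ : Fin m → PrincipalParts (PowerSeries k) S m) :
    ((m * (m - 1) : ℕ) : ℕ∞) ≤ Cardinal.toENat (Module.rank k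
      (S ⧸ (Ideal.span {algebraMap (PowerSeries k) S PowerSeries.X} ⊔ degeneracyIdeal e τ))) := by
  rw [degeneracyIdeal, maximalMinorsIdeal_square, c.algebraMap_X_eq]
  exact c.le_rank_quotient_of_mem_cornerIdeal (c.det_mem_cornerIdeal hm e τ)

theorem exists_rank_quotient_special_le (c : SmoothingChart k S) [CharZero k] {m : ℕ} (hm : 1 ≤ m) :
    ∃ (e : Module.Basis (Fin m) S (Module.Dual S (PrincipalParts (PowerSeries k) S m)))
      (τ : Fin m → PrincipalParts (PowerSeries k) S m),
      Cardinal.toENat (Module.rank k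
        (S ⧸ (Ideal.span {algebraMap (PowerSeries k) S PowerSeries.X} ⊔ degeneracyIdeal e τ))) ≤
        ((m * (m - 1) : ℕ) : ℕ∞) := by
  obtain ⟨e, τ, h⟩ := c.exists_degeneracyIdeal_eq m m
  refine ⟨e, τ, ?_⟩
  rw [h, maximalMinorsIdeal_square, c.algebraMap_X_eq, ← two_mul_choose_two]
  rcases hm.eq_or_lt with rfl | hm
  · have : (nodeMatrix c.x c.y 1 1).det = 1 := by
      simp [nodeMatrix, nodeColumn, powerVec]
    rw [this, Ideal.span_singleton_one, sup_top_eq, rank_subsingleton']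
    simp
  · obtain ⟨α, β, h, hα, hβ, hdet⟩ := det_nodeMatrix_eq (k := k) c.x c.y hm
    exact c.rank_quotient_le_of_eq (Nat.choose_pos hm) hα hβ hdet

theorem le_rank_quotient_degeneracyIdeal (c : SmoothingChart k S) {m n : ℕ} (hmn : 1 ≤ min m n)
    (e : Module.Basis (Fin m) S (Module.Dual S (PrincipalParts (PowerSeries k) S m)))
    (τ : Fin n → PrincipalParts (PowerSeries k) S m) :
    (((min m n + 2).choose 4 : ℕ) : ℕ∞) ≤
      Cardinal.toENat (Module.rank k (S ⧸ degeneracyIdeal e τ)) :=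
  c.le_rank_quotient_of_le_cornerIdeal hmn (c.degeneracyIdeal_le_cornerIdeal hmn e τ)

theorem exists_rank_quotient_le_pred (c : SmoothingChart k S) [CharZero k] (s : ℕ) :
    ∃ (e : Module.Basis (Fin (s + 1)) S (Module.Dual S (PrincipalParts (PowerSeries k) S (s + 1))))
      (τ : Fin s → PrincipalParts (PowerSeries k) S (s + 1)),
      Cardinal.toENat (Module.rank k (S ⧸ degeneracyIdeal e τ)) ≤
        (((s + 2).choose 4 : ℕ) : ℕ∞) := by
  obtain ⟨e, τ, h⟩ := c.exists_degeneracyIdeal_eq (s + 1) s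
  refine ⟨e, τ, ?_⟩
  rw [h]
  rcases Nat.eq_zero_or_pos s with rfl | hs
  -- For the empty list the only minor is the empty determinant `1`.
  · have : maximalMinorsIdeal (nodeMatrix c.x c.y (0 + 1) 0) = ⊤ := by
      rw [Ideal.eq_top_iff_one]
      simpa using minor_mem_maximalMinorsIdeal (s := 0) rfl (nodeMatrix c.x c.y (0 + 1) 0)
        (Fin.castLEOrderEmb (Nat.zero_le _)) (RelEmbedding.refl _)
    rw [this, rank_subsingleton']
    simp
  · exact c.rank_quotient_le_of_cornerIdeal_le hs
      (cornerIdeal_le_maximalMinorsIdeal_pred (k := k) c.x_mem c.y_mem s)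

theorem exists_rank_quotient_le_succ (c : SmoothingChart k S) [CharZero k] {m : ℕ} (hm : 1 ≤ m) :
    ∃ (e : Module.Basis (Fin m) S (Module.Dual S (PrincipalParts (PowerSeries k) S m)))
      (τ : Fin (m + 1) → PrincipalParts (PowerSeries k) S m),
      Cardinal.toENat (Module.rank k (S ⧸ degeneracyIdeal e τ)) ≤
        (((m + 2).choose 4 : ℕ) : ℕ∞) := by
  obtain ⟨e, τ, h⟩ := c.exists_degeneracyIdeal_eq m (m + 1)
  refine ⟨e, τ, ?_⟩
  rw [h]
  exact c.rank_quotient_le_of_cornerIdeal_le hm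
    (cornerIdeal_le_maximalMinorsIdeal_succ (k := k) c.x_mem c.y_mem m)

/-- The degeneracy locus of a list of length `m` has the same multiplicity on the special fibre and
on the generic fibre. -/
theorem rank_genericFibre_eq (c : SmoothingChart k S) (K : Type*) [Field K]
    [Algebra (PowerSeries k) K] {m r : ℕ}
    (e : Module.Basis (Fin m) S (Module.Dual S (PrincipalParts (PowerSeries k) S m)))
    (τ : Fin m → PrincipalParts (PowerSeries k) S m)
    (h : Cardinal.toENat (Module.rank k
      (S ⧸ (Ideal.span {algebraMap (PowerSeries k) S PowerSeries.X} ⊔ degeneracyIdeal e τ))) =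
        (r : ℕ∞)) :
    Cardinal.toENat (Module.rank K (K ⊗[PowerSeries k] (S ⧸ degeneracyIdeal e τ))) = (r : ℕ∞) := by
  rw [degeneracyIdeal, maximalMinorsIdeal_square] at h ⊢
  rw [c.algebraMap_X_eq] at h
  obtain ⟨b⟩ := c.nonempty_basis_quotient h
  rw [rank_eq_card_basis (b.baseChange K), Fintype.card_fin, Cardinal.toENat_nat]

end SmoothingChart

/-! ### The minima over all deformations of the node -/

section Node

universe u

variable {k : Type u} [Field k] (V : Def1Basis (node k))

theorem exists_nonempty_smoothingChart :
    ∃ a : Fin V.d → k, Nonempty (SmoothingChart k (TotalRing V a)) := by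
  obtain ⟨l, hl⟩ := exists_constantCoeff_ne_zero V
  refine ⟨Pi.single l 1, nonempty_smoothingChart V _ ?_⟩
  rwa [Finset.sum_eq_single l (fun i _ hi => by rw [Pi.single_eq_of_ne hi, zero_smul]) (by simp),
    Pi.single_eq_same, one_smul]

theorem smoothingChart_of_basis [CharZero k] {m : ℕ} (hm : 1 < m) (a : Fin V.d → k)
    (e : Module.Basis (Fin m) (TotalRing V a)
      (Module.Dual (TotalRing V a) (PrincipalParts (PowerSeries k) (TotalRing V a) m))) :
    Nonempty (SmoothingChart k (TotalRing V a)) := by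
  by_cases h : MvPowerSeries.constantCoeff (∑ l, a l • V.δ l 0) = 0
  · exact ((isEmpty_basis_dual_of_constantCoeff_eq_zero V a hm h).false e).elim
  · exact nonempty_smoothingChart V a h

theorem AD1_node [CharZero k] {m : ℕ} (hm : 1 ≤ m) : AD1 V m = ((m * (m - 1) : ℕ) : ℕ∞) := by
  refine le_antisymm ?_ (le_sInf ?_)
  · obtain ⟨a, ⟨c⟩⟩ := exists_nonempty_smoothingChart V
    obtain ⟨e, τ, h⟩ := c.exists_rank_quotient_special_le hm
    exact sInf_le_of_le ⟨a, e, τ, rfl⟩ h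
  · rintro _ ⟨a, e, τ, rfl⟩
    rcases hm.eq_or_lt with rfl | hm'
    -- For `m = 1` the zero direction is not excluded, but the bound is zero.
    · simp
    · obtain ⟨c⟩ := smoothingChart_of_basis V hm' a e
      exact c.le_rank_quotient_special hm e τ

theorem le_minColength_node [CharZero k] {m n : ℕ} (hm : 1 < m) (hn : 1 ≤ n) :
    (((min m n + 2).choose 4 : ℕ) : ℕ∞) ≤ minColength V m n := by
  refine le_sInf ?_
  rintro _ ⟨a, e, τ, rfl⟩
  obtain ⟨c⟩ := smoothingChart_of_basis V hm a e
  exact c.le_rank_quotient_degeneracyIdeal (le_min hm.le hn) e τ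

theorem AD2_node [CharZero k] {m : ℕ} (hm : 1 ≤ m) : AD2 V m = (((m + 1).choose 4 : ℕ) : ℕ∞) := by
  obtain ⟨s, rfl⟩ := Nat.exists_eq_add_of_le' hm
  refine le_antisymm ?_ ?_
  · obtain ⟨a, ⟨c⟩⟩ := exists_nonempty_smoothingChart V
    obtain ⟨e, τ, h⟩ := c.exists_rank_quotient_le_pred s
    exact sInf_le_of_le ⟨a, e, τ, rfl⟩ h
  · rcases Nat.eq_zero_or_pos s with rfl | hs
    · simp [Nat.choose_eq_zero_of_lt]
    · simpa [AD2] using le_minColength_node V (m := s + 1) (n := s) (by omega) hs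

theorem AD11_node [CharZero k] {m : ℕ} (hm : 1 ≤ m) : AD11 V m = (((m + 2).choose 4 : ℕ) : ℕ∞) := by
  refine le_antisymm ?_ ?_
  · obtain ⟨a, ⟨c⟩⟩ := exists_nonempty_smoothingChart V
    obtain ⟨e, τ, h⟩ := c.exists_rank_quotient_le_succ hm
    exact sInf_le_of_le ⟨a, e, τ, rfl⟩ h
  · rcases hm.eq_or_lt with rfl | hm
    · simp
    · simpa [AD11] using le_minColength_node V (m := m) (n := m + 1) hm (by omega)

theorem limitingWeightOneCount_node [CharZero k] {m : ℕ} (hm : 1 ≤ m) :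
    LimitingWeightOneCount V m ((m * (m - 1) : ℕ) : ℕ∞) := by
  obtain ⟨l, hl⟩ := exists_constantCoeff_ne_zero V
  -- This linear form computes the constant term of the perturbation, so its nonvanishing is exactly
  -- the condition for a smoothing chart.
  refine ⟨∑ l, MvPolynomial.C (MvPowerSeries.constantCoeff (V.δ l 0)) * MvPolynomial.X l, ?_, ?_⟩
  · intro h
    have := congrArg (MvPolynomial.coeff (Finsupp.single l 1)) h
    simp only [MvPolynomial.coeff_sum, MvPolynomial.coeff_C_mul, MvPolynomial.coeff_X,
      Finsupp.single_left_inj one_ne_zero, mul_ite, mul_one, mul_zero, Finset.sum_ite_eq',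
      Finset.mem_univ, if_true, MvPolynomial.coeff_zero] at this
    exact hl this
  · intro a ha
    have ha' : MvPowerSeries.constantCoeff (∑ l, a l • V.δ l 0) ≠ 0 := by
      simpa [mul_comm] using ha
    obtain ⟨c⟩ := nonempty_smoothingChart V a ha'
    rw [AD1_node V hm]
    refine ⟨?_, fun e τ h => c.rank_genericFibre_eq _ e τ h⟩
    obtain ⟨e, τ, h⟩ := c.exists_rank_quotient_special_le hm
    exact ⟨e, τ, le_antisymm h (c.le_rank_quotient_special hm e τ)⟩

end Node

end AutomaticDegeneracy

theorem mainTheorem1 {k : Type*} [Field k] [IsAlgClosed k] [CharZero k]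
    (V : AutomaticDegeneracy.Def1Basis (AutomaticDegeneracy.node k)) (m : ℕ) (hm : 1 ≤ m) :
    (AutomaticDegeneracy.AD1 V m = ((m * (m - 1) : ℕ) : ℕ∞) ∧
      AutomaticDegeneracy.LimitingWeightOneCount V m ((m * (m - 1) : ℕ) : ℕ∞)) ∧
    AutomaticDegeneracy.AD2 V m = ((Nat.choose (m + 1) 4 : ℕ) : ℕ∞) ∧
    AutomaticDegeneracy.AD11 V m = ((Nat.choose (m + 2) 4 : ℕ) : ℕ∞) :=
  ⟨⟨AutomaticDegeneracy.AD1_node V hm, AutomaticDegeneracy.limitingWeightOneCount_node V hm⟩,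
    AutomaticDegeneracy.AD2_node V hm, AutomaticDegeneracy.AD11_node V hm⟩
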